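/- **Setting.** Let $\mathbb I=[0,1]$ and let $(X_i,Y_i)$, $i\ge 1$, be i.i.d. copies of $(X,Y)$, where $X$ is a random predictor process with paths in $L^2(\mathbb I)$ and $Y\in\mathcal Y\subset\mathbb R$. The log-likelihood is of exponential-family form $\ell(y;a)=\{ya-b(a)\}/d+c(y)$, $y\in\mathcal Y$, $a\in\mathbb R$, with dispersion $d>0$, and $F=b'$ is the link function. Let $m\ge 1$; $H^m(\mathbb I)$ is the set of functions $\beta$ on $\mathbb I$ with $\beta^{(0)},\dots,\beta^{(m-1)}$ absolutely continuous and $\beta^{(m)}\in L^2(\mathbb I)$; $J(\beta,\tilde\beta)=\int_0^1\beta^{(m)}\tilde\beta^{(m)}$; $\mathcal H=\mathbb R\times H^m(\mathbb I)$. For $\theta=(\alpha,\beta)\in\mathcal H$ put $\eta_\theta(x)=\alpha+\int_0^1x(t)\beta(t)\,dt$. Dots and primes on $\ell$ denote derivatives in $a$. **Assumptions.** Let $\theta_0=(\alpha_0,\beta_0)\in\mathcal H$ (for instance the pseudo-true parameter $\tilde\theta_0$ below), let $B(X)=-\mathbb E\{\ddot\ell_a(Y;\eta_{\theta_0}(X))\mid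 X\}$ and $C(s,t)=\mathbb E\{B(X)X(t)X(s)\}$, and suppose: 1. (a) $\ell(y;\cdot)$ is three times continuously differentiable and strictly concave, and for some $C_0,C_1>0$, a.s., $\mathbb E\{\exp(\sup_a|\ddot\ell_a(Y;a)|/C_0)\mid X\}\le C_1$ and $\mathbb E\{\exp(\sup_a|\ell_a'''(Y;a)|/C_0)\mid X\}\le C_1$. (b) $C_2^{-1}\le B(X)\le C_2$ a.s. for some $C_2>0$, and $\mathbb E\{B(X)X(t)\}=0$ for all $t\in\mathbb I$. (c) $\mathbb E\{\epsilon^2\}<\infty$ for $\epsilon=\dot\ell_a(Y;\eta_{\theta_0}(X))$. 2. $\mathbb E\{X(t)^2\}<\infty$ for all $t$, $C$ is continuous on $\mathbb I\times\mathbb I$, and $\beta\in L^2(\mathbb I)$, $\int_0^1C(s,\cdot)\beta(s)\,ds=0$ imply $\beta=0$. 3. With $V(\beta,\tilde\beta)=\int_0^1\!\int_0^1C(s,t)\beta(t)\tilde\beta(s)\,ds\,dt$, there are constants $a\ge0$, $C_\varphi>0$, $k>a+1/2$, functions $\varphi_\nu\in H^m(\mathbb I)$, $\nu\ge1$, with $\|\varphi_\nu\|_{L^2}\le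 C_\varphi\nu^a$, and a nondecreasing sequence $\rho_\nu\ge0$ with $c_1\nu^{2k}\le\rho_\nu\le c_2\nu^{2k}$ for all large $\nu$ ($c_1,c_2>0$), such that $V(\varphi_\nu,\varphi_\mu)=\delta_{\nu\mu}$, $J(\varphi_\nu,\varphi_\mu)=\rho_\nu\delta_{\nu\mu}$, and every $\beta\in H^m(\mathbb I)$ satisfies $\beta=\sum_\nu V(\beta,\varphi_\nu)\varphi_\nu$ with convergence in the norm $(V+J)^{1/2}$. 4. $\mathbb E\exp(s\|X\|_{L^2})<\infty$ for some $s\in(0,1)$, and $\mathbb E\langle X,\beta\rangle_{L^2}^4\le M_0(\mathbb E\langle X,\beta\rangle_{L^2}^2)^2$ for all $\beta\in H^m(\mathbb I)$, for some $M_0>0$. 5. The tuning parameters $\lambda=\lambda_n>0$ and $h=\lambda^{1/(2k)}$ satisfy, as $n\to\infty$, $h=o(1)$, $n^{-1/2}h^{-1}=o(1)$, $\log(h^{-1})=O(\log n)$ and $n^{-1/2}h^{-(a+1)-(2k-2a-1)/(4m)}(\log n)^2(\log\log n)^{1/2}=o(1)$. **Test statistic.** Let $\hat\theta_n\in\mathcal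 H$ be such that, with probability tending to one, it maximizes $\frac1n\sum_{i=1}^n\ell(Y_i;\eta_\theta(X_i))-\frac\lambda2J(\beta,\beta)$ over $\theta=(\alpha,\beta)\in\mathcal H$; let $\hat e_i=Y_i-F(\eta_{\hat\theta_n}(X_i))$. Let $\hat\psi_1,\dots,\hat\psi_p$ be orthonormal eigenfunctions of the sample covariance operator of $X_1,\dots,X_n$ for its $p$ largest eigenvalues, and $\widehat X_i^p=(\langle X_i,\hat\psi_1\rangle_{L^2},\dots,\langle X_i,\hat\psi_p\rangle_{L^2})^\top$. Let $\mathrm{Ang}(u,v)=\arccos\{\langle u,v\rangle/(\|u\|\|v\|)\}$, with the value $\pi/2$ if $u=0$ or $v=0$, and $$T_n=\frac1{n(n-1)(n-2)}\sum_{i,j,k\ \text{distinct}}\hat e_i\hat e_j\,\mathrm{Ang}\big(\widehat X_i^p-\widehat X_k^p,\ \widehat X_k^p-\widehat X_j^p\big).$$ **Theorem.** Suppose moreover that the alternative $H_1$ holds: $P\big(\mathbb E\{Y\mid X\}\ne F(\eta_\theta(X))\big)>0$ for every $\theta\in\mathcal H$. Let $\tilde\theta_0$ be a maximizer of $\mathbb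 E\{\ell(Y;\eta_\theta(X))\}$ over $\theta\in\mathcal H$ (these expectations being finite), and $\tilde\epsilon_i=\dot\ell_a(Y_i;\eta_{\tilde\theta_0}(X_i))$. If $p=p_n\to\infty$ and $p=o(n^{1/4})$, then $$T_n\ \xrightarrow{\;p\;}\ d^2\,\mathbb E\big\{\tilde\epsilon_1\tilde\epsilon_2\,\mathrm{Ang}(X_1-X_3,\,X_3-X_2)\big\},\qquad \mathbb E\big\{\tilde\epsilon_1\tilde\epsilon_2\,\mathrm{Ang}(X_1-X_3,\,X_3-X_2)\big\}>0,$$ where the angle in the limit is taken in $L^2(\mathbb I)$. In particular the limit is $\mathbb E\{\tilde\epsilon_1\tilde\epsilon_2\mathrm{Ang}(X_{13},X_{32})\}$ when $d=1$. Consequently $nh\,T_n\to\infty$ in probability. -/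

import Mathlib

open MeasureTheory ProbabilityTheory Filter Topology Asymptotics Set

noncomputable section

namespace GFLM

/-- The Hilbert space `L²([0,1])`. -/
abbrev L2I : Type := Lp ℝ 2 (volume.restrict (Icc (0 : ℝ) 1))

/-- `L²([0,1])` with its Borel σ-algebra. -/
instance instMeasurableSpaceL2I : MeasurableSpace L2I := borel L2I

instance instBorelSpaceL2I : BorelSpace L2I := ⟨rfl⟩

/-! ### Sobolev space, roughness penalty, parameter space -/

/-- Membership in `H^m([0,1])`: the derivatives of order `0, …, m-1` are absolutely continuous on
`[0,1]` and the derivative of order `m` is square integrable. -/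
def MemSobolev (m : ℕ) (β : ℝ → ℝ) : Prop :=
  (∀ j < m, AbsolutelyContinuousOnInterval (iteratedDerivWithin j β (Icc 0 1)) 0 1) ∧
    MemLp (iteratedDerivWithin m β (Icc 0 1)) 2 (volume.restrict (Icc (0 : ℝ) 1))

/-- `J(β, β') = ∫₀¹ β^{(m)}(t) β'^{(m)}(t) dt`. -/
def roughness (m : ℕ) (β β' : ℝ → ℝ) : ℝ :=
  ∫ t in (0 : ℝ)..1,
    iteratedDerivWithin m β (Icc 0 1) t * iteratedDerivWithin m β' (Icc 0 1) t

/-- The parameter space `ℋ = ℝ × H^m([0,1])` of pairs `θ = (α, β)`. -/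
def paramSpace (m : ℕ) : Set (ℝ × (ℝ → ℝ)) := {θ | MemSobolev m θ.2}

/-- The linear predictor `α + ∫₀¹ x(t) β(t) dt`. -/
def linPred (x : L2I) (θ : ℝ × (ℝ → ℝ)) : ℝ := θ.1 + ∫ t in (0 : ℝ)..1, x t * θ.2 t

/-! ### The model: link function and log-likelihood -/

/-- `ℓ(y; a) = (y a - b(a)) / d + c(y)`, `y ∈ 𝒴`, is an exponential-family log-likelihood with
dispersion `d > 0`, and `F = b'` is the mean as a function of the linear predictor. -/
structure IsExpFamilyLogLik (𝒴 : Set ℝ) (ℓ : ℝ → ℝ → ℝ) (F : ℝ → ℝ) (d : ℝ) : Prop where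
  dispersion_pos : 0 < d
  form : ∃ b c : ℝ → ℝ, (∀ a, HasDerivAt b (F a) a) ∧
    ∀ y ∈ 𝒴, ∀ a, ℓ y a = (y * a - b a) / d + c y

/-- The score `∂ℓ/∂a (y; α + ∫ x β)` at the parameter `θ = (α, β)`. -/
def score (ℓ : ℝ → ℝ → ℝ) (θ : ℝ × (ℝ → ℝ)) (x : L2I) (y : ℝ) : ℝ := deriv (ℓ y) (linPred x θ)

section Population

variable {Ω : Type*} [MeasurableSpace Ω]

/-- The σ-algebra generated by the predictor. -/
abbrev sigmaX (X : Ω → L2I) : MeasurableSpace Ω := MeasurableSpace.comap X inferInstance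

/-- `B(X) = -E{∂²ℓ/∂a² (Y; α₀ + ∫ X β₀) | X}`. -/
def weightB (P : Measure Ω) (ℓ : ℝ → ℝ → ℝ) (X : Ω → L2I) (Y : Ω → ℝ) (θ₀ : ℝ × (ℝ → ℝ)) :
    Ω → ℝ :=
  fun ω => -(P[fun ω' => iteratedDeriv 2 (ℓ (Y ω')) (linPred (X ω') θ₀) | sigmaX X]) ω

/-- `x` is a jointly measurable process `x ω t` whose paths represent the `L²`-valued `X`. -/
def IsProcessOf (P : Measure Ω) (X : Ω → L2I) (x : Ω → ℝ → ℝ) : Prop :=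
  Measurable (Function.uncurry x) ∧
    ∀ᵐ ω ∂P, (X ω : ℝ → ℝ) =ᵐ[volume.restrict (Icc (0 : ℝ) 1)] x ω

/-- The bound `E{exp(sup_a |∂ʲℓ/∂aʲ (Y; a)| / C₀) | X} ≤ C₁` a.s.; finiteness of the supremum and
of the expectation are spelled out. -/
def ExpSupBound (P : Measure Ω) (ℓ : ℝ → ℝ → ℝ) (X : Ω → L2I) (Y : Ω → ℝ) (j : ℕ)
    (C₀ C₁ : ℝ) : Prop :=
  (∀ᵐ ω ∂P, BddAbove (range fun a => |iteratedDeriv j (ℓ (Y ω)) a|)) ∧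
  Integrable (fun ω => Real.exp ((⨆ a, |iteratedDeriv j (ℓ (Y ω)) a|) / C₀)) P ∧
  ∀ᵐ ω ∂P,
    (P[fun ω' => Real.exp ((⨆ a, |iteratedDeriv j (ℓ (Y ω')) a|) / C₀) | sigmaX X]) ω ≤ C₁

/-- Smoothness, concavity and tail conditions on the log-likelihood; bounds on the weight `B(X)`;
weighted centring of the predictor; finite variance of the score at `θ₀`. -/
structure ModelAssumption (P : Measure Ω) (𝒴 : Set ℝ) (ℓ : ℝ → ℝ → ℝ) (X : Ω → L2I)
    (x : Ω → ℝ → ℝ) (Y : Ω → ℝ) (θ₀ : ℝ × (ℝ → ℝ)) : Prop where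
  smooth : ∀ y ∈ 𝒴, ContDiff ℝ 3 (ℓ y)
  concave : ∀ y ∈ 𝒴, StrictConcaveOn ℝ univ (ℓ y)
  tails : ∃ C₀ > 0, ∃ C₁ > 0, ExpSupBound P ℓ X Y 2 C₀ C₁ ∧ ExpSupBound P ℓ X Y 3 C₀ C₁
  weight_bounds : ∃ C₂ > 0, ∀ᵐ ω ∂P,
    C₂⁻¹ ≤ weightB P ℓ X Y θ₀ ω ∧ weightB P ℓ X Y θ₀ ω ≤ C₂
  centred : ∀ t ∈ Icc (0 : ℝ) 1, ∫ ω, weightB P ℓ X Y θ₀ ω * x ω t ∂P = 0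
  score_sq : MemLp (fun ω => score ℓ θ₀ (X ω) (Y ω)) 2 P

/-- The weighted covariance function `C(s, t) = E{B X(t) X(s)}`. -/
def covFun (P : Measure Ω) (B : Ω → ℝ) (x : Ω → ℝ → ℝ) (s t : ℝ) : ℝ :=
  ∫ ω, B ω * x ω t * x ω s ∂P

/-- `C` is well defined and continuous on `[0,1]²`, and its integral operator is injective on
`L²([0,1])`. -/
structure CovarianceAssumption (P : Measure Ω) (B : Ω → ℝ) (x : Ω → ℝ → ℝ) : Prop where
  sq_integrable : ∀ t ∈ Icc (0 : ℝ) 1, MemLp (fun ω => x ω t) 2 P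
  continuous : ContinuousOn (fun q : ℝ × ℝ => covFun P B x q.1 q.2) (Icc 0 1 ×ˢ Icc 0 1)
  injective : ∀ β : L2I,
    (∀ᵐ t ∂(volume.restrict (Icc (0 : ℝ) 1)), ∫ s in (0 : ℝ)..1, covFun P B x s t * β s = 0) →
      β = 0

/-- `V(β, β') = ∫₀¹ ∫₀¹ C(s, t) β(t) β'(s) ds dt`. -/
def formV (C : ℝ → ℝ → ℝ) (β β' : ℝ → ℝ) : ℝ :=
  ∫ t in (0 : ℝ)..1, ∫ s in (0 : ℝ)..1, C s t * β t * β' s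

/-- A sequence `φ₁, φ₂, …` in `H^m` that diagonalizes `V` and `J` simultaneously, with `L²`-norms
at most `C_φ ν^a` and `J`-eigenvalues `ρ_ν ≍ ν^{2k}` (as `ν → ∞`, the first ones may vanish), such
that every `β ∈ H^m` is the sum of its expansion `∑ V(β, φ_ν) φ_ν` in the norm given by `V + J`.
The index `ν ≥ 1` is `i + 1` with `i : ℕ`. -/
def EigenAssumption (m : ℕ) (C : ℝ → ℝ → ℝ) (a k : ℝ) : Prop :=
  0 ≤ a ∧ a + 1 / 2 < k ∧
  ∃ (φ : ℕ → ℝ → ℝ) (ρ : ℕ → ℝ),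
    (∀ i, MemSobolev m (φ i)) ∧
    (∃ Cφ > 0, ∀ i : ℕ, Real.sqrt (∫ t in (0 : ℝ)..1, φ i t ^ 2) ≤ Cφ * ((i : ℝ) + 1) ^ a) ∧
    (∀ i j, formV C (φ i) (φ j) = if i = j then 1 else 0) ∧
    (∀ i j, roughness m (φ i) (φ j) = if i = j then ρ i else 0) ∧
    Monotone ρ ∧ (∀ i, 0 ≤ ρ i) ∧
    (∃ c₁ > 0, ∃ c₂ > 0, ∀ᶠ i : ℕ in atTop,
      c₁ * ((i : ℝ) + 1) ^ (2 * k) ≤ ρ i ∧ ρ i ≤ c₂ * ((i : ℝ) + 1) ^ (2 * k)) ∧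
    ∀ β, MemSobolev m β →
      Tendsto (fun N : ℕ =>
        let r : ℝ → ℝ := fun t => β t - ∑ i ∈ Finset.range N, formV C β (φ i) * φ i t
        formV C r r + roughness m r r) atTop (𝓝 0)

/-- Exponential moment of `‖X‖` and the fourth moment inequality for `⟨X, β⟩`, `β ∈ H^m`. -/
structure MomentAssumption (P : Measure Ω) (m : ℕ) (X : Ω → L2I) : Prop where
  exp_moment : ∃ s ∈ Ioo (0 : ℝ) 1, Integrable (fun ω => Real.exp (s * ‖X ω‖)) P
  fourth : ∃ M₀ > 0, ∀ β, MemSobolev m β →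
    ∫ ω, (∫ t in (0 : ℝ)..1, X ω t * β t) ^ 4 ∂P ≤
      M₀ * (∫ ω, (∫ t in (0 : ℝ)..1, X ω t * β t) ^ 2 ∂P) ^ 2

/-- `θ` maximizes the expected log-likelihood over `ℋ`. -/
def IsPseudoTrue (P : Measure Ω) (m : ℕ) (ℓ : ℝ → ℝ → ℝ) (X : Ω → L2I) (Y : Ω → ℝ)
    (θ : ℝ × (ℝ → ℝ)) : Prop :=
  θ ∈ paramSpace m ∧
  (∀ θ' ∈ paramSpace m, Integrable (fun ω => ℓ (Y ω) (linPred (X ω) θ')) P) ∧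
  IsMaxOn (fun θ' => ∫ ω, ℓ (Y ω) (linPred (X ω) θ') ∂P) (paramSpace m) θ

/-- The alternative: `P(E{Y | X} ≠ F(α + ∫ X β)) > 0` for every `(α, β) ∈ ℋ`. -/
def Alternative (P : Measure Ω) (m : ℕ) (F : ℝ → ℝ) (X : Ω → L2I) (Y : Ω → ℝ) : Prop :=
  ∀ θ ∈ paramSpace m, 0 < P {ω | (P[Y | sigmaX X]) ω ≠ F (linPred (X ω) θ)}

end Population

/-! ### Tuning parameter -/

/-- The bandwidth `h = λ^{1/(2k)}`. -/
def bandwidth (k lam : ℝ) : ℝ := lam ^ (1 / (2 * k))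

/-- Rate conditions on `h_n = λ_n^{1/(2k)}`. -/
structure RateAssumption (m : ℕ) (a k : ℝ) (lam : ℕ → ℝ) : Prop where
  pos : ∀ n, 0 < lam n
  h_small : Tendsto (fun n => bandwidth k (lam n)) atTop (𝓝 0)
  nh_large : Tendsto (fun n : ℕ => (n : ℝ) ^ (-(1 / 2) : ℝ) * (bandwidth k (lam n))⁻¹) atTop (𝓝 0)
  log_h : (fun n => Real.log (bandwidth k (lam n))⁻¹) =O[atTop] fun n : ℕ => Real.log n
  remainder : Tendsto (fun n : ℕ =>
    (n : ℝ) ^ (-(1 / 2) : ℝ) *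
      bandwidth k (lam n) ^ (-(a + 1) - (2 * k - 2 * a - 1) / (4 * m)) *
      Real.log n ^ 2 * Real.log (Real.log n) ^ (1 / 2 : ℝ)) atTop (𝓝 0)

/-! ### The estimator and the test statistic, for a sample `(X₀, Y₀), …, (X_{n-1}, Y_{n-1})` -/

/-- The penalized log-likelihood `ℓ_{n,λ}(θ)`. -/
def penLogLik (ℓ : ℝ → ℝ → ℝ) (m : ℕ) (lam : ℝ) (n : ℕ) (X : ℕ → L2I) (Y : ℕ → ℝ)
    (θ : ℝ × (ℝ → ℝ)) : ℝ :=
  (1 / n : ℝ) * ∑ i ∈ Finset.range n, ℓ (Y i) (linPred (X i) θ) - lam / 2 * roughness m θ.2 θ.2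

/-- `θ` maximizes the penalized log-likelihood over `ℋ`. -/
def IsEstimate (ℓ : ℝ → ℝ → ℝ) (m : ℕ) (lam : ℝ) (n : ℕ) (X : ℕ → L2I) (Y : ℕ → ℝ)
    (θ : ℝ × (ℝ → ℝ)) : Prop :=
  θ ∈ paramSpace m ∧ IsMaxOn (penLogLik ℓ m lam n X Y) (paramSpace m) θ

/-- The sample mean curve. -/
def sampleMean (n : ℕ) (X : ℕ → L2I) : L2I := (1 / n : ℝ) • ∑ i ∈ Finset.range n, X i

/-- The sample covariance operator `u ↦ n⁻¹ ∑ᵢ ⟨Xᵢ - X̄, u⟩ (Xᵢ - X̄)`. -/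
def sampleCov (n : ℕ) (X : ℕ → L2I) (u : L2I) : L2I :=
  (1 / n : ℝ) • ∑ i ∈ Finset.range n,
    inner ℝ (X i - sampleMean n X) u • (X i - sampleMean n X)

/-- `ψ₀, …, ψ_{p-1}` are the estimated eigenfunctions: orthonormal eigenfunctions of the sample
covariance operator for its `p` largest eigenvalues (with multiplicity, in decreasing order). -/
def IsEstimatedFPC (n p : ℕ) (X : ℕ → L2I) (ψ : Fin p → L2I) : Prop :=
  Orthonormal ℝ ψ ∧ ∃ κ : Fin p → ℝ, Antitone κ ∧
    (∀ ν, sampleCov n X (ψ ν) = κ ν • ψ ν) ∧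
    ∀ u : L2I, (∀ ν, inner ℝ (ψ ν) u = 0) → ∀ ν, inner ℝ (sampleCov n X u) u ≤ κ ν * ‖u‖ ^ 2

/-- The vector `(⟨x, ψ₁⟩, …, ⟨x, ψ_p⟩)` of scores of a curve `x`, in Euclidean space. -/
def fpcScores {p : ℕ} (ψ : Fin p → L2I) (x : L2I) : EuclideanSpace ℝ (Fin p) :=
  WithLp.toLp 2 fun ν => inner ℝ x (ψ ν)

/-- The residual `y - F(α + ∫ x β)`. -/
def residual (F : ℝ → ℝ) (θ : ℝ × (ℝ → ℝ)) (x : L2I) (y : ℝ) : ℝ := y - F (linPred x θ)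

/-- The statistic `T_n`; the sum is over triples of pairwise distinct indices. -/
def testStat (F : ℝ → ℝ) (n : ℕ) {p : ℕ} (X : ℕ → L2I) (Y : ℕ → ℝ) (θ : ℝ × (ℝ → ℝ))
    (ψ : Fin p → L2I) : ℝ :=
  (1 / (n * (n - 1) * (n - 2)) : ℝ) *
    ∑ i ∈ Finset.range n, ∑ j ∈ Finset.range n, ∑ k ∈ Finset.range n,
      if i ≠ j ∧ j ≠ k ∧ i ≠ k then
        residual F θ (X i) (Y i) * residual F θ (X j) (Y j) *
          InnerProductGeometry.angle
            (fpcScores ψ (X i) - fpcScores ψ (X k)) (fpcScores ψ (X k) - fpcScores ψ (X j))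
      else 0

/-- The quantity `E{ε̃₁ ε̃₂ Ang(X₁ - X₃, X₃ - X₂)}`, with `ε̃` the score at `θ` and the angle taken in
`L²([0,1])`, written with the first three observations of the i.i.d. sequence. -/
def scoreAngleMean {Ω : Type*} [MeasurableSpace Ω] (P : Measure Ω) (ℓ : ℝ → ℝ → ℝ)
    (θ : ℝ × (ℝ → ℝ)) (X : ℕ → Ω → L2I) (Y : ℕ → Ω → ℝ) : ℝ :=
  ∫ ω, score ℓ θ (X 0 ω) (Y 0 ω) * score ℓ θ (X 1 ω) (Y 1 ω) *
    InnerProductGeometry.angle (X 0 ω - X 2 ω) (X 2 ω - X 1 ω) ∂P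

end GFLM

end

/-!
The statistic is a U-statistic of order three, disturbed by estimated residuals and estimated angles.
Both disturbances vanish in mean, so the law of large numbers for U-statistics gives the limit;
positive definiteness of the angle kernel makes the limit positive under the alternative.
Convergence in probability is expressed as convergence along the filter `probFilter`.

*Angles.* The scores on the estimated principal components have the same angles as the orthogonal
projections of the curves. The estimated components leave a smaller mean squared remainder than any
subspace of fixed finite dimension (Ky Fan), so the remainder tends to zero as soon as `p → ∞`. As
short differences of curves are rare, the angles converge in mean (`tendsto_tripleAvg_angle`).

*Residuals.* The parameters of penalized norm at most one are an ellipsoid in the eigenfunctions of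
`V` and `J`, whose effective dimension `∑ 1 / (1 + λ ρ i)` is `o(n ^ (1 / 2))` by the rate conditions.
Over such ellipsoids the empirical second moments are bounded by the population ones up to a small
error (`IsFeatureSystem.eventually_avg_sq_le`), empirical correlations with a residual orthogonal
to all features vanish uniformly (`IsFeatureSystem.eventually_abs_avg_mul_le`), and functions with
coefficients bounded away from zero are not small in empirical mean
(`IsFeatureSystem.eventually_le_avg_min`). The residual at the pseudo-true parameter is orthogonal to
the features by the first-order condition. By concavity of the penalized log-likelihood the estimation
error may be shrunk to the unit ball; the basic inequality of maximum likelihood then shows that the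
error lies inside the ball, and that the mean Bregman divergence of the cumulant function between
the fitted and the pseudo-true linear predictors tends to zero (`eventually_avg_bregman_le`). That
divergence dominates the squared difference of the fitted means, because the link is Lipschitz. No
rate of convergence of the estimator is needed.

*Positivity.* With `U` the normalization of `X - x` (and `0` where `X = x`), the angle
`Ang(X₁ - x, x - X₂)` is `π / 2 + arcsin ⟨U₁, U₂⟩`. The constant does not contribute, as the residual has
mean zero. The arcsine series has positive coefficients, and powers of an inner product are positive
semidefinite kernels, so the limit is nonnegative. If it vanished, then for almost every centre `x`
all odd directional moments of the residual would vanish, hence the differences of the masses of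
opposite half-spaces with boundary through `x` (`integral_mul_sign_inner_eq_zero`). Varying `x` along
the law of `X`, all half-spaces have mass zero (`integral_indicator_Ioi_eq_zero`), so the residual has
conditional mean zero given `X`, which the alternative excludes (`integral_mul_angle_pos`).

Finally `n h → ∞`, so that `n h T` diverges along with the positive limit of `T`.
-/

noncomputable section

namespace GFLM

/-! ### Convergence in probability as convergence along a filter -/

section InProbability

variable {Ω : Type*} [MeasurableSpace Ω]

/-- The filter on `ℕ × Ω` of the sequences of events whose (outer) probability tends to one. -/
def probFilter (P : Measure Ω) : Filter (ℕ × Ω) where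
  sets := {S | Tendsto (fun n => P {ω | (n, ω) ∉ S}) atTop (𝓝 0)}
  univ_sets := by simp
  sets_of_superset := by
    intro S T hS hST
    refine tendsto_of_tendsto_of_tendsto_of_le_of_le tendsto_const_nhds hS (fun _ => zero_le) ?_
    intro n
    exact measure_mono fun ω hω h => hω (hST h)
  inter_sets := by
    intro S T hS hT
    have h := Tendsto.add hS hT
    rw [add_zero] at h
    refine tendsto_of_tendsto_of_tendsto_of_le_of_le tendsto_const_nhds h (fun _ => zero_le) ?_
    intro n
    refine (measure_mono ?_).trans (measure_union_le _ _)
    intro ω hω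
    by_contra hc
    simp only [mem_union, mem_ofPred_eq, not_or, not_not] at hc
    exact hω hc

variable {P : Measure Ω}

lemma eventually_probFilter {p : ℕ × Ω → Prop} :
    (∀ᶠ q in probFilter P, p q) ↔ Tendsto (fun n => P {ω | ¬ p (n, ω)}) atTop (𝓝 0) := Iff.rfl

lemma tendsto_fst_probFilter : Tendsto Prod.fst (probFilter P) atTop := by
  rw [tendsto_atTop]
  intro N
  rw [eventually_probFilter]
  refine tendsto_const_nhds.congr' ?_
  filter_upwards [eventually_ge_atTop N] with n hn
  simp [hn]

lemma eventually_probFilter_of_ae {p : ℕ × Ω → Prop} (h : ∀ n, ∀ᵐ ω ∂P, p (n, ω)) :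
    ∀ᶠ q in probFilter P, p q := by
  rw [eventually_probFilter]
  refine tendsto_const_nhds.congr fun n => ?_
  exact (h n).symm

lemma tendstoInMeasure_iff_probFilter {T : ℕ → Ω → ℝ} {c : ℝ} :
    TendstoInMeasure P T atTop (fun _ => c) ↔
      Tendsto (fun q : ℕ × Ω => T q.1 q.2) (probFilter P) (𝓝 c) := by
  rw [tendstoInMeasure_iff_dist, Metric.tendsto_nhds]
  refine forall₂_congr fun ε _ => ?_
  rw [eventually_probFilter]
  simp only [not_lt]

/-- Markov's inequality. -/
lemma eventually_lt_of_lintegral {f : ℕ → Ω → ENNReal} (hf : ∀ n, AEMeasurable (f n) P)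
    {a : ℕ → ENNReal} (ha : Tendsto a atTop (𝓝 0)) (hfa : ∀ᶠ n in atTop, ∫⁻ ω, f n ω ∂P ≤ a n)
    {ε : ENNReal} (hε : ε ≠ 0) (hε' : ε ≠ ⊤) :
    ∀ᶠ q in probFilter P, f q.1 q.2 < ε := by
  rw [eventually_probFilter]
  have h : Tendsto (fun n => a n / ε) atTop (𝓝 0) := by
    have := ENNReal.Tendsto.div_const (b := ε) ha (Or.inr hε)
    simpa using this
  refine tendsto_of_tendsto_of_tendsto_of_le_of_le' tendsto_const_nhds h
    (Eventually.of_forall fun _ => zero_le) ?_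
  filter_upwards [hfa] with n hn
  simp only [not_lt]
  exact (meas_ge_le_lintegral_div (hf n) hε hε').trans (ENNReal.div_le_div_right hn _)

/-- Convergence in mean square implies convergence in probability. -/
lemma tendsto_probFilter_of_integral_sq {f : ℕ → Ω → ℝ} {a : ℕ → ℝ}
    (hf : ∀ n, MemLp (f n) 2 P) (ha : Tendsto a atTop (𝓝 0))
    (hfa : ∀ᶠ n in atTop, ∫ ω, f n ω ^ 2 ∂P ≤ a n) :
    Tendsto (fun q : ℕ × Ω => f q.1 q.2) (probFilter P) (𝓝 0) := by
  rw [Metric.tendsto_nhds]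
  intro ε hε
  have h := eventually_lt_of_lintegral (P := P) (f := fun n ω => ENNReal.ofReal (f n ω ^ 2))
    (a := fun n => ENNReal.ofReal (a n)) (ε := ENNReal.ofReal (ε ^ 2))
    (fun n => ((hf n).1.aemeasurable.pow_const 2).ennreal_ofReal)
    (by simpa using ENNReal.tendsto_ofReal ha) ?_ ?_ ENNReal.ofReal_ne_top
  · filter_upwards [h] with q hq
    rw [Real.dist_eq, sub_zero]
    rw [ENNReal.ofReal_lt_ofReal_iff (by positivity)] at hq
    exact abs_lt_of_sq_lt_sq hq hε.le
  · filter_upwards [hfa] with n hn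
    rw [← ofReal_integral_eq_lintegral_ofReal (hf n).integrable_sq
      (Eventually.of_forall fun _ => sq_nonneg _)]
    exact ENNReal.ofReal_le_ofReal hn
  · simp only [ne_eq, ENNReal.ofReal_eq_zero, not_le]
    positivity

end InProbability

/-! ### Averages and third order U-statistics of an i.i.d. sequence -/

/-- The average of the first `n` terms of a sequence. -/
def avg (n : ℕ) (f : ℕ → ℝ) : ℝ := (n : ℝ)⁻¹ * ∑ i ∈ Finset.range n, f i

lemma avg_add (n : ℕ) (f g : ℕ → ℝ) : avg n (fun i => f i + g i) = avg n f + avg n g := by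
  simp [avg, Finset.sum_add_distrib, mul_add]

lemma avg_sub (n : ℕ) (f g : ℕ → ℝ) : avg n (fun i => f i - g i) = avg n f - avg n g := by
  simp [avg, Finset.sum_sub_distrib, mul_sub]

lemma avg_mul_left (n : ℕ) (c : ℝ) (f : ℕ → ℝ) : avg n (fun i => c * f i) = c * avg n f := by
  simp only [avg, ← Finset.mul_sum]; ring

lemma avg_nonneg {n : ℕ} {f : ℕ → ℝ} (h : ∀ i < n, 0 ≤ f i) : 0 ≤ avg n f :=
  mul_nonneg (by positivity) (Finset.sum_nonneg fun i hi => h i (Finset.mem_range.1 hi))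

lemma avg_mono {n : ℕ} {f g : ℕ → ℝ} (h : ∀ i < n, f i ≤ g i) : avg n f ≤ avg n g :=
  mul_le_mul_of_nonneg_left (Finset.sum_le_sum fun i hi => h i (Finset.mem_range.1 hi))
    (by positivity)

lemma avg_congr {n : ℕ} {f g : ℕ → ℝ} (h : ∀ i < n, f i = g i) : avg n f = avg n g :=
  le_antisymm (avg_mono fun i hi => (h i hi).le) (avg_mono fun i hi => (h i hi).ge)

lemma avg_const {n : ℕ} (hn : n ≠ 0) (c : ℝ) : avg n (fun _ => c) = c := by
  have : (n : ℝ) ≠ 0 := by exact_mod_cast hn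
  simp [avg]; field_simp

lemma avg_mul_sq_le (n : ℕ) (f g : ℕ → ℝ) :
    avg n (fun i => f i * g i) ^ 2 ≤ avg n (fun i => f i ^ 2) * avg n (fun i => g i ^ 2) := by
  simp only [avg]
  have h := Finset.sum_mul_sq_le_sq_mul_sq (Finset.range n) f g
  calc _ = (n : ℝ)⁻¹ ^ 2 * (∑ i ∈ Finset.range n, f i * g i) ^ 2 := by ring
    _ ≤ (n : ℝ)⁻¹ ^ 2 * ((∑ i ∈ Finset.range n, f i ^ 2) * ∑ i ∈ Finset.range n, g i ^ 2) :=
        mul_le_mul_of_nonneg_left h (by positivity)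
    _ = _ := by ring

lemma avg_sq_le (n : ℕ) (f : ℕ → ℝ) : avg n f ^ 2 ≤ avg n (fun i => f i ^ 2) := by
  rcases eq_or_ne n 0 with rfl | hn
  · simp [avg]
  · have h := avg_mul_sq_le n f (fun _ => 1)
    simpa [avg_const hn] using h

/-- A sequence of independent and identically distributed random elements. -/
structure IsIID {Ω 𝒵 : Type*} [MeasurableSpace Ω] [MeasurableSpace 𝒵] (P : Measure Ω)
    (Z : ℕ → Ω → 𝒵) : Prop where
  meas : ∀ i, Measurable (Z i)
  indep : iIndepFun Z P
  ident : ∀ i, IdentDistrib (Z i) (Z 0) P P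

section IID

variable {Ω 𝒵 : Type*} [MeasurableSpace Ω] [MeasurableSpace 𝒵] {P : Measure Ω}
  {Z : ℕ → Ω → 𝒵}

lemma IsIID.comp {𝒲 : Type*} [MeasurableSpace 𝒲] (hZ : IsIID P Z) {f : 𝒵 → 𝒲}
    (hf : Measurable f) : IsIID P (fun i ω => f (Z i ω)) where
  meas i := hf.comp (hZ.meas i)
  indep := hZ.indep.comp (fun _ => f) (fun _ => hf)
  ident i := (hZ.ident i).comp hf

lemma IsIID.memLp {p : ENNReal} (hZ : IsIID P Z) {f : 𝒵 → ℝ} (hf : Measurable f)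
    (h : MemLp (fun ω => f (Z 0 ω)) p P) (i : ℕ) : MemLp (fun ω => f (Z i ω)) p P :=
  (((hZ.ident i).comp hf).memLp_iff).2 h

lemma IsIID.integral_eq (hZ : IsIID P Z) {f : 𝒵 → ℝ} (hf : Measurable f) (i : ℕ) :
    ∫ ω, f (Z i ω) ∂P = ∫ ω, f (Z 0 ω) ∂P := ((hZ.ident i).comp hf).integral_eq

lemma IsIID.indepFun_comp (hZ : IsIID P Z) {𝒲 : Type*} [MeasurableSpace 𝒲] {f : 𝒵 → 𝒲}
    (hf : Measurable f) {i j : ℕ} (hij : i ≠ j) :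
    IndepFun (fun ω => f (Z i ω)) (fun ω => f (Z j ω)) P :=
  (hZ.indep.indepFun hij).comp hf hf

variable [IsProbabilityMeasure P]

/-- The weak law of large numbers. -/
lemma IsIID.tendsto_avg (hZ : IsIID P Z) {f : 𝒵 → ℝ} (hf : Measurable f)
    (h : Integrable (fun ω => f (Z 0 ω)) P) :
    Tendsto (fun q : ℕ × Ω => avg q.1 (fun i => f (Z i q.2))) (probFilter P)
      (𝓝 (∫ ω, f (Z 0 ω) ∂P)) := by
  rw [← tendstoInMeasure_iff_probFilter (T := fun n ω => avg n (fun i => f (Z i ω)))]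
  refine tendstoInMeasure_of_tendsto_ae (fun n => ?_) ?_
  · refine Measurable.aestronglyMeasurable ?_
    exact (Finset.measurable_sum _ fun i _ => hf.comp (hZ.meas i)).const_mul _
  · have := strong_law_ae (fun i ω => f (Z i ω)) h
      (fun i j hij => hZ.indepFun_comp hf hij) (fun i => (hZ.ident i).comp hf)
    simpa [avg] using this

/-- The mean squared error of an average. -/
lemma IsIID.integral_avg_sub_sq_le (hZ : IsIID P Z) {f : 𝒵 → ℝ} (hf : Measurable f)
    (h : MemLp (fun ω => f (Z 0 ω)) 2 P) {n : ℕ} (hn : n ≠ 0) :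
    ∫ ω, (avg n (fun i => f (Z i ω)) - ∫ ω', f (Z 0 ω') ∂P) ^ 2 ∂P ≤
      (∫ ω, f (Z 0 ω) ^ 2 ∂P) / n := by
  have hn' : (n : ℝ) ≠ 0 := by exact_mod_cast hn
  have hL : ∀ i, MemLp (fun ω => f (Z i ω)) 2 P := hZ.memLp hf h
  have hmean : ∫ ω, avg n (fun i => f (Z i ω)) ∂P = ∫ ω, f (Z 0 ω) ∂P := by
    simp only [avg]
    rw [integral_const_mul, integral_finsetSum _ fun i _ => (hL i).integrable one_le_two]
    simp only [hZ.integral_eq hf, Finset.sum_const, Finset.card_range, nsmul_eq_mul]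
    field_simp
  have hLa : MemLp (fun ω => avg n (fun i => f (Z i ω))) 2 P := by
    refine MemLp.const_mul ?_ _
    exact memLp_finsetSum _ fun i _ => hL i
  have hvar : variance (fun ω => avg n (fun i => f (Z i ω))) P =
      ((n : ℝ)⁻¹) ^ 2 * (n * variance (fun ω => f (Z 0 ω)) P) := by
    simp only [avg]
    rw [variance_const_mul]
    have h1 := IndepFun.variance_sum (μ := P) (X := fun i ω => f (Z i ω))
      (s := Finset.range n) (fun i _ => hL i)
      (fun i _ j _ hij => hZ.indepFun_comp hf hij)
    have h2 : (∑ i ∈ Finset.range n, fun ω => f (Z i ω)) =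
      fun ω => ∑ i ∈ Finset.range n, f (Z i ω) := by ext; simp
    rw [h2] at h1
    rw [h1]
    have h3 : ∀ i, variance (fun ω => f (Z i ω)) P = variance (fun ω => f (Z 0 ω)) P :=
      fun i => ((hZ.ident i).comp hf).variance_eq
    simp [h3]
  rw [variance_eq_integral hLa.1.aemeasurable, hmean] at hvar
  rw [hvar]
  have h4 := variance_le_expectation_sq (μ := P) (X := fun ω => f (Z 0 ω)) h.1
  have h5 : ((n : ℝ)⁻¹) ^ 2 * (n * variance (fun ω => f (Z 0 ω)) P) =
    variance (fun ω => f (Z 0 ω)) P / n := by field_simp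
  rw [h5]
  exact div_le_div_of_nonneg_right h4 (by positivity)

end IID

/-- The triples of pairwise distinct indices below `n`. -/
def distinctTriples (n : ℕ) : Finset (ℕ × ℕ × ℕ) :=
  (Finset.range n ×ˢ Finset.range n ×ˢ Finset.range n).filter
    fun t => t.1 ≠ t.2.1 ∧ t.2.1 ≠ t.2.2 ∧ t.1 ≠ t.2.2

lemma sum_distinctTriples (n : ℕ) (G : ℕ → ℕ → ℕ → ℝ) :
    ∑ t ∈ distinctTriples n, G t.1 t.2.1 t.2.2 =
      ∑ i ∈ Finset.range n, ∑ j ∈ Finset.range n, ∑ k ∈ Finset.range n,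
        if i ≠ j ∧ j ≠ k ∧ i ≠ k then G i j k else 0 := by
  rw [distinctTriples, Finset.sum_filter, Finset.sum_product]
  refine Finset.sum_congr rfl fun i _ => ?_
  rw [Finset.sum_product]

lemma card_distinctTriples (n : ℕ) :
    ((distinctTriples n).card : ℝ) = n * (n - 1) * (n - 2) := by
  have h := sum_distinctTriples n (fun _ _ _ => 1)
  rw [Finset.sum_const, nsmul_eq_mul, mul_one] at h
  rw [h]
  have h1 : ∀ i ∈ Finset.range n, ∀ j ∈ Finset.range n,
      (∑ k ∈ Finset.range n, if i ≠ j ∧ j ≠ k ∧ i ≠ k then (1 : ℝ) else 0) =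
        if i ≠ j then (n : ℝ) - 2 else 0 := by
    intro i hi j hj
    by_cases hij : i = j
    · simp [hij]
    · have h2 : ((Finset.range n).filter fun k => i ≠ j ∧ j ≠ k ∧ i ≠ k) =
          ((Finset.range n).erase i).erase j := by
        ext k
        simp only [Finset.mem_filter, Finset.mem_erase]
        constructor
        · rintro ⟨hk, -, h3, h4⟩; exact ⟨h3.symm, h4.symm, hk⟩
        · rintro ⟨h3, h4, hk⟩; exact ⟨hk, hij, fun h => h3 h.symm, fun h => h4 h.symm⟩
      rw [← Finset.sum_filter, h2, if_pos hij, Finset.sum_const, nsmul_eq_mul, mul_one,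
        Finset.card_erase_of_mem (Finset.mem_erase.2 ⟨fun h => hij h.symm, hj⟩),
        Finset.card_erase_of_mem hi, Finset.card_range]
      have hn : 2 ≤ n := by
        have := Finset.mem_range.1 hi; have := Finset.mem_range.1 hj; omega
      rw [Nat.sub_sub, Nat.cast_sub hn]; norm_num
  rw [Finset.sum_congr rfl fun i hi => Finset.sum_congr rfl (h1 i hi)]
  have h3 : ∀ i ∈ Finset.range n,
      (∑ j ∈ Finset.range n, if i ≠ j then (n : ℝ) - 2 else 0) = ((n : ℝ) - 1) * (n - 2) := by
    intro i hi
    have h2 : ((Finset.range n).filter fun k => i ≠ k) = (Finset.range n).erase i := by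
      ext k
      simp only [Finset.mem_filter, Finset.mem_erase]
      exact ⟨fun h => ⟨fun h' => h.2 h'.symm, h.1⟩, fun h => ⟨h.2, fun h' => h.1 h'.symm⟩⟩
    rw [← Finset.sum_filter, h2, Finset.sum_const, nsmul_eq_mul,
      Finset.card_erase_of_mem hi, Finset.card_range]
    have hn : 1 ≤ n := by have := Finset.mem_range.1 hi; omega
    rw [Nat.cast_sub hn]; norm_num
  rw [Finset.sum_congr rfl h3, Finset.sum_const, nsmul_eq_mul, Finset.card_range]
  ring

/-- The set of the three indices of a triple. -/
def tripleSet (t : ℕ × ℕ × ℕ) : Finset ℕ := {t.1, t.2.1, t.2.2}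

/-- At most `9 n²` triples share an index with a given triple. -/
lemma card_filter_not_disjoint_le (n : ℕ) (t : ℕ × ℕ × ℕ) :
    ((distinctTriples n).filter fun s => ¬ Disjoint (tripleSet t) (tripleSet s)).card ≤
      9 * n ^ 2 := by
  have hsub : ((distinctTriples n).filter fun s => ¬ Disjoint (tripleSet t) (tripleSet s)) ⊆
      (tripleSet t ×ˢ Finset.range n ×ˢ Finset.range n) ∪
      ((Finset.range n ×ˢ tripleSet t ×ˢ Finset.range n) ∪
      (Finset.range n ×ˢ Finset.range n ×ˢ tripleSet t)) := by
    rintro ⟨a, b, c⟩ hs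
    simp only [distinctTriples, Finset.mem_filter, Finset.mem_product] at hs
    obtain ⟨⟨⟨ha, hb, hc⟩, -⟩, hd⟩ := hs
    rw [Finset.not_disjoint_iff] at hd
    obtain ⟨x, hx, hx'⟩ := hd
    simp only [tripleSet, Finset.mem_insert, Finset.mem_singleton] at hx'
    simp only [Finset.mem_union, Finset.mem_product]
    rcases hx' with rfl | rfl | rfl
    · exact Or.inl ⟨hx, hb, hc⟩
    · exact Or.inr (Or.inl ⟨ha, hx, hc⟩)
    · exact Or.inr (Or.inr ⟨ha, hb, hx⟩)
  have h3 : (tripleSet t).card ≤ 3 := Finset.card_le_three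
  refine (Finset.card_le_card hsub).trans ?_
  refine (Finset.card_union_le _ _).trans ?_
  refine (Nat.add_le_add_left (Finset.card_union_le _ _) _).trans ?_
  simp only [Finset.card_product, Finset.card_range]
  nlinarith [Nat.zero_le (n * n)]

/-- The normalized sum over the triples of pairwise distinct indices below `n`. -/
def tripleAvg (n : ℕ) (G : ℕ → ℕ → ℕ → ℝ) : ℝ :=
  (1 / (n * (n - 1) * (n - 2)) : ℝ) * ∑ t ∈ distinctTriples n, G t.1 t.2.1 t.2.2

section IID

variable {Ω 𝒵 : Type*} [MeasurableSpace Ω] [MeasurableSpace 𝒵] {P : Measure Ω}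
  {Z : ℕ → Ω → 𝒵}

lemma IsIID.indepFun_triple (hZ : IsIID P Z) {t s : ℕ × ℕ × ℕ}
    (h : Disjoint (tripleSet t) (tripleSet s)) :
    IndepFun (fun ω => (Z t.1 ω, Z t.2.1 ω, Z t.2.2 ω)) (fun ω => (Z s.1 ω, Z s.2.1 ω, Z s.2.2 ω))
      P := by
  have h1 := hZ.indep.indepFun_finset (tripleSet t) (tripleSet s) h hZ.meas
  have key : ∀ t : ℕ × ℕ × ℕ, Measurable fun v : tripleSet t → 𝒵 =>
      (v ⟨t.1, by simp [tripleSet]⟩, v ⟨t.2.1, by simp [tripleSet]⟩,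
        v ⟨t.2.2, by simp [tripleSet]⟩) := fun t =>
    (measurable_pi_apply _).prodMk ((measurable_pi_apply _).prodMk (measurable_pi_apply _))
  exact h1.comp (key t) (key s)

variable [IsProbabilityMeasure P]

lemma IsIID.map_triple (hZ : IsIID P Z) {i j k : ℕ} (hij : i ≠ j) (hjk : j ≠ k) (hik : i ≠ k) :
    P.map (fun ω => (Z i ω, Z j ω, Z k ω)) =
      (P.map (Z 0)).prod ((P.map (Z 0)).prod (P.map (Z 0))) := by
  have h1 : IndepFun (Z i) (fun ω => (Z j ω, Z k ω)) P :=
    (hZ.indep.indepFun_prodMk hZ.meas j k i hij.symm hik.symm).symm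
  rw [(indepFun_iff_map_prod_eq_prod_map_map (hZ.meas i).aemeasurable
    ((hZ.meas j).prodMk (hZ.meas k)).aemeasurable).1 h1,
    (indepFun_iff_map_prod_eq_prod_map_map (hZ.meas j).aemeasurable
    (hZ.meas k).aemeasurable).1 (hZ.indep.indepFun hjk),
    (hZ.ident i).map_eq, (hZ.ident j).map_eq, (hZ.ident k).map_eq]

lemma IsIID.identDistrib_triple (hZ : IsIID P Z) {i j k : ℕ} (hij : i ≠ j) (hjk : j ≠ k)
    (hik : i ≠ k) :
    IdentDistrib (fun ω => (Z i ω, Z j ω, Z k ω)) (fun ω => (Z 0 ω, Z 1 ω, Z 2 ω)) P P where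
  aemeasurable_fst := ((hZ.meas i).prodMk ((hZ.meas j).prodMk (hZ.meas k))).aemeasurable
  aemeasurable_snd := ((hZ.meas 0).prodMk ((hZ.meas 1).prodMk (hZ.meas 2))).aemeasurable
  map_eq := by
    rw [hZ.map_triple hij hjk hik, hZ.map_triple (by norm_num) (by norm_num) (by norm_num)]

/-- The weak law of large numbers for U-statistics of order three with a square integrable
kernel: summands whose triples of indices are disjoint are uncorrelated, and the pairs of triples
that share an index are negligible in number. -/
lemma IsIID.tendsto_tripleAvg (hZ : IsIID P Z) {G : 𝒵 × 𝒵 × 𝒵 → ℝ} (hG : Measurable G)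
    (h2 : MemLp (fun ω => G (Z 0 ω, Z 1 ω, Z 2 ω)) 2 P) :
    Tendsto (fun q : ℕ × Ω => tripleAvg q.1 (fun i j k => G (Z i q.2, Z j q.2, Z k q.2)))
      (probFilter P) (𝓝 (∫ ω, G (Z 0 ω, Z 1 ω, Z 2 ω) ∂P)) := by
  set m := ∫ ω, G (Z 0 ω, Z 1 ω, Z 2 ω) ∂P with hm
  set D : ℕ × ℕ × ℕ → Ω → ℝ := fun t ω => G (Z t.1 ω, Z t.2.1 ω, Z t.2.2 ω) - m with hD
  set v := ∫ ω, D (0, 1, 2) ω ^ 2 ∂P with hv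
  have hmD : ∀ t, Measurable (D t) := fun t =>
    (hG.comp ((hZ.meas _).prodMk ((hZ.meas _).prodMk (hZ.meas _)))).sub_const _
  have hident : ∀ n, ∀ t ∈ distinctTriples n, IdentDistrib (D t) (D (0, 1, 2)) P P := by
    intro n t ht
    simp only [distinctTriples, Finset.mem_filter] at ht
    exact (hZ.identDistrib_triple ht.2.1 ht.2.2.1 ht.2.2.2).comp (hG.sub_const m)
  have hL0 : MemLp (D (0, 1, 2)) 2 P := h2.sub (memLp_const m)
  have hL : ∀ n, ∀ t ∈ distinctTriples n, MemLp (D t) 2 P := fun n t ht =>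
    ((hident n t ht).memLp_iff).2 hL0
  have hm0 : ∀ n, ∀ t ∈ distinctTriples n, ∫ ω, D t ω ∂P = 0 := by
    intro n t ht
    rw [(hident n t ht).integral_eq]
    simp only [hD]
    rw [integral_sub (h2.integrable one_le_two) (integrable_const _)]
    simp [hm]
  have hsq : ∀ n, ∀ t ∈ distinctTriples n, ∫ ω, D t ω ^ 2 ∂P = v := fun n t ht =>
    ((hident n t ht).comp (measurable_id.pow_const 2)).integral_eq
  have hprod : ∀ n, ∀ t ∈ distinctTriples n, ∀ s ∈ distinctTriples n,
      Integrable (fun ω => D t ω * D s ω) P := fun n t ht s hs =>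
    (hL n t ht).integrable_mul (hL n s hs)
  have hcov : ∀ n, ∀ t ∈ distinctTriples n, ∀ s ∈ distinctTriples n,
      ∫ ω, D t ω * D s ω ∂P ≤ if ¬ Disjoint (tripleSet t) (tripleSet s) then v else 0 := by
    intro n t ht s hs
    by_cases hd : Disjoint (tripleSet t) (tripleSet s)
    swap
    · rw [if_pos hd]
      have h1 : ∫ ω, D t ω * D s ω ∂P ≤ ∫ ω, (2⁻¹ * D t ω ^ 2 + 2⁻¹ * D s ω ^ 2) ∂P := by
        refine integral_mono (hprod n t ht s hs)
          (((hL n t ht).integrable_sq.const_mul _).add ((hL n s hs).integrable_sq.const_mul _)) ?_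
        intro ω
        simp only
        nlinarith [sq_nonneg (D t ω - D s ω)]
      refine h1.trans_eq ?_
      rw [integral_add ((hL n t ht).integrable_sq.const_mul _)
        ((hL n s hs).integrable_sq.const_mul _), integral_const_mul, integral_const_mul,
        hsq n t ht, hsq n s hs]
      ring
    · rw [if_neg (not_not.2 hd)]
      have hi : IndepFun (D t) (D s) P :=
        (hZ.indepFun_triple hd).comp (hG.sub_const m) (hG.sub_const m)
      rw [hi.integral_fun_mul_eq_mul_integral (hmD t).aestronglyMeasurable
        (hmD s).aestronglyMeasurable, hm0 n t ht]
      simp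
  have hv0 : 0 ≤ v := integral_nonneg fun _ => sq_nonneg _
  have hsum : ∀ n, ∫ ω, (∑ t ∈ distinctTriples n, D t ω) ^ 2 ∂P ≤
      (n : ℝ) * (n - 1) * (n - 2) * (9 * n ^ 2 * v) := by
    intro n
    have e1 : ∀ ω, (∑ t ∈ distinctTriples n, D t ω) ^ 2 =
        ∑ t ∈ distinctTriples n, ∑ s ∈ distinctTriples n, D t ω * D s ω := by
      intro ω; rw [sq, Finset.sum_mul_sum]
    simp_rw [e1]
    rw [integral_finsetSum _ fun t ht => integrable_finsetSum _ fun s hs => hprod n t ht s hs]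
    calc _ ≤ ∑ t ∈ distinctTriples n, 9 * (n : ℝ) ^ 2 * v := ?_
      _ = _ := by rw [Finset.sum_const, nsmul_eq_mul, card_distinctTriples]
    refine Finset.sum_le_sum fun t ht => ?_
    rw [integral_finsetSum _ fun s hs => hprod n t ht s hs]
    refine (Finset.sum_le_sum fun s hs => hcov n t ht s hs).trans ?_
    rw [← Finset.sum_filter, Finset.sum_const, nsmul_eq_mul]
    exact mul_le_mul_of_nonneg_right (by exact_mod_cast card_filter_not_disjoint_le n t) hv0
  have hmain : Tendsto (fun q : ℕ × Ω =>
      (1 / (q.1 * (q.1 - 1) * (q.1 - 2)) : ℝ) * ∑ t ∈ distinctTriples q.1, D t q.2)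
      (probFilter P) (𝓝 0) := by
    refine tendsto_probFilter_of_integral_sq (P := P)
      (f := fun n ω => (1 / (n * (n - 1) * (n - 2)) : ℝ) * ∑ t ∈ distinctTriples n, D t ω)
      (a := fun n : ℕ => 54 * v / n) ?_ ?_ ?_
    · intro n
      exact (memLp_finsetSum _ fun t ht => hL n t ht).const_mul _
    · exact tendsto_const_div_atTop_nhds_zero_nat _
    · filter_upwards [eventually_ge_atTop 3] with n hn
      have hn' : (3 : ℝ) ≤ n := by exact_mod_cast hn
      simp_rw [mul_pow]
      rw [integral_const_mul]
      have hN : 0 < (n : ℝ) * (n - 1) * (n - 2) :=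
        mul_pos (mul_pos (by linarith) (by linarith)) (by linarith)
      calc _ ≤ (1 / (n * (n - 1) * (n - 2)) : ℝ) ^ 2 *
            ((n : ℝ) * (n - 1) * (n - 2) * (9 * n ^ 2 * v)) :=
            mul_le_mul_of_nonneg_left (hsum n) (by positivity)
        _ = 9 * n ^ 2 * v / (n * (n - 1) * (n - 2)) := by field_simp
        _ ≤ 54 * v / n := by
          rw [div_le_div_iff₀ hN (by linarith)]
          have h6 : 0 ≤ (n : ℝ) ^ 2 * (5 * n ^ 2 - 18 * n + 12) := by
            refine mul_nonneg (by positivity) ?_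
            nlinarith
          nlinarith [mul_nonneg hv0 (mul_nonneg (by linarith : (0:ℝ) ≤ n)
            (by nlinarith : 0 ≤ 5 * (n : ℝ) ^ 2 - 18 * n + 12))]
  have h := hmain.add_const m
  rw [zero_add] at h
  refine h.congr' ?_
  have h3 : ∀ᶠ q in probFilter P, 3 ≤ q.1 := tendsto_fst_probFilter.eventually_ge_atTop 3
  filter_upwards [h3] with q hq
  have hn' : (3 : ℝ) ≤ q.1 := by exact_mod_cast hq
  have hN : 0 < (q.1 : ℝ) * (q.1 - 1) * (q.1 - 2) :=
    mul_pos (mul_pos (by linarith) (by linarith)) (by linarith)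
  simp only [hD, tripleAvg, Finset.sum_sub_distrib, Finset.sum_const, nsmul_eq_mul,
    card_distinctTriples]
  generalize (q.1 : ℝ) * (q.1 - 1) * (q.1 - 2) = N at hN
  field_simp
  ring

end IID

instance instSecondCountableL2I : SecondCountableTopology L2I := by
  have : Fact ((2 : ENNReal) ≠ ⊤) := ⟨by simp⟩
  infer_instance

/-! ### Orthogonal projections and estimated principal components -/

section Projection

variable {H : Type*} [NormedAddCommGroup H] [InnerProductSpace ℝ H] {p : ℕ}

/-- The orthogonal projection onto the span of a finite orthonormal family. -/
def onProj (ψ : Fin p → H) (x : H) : H := ∑ ν, inner ℝ (ψ ν) x • ψ ν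

lemma onProj_sub (ψ : Fin p → H) (x y : H) : onProj ψ (x - y) = onProj ψ x - onProj ψ y := by
  simp [onProj, inner_sub_right, sub_smul, Finset.sum_sub_distrib]

lemma inner_onProj {ψ : Fin p → H} (hψ : Orthonormal ℝ ψ) (x y : H) :
    inner ℝ (onProj ψ x) (onProj ψ y) = ∑ ν, inner ℝ (ψ ν) x * inner ℝ (ψ ν) y := by
  simpa [onProj] using hψ.inner_sum (fun ν => inner ℝ (ψ ν) x) (fun ν => inner ℝ (ψ ν) y)
    Finset.univ

lemma inner_onProj_self {ψ : Fin p → H} (x : H) :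
    inner ℝ (onProj ψ x) x = ∑ ν, inner ℝ (ψ ν) x ^ 2 := by
  simp [onProj, sum_inner, inner_smul_left, sq]

lemma inner_onProj_sub {ψ : Fin p → H} (hψ : Orthonormal ℝ ψ) (x : H) :
    inner ℝ (onProj ψ x) (x - onProj ψ x) = 0 := by
  rw [inner_sub_right, inner_onProj_self, inner_onProj hψ]
  simp [sq]

lemma norm_sub_onProj_sq {ψ : Fin p → H} (hψ : Orthonormal ℝ ψ) (x : H) :
    ‖x - onProj ψ x‖ ^ 2 = ‖x‖ ^ 2 - ∑ ν, inner ℝ (ψ ν) x ^ 2 := by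
  rw [norm_sub_sq_real, real_inner_comm, inner_onProj_self,
    ← real_inner_self_eq_norm_sq (onProj ψ x),
    inner_onProj hψ]
  simp only [sq]; ring

lemma norm_sub_onProj_le {ψ : Fin p → H} (hψ : Orthonormal ℝ ψ) (x : H) :
    ‖x - onProj ψ x‖ ≤ ‖x‖ := by
  refine le_of_sq_le_sq ?_ (norm_nonneg _)
  rw [norm_sub_onProj_sq hψ]
  have : 0 ≤ ∑ ν, inner ℝ (ψ ν) x ^ 2 := Finset.sum_nonneg fun _ _ => sq_nonneg _
  linarith

lemma arcsin_le_mul {t : ℝ} (h0 : 0 ≤ t) (h1 : t ≤ 1) : Real.arcsin t ≤ Real.pi / 2 * t := by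
  have h := Real.mul_le_sin (Real.arcsin_nonneg.2 h0) (Real.arcsin_le_pi_div_two t)
  rw [Real.sin_arcsin (by linarith) h1] at h
  have hp := Real.pi_pos
  calc Real.arcsin t = Real.pi / 2 * (2 / Real.pi * Real.arcsin t) := by field_simp
    _ ≤ _ := mul_le_mul_of_nonneg_left h (by positivity)

lemma angle_onProj_le {ψ : Fin p → H} (hψ : Orthonormal ℝ ψ) {x : H} (hx : x ≠ 0) :
    InnerProductGeometry.angle (onProj ψ x) x ≤ Real.pi / 2 * (‖x - onProj ψ x‖ / ‖x‖) := by
  have hx' : onProj ψ x + (x - onProj ψ x) = x := by abel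
  have h := InnerProductGeometry.angle_add_eq_arcsin_of_inner_eq_zero (inner_onProj_sub hψ x) (by
    by_contra hc
    simp only [not_or, ne_eq, not_not] at hc
    rw [hc.2, hc.1, add_zero] at hx'
    exact hx hx'.symm)
  rw [hx'] at h
  rw [h]
  exact arcsin_le_mul (by positivity) (div_le_one_of_le₀ (norm_sub_onProj_le hψ x) (norm_nonneg _))

/-- Projecting two vectors changes their angle by at most the sum of the angles between the
vectors and their projections. -/
lemma abs_angle_onProj_sub_le {ψ : Fin p → H} (hψ : Orthonormal ℝ ψ) (x y : H) :
    |InnerProductGeometry.angle (onProj ψ x) (onProj ψ y) - InnerProductGeometry.angle x y| ≤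
      Real.pi / 2 * (‖x - onProj ψ x‖ / ‖x‖ + ‖y - onProj ψ y‖ / ‖y‖) := by
  have h0 : onProj ψ 0 = 0 := by simp [onProj]
  have hpos : 0 ≤ Real.pi / 2 * (‖x - onProj ψ x‖ / ‖x‖ + ‖y - onProj ψ y‖ / ‖y‖) := by
    have := Real.pi_pos
    positivity
  by_cases hx : x = 0
  · rw [hx] at hpos ⊢
    simpa [h0] using hpos
  by_cases hy : y = 0
  · rw [hy] at hpos ⊢
    simpa [h0] using hpos
  have hxx := angle_onProj_le hψ hx
  have hyy := angle_onProj_le hψ hy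
  have t1 := InnerProductGeometry.angle_le_angle_add_angle (onProj ψ x) x (onProj ψ y)
  have t2 := InnerProductGeometry.angle_le_angle_add_angle x y (onProj ψ y)
  have t3 := InnerProductGeometry.angle_le_angle_add_angle x (onProj ψ x) y
  have t4 := InnerProductGeometry.angle_le_angle_add_angle (onProj ψ x) (onProj ψ y) y
  rw [InnerProductGeometry.angle_comm y (onProj ψ y)] at t2
  rw [InnerProductGeometry.angle_comm x (onProj ψ x)] at t3
  rw [abs_le]
  constructor <;> linarith

/-- The relative projection error is small unless the vector is short. -/
lemma norm_sub_onProj_div_le {ψ : Fin p → H} (hψ : Orthonormal ℝ ψ) (x : H) {τ : ℝ} (hτ : 0 < τ) :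
    ‖x - onProj ψ x‖ / ‖x‖ ≤ (Ioo 0 τ).indicator 1 ‖x‖ + τ⁻¹ * ‖x - onProj ψ x‖ := by
  rcases eq_or_ne x 0 with rfl | hx
  · simp [onProj]
  have hx' : 0 < ‖x‖ := norm_pos_iff.2 hx
  by_cases h : ‖x‖ < τ
  · rw [indicator_of_mem (show ‖x‖ ∈ Ioo 0 τ from ⟨hx', h⟩)]
    have h1 := div_le_one_of_le₀ (norm_sub_onProj_le hψ x) (norm_nonneg x)
    have h2 : 0 ≤ τ⁻¹ * ‖x - onProj ψ x‖ := by positivity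
    simp only [Pi.one_apply]
    linarith
  · rw [indicator_of_notMem (fun hc => h hc.2), zero_add, div_eq_inv_mul]
    exact mul_le_mul_of_nonneg_right (inv_anti₀ hτ (not_lt.1 h)) (norm_nonneg _)

end Projection

lemma angle_fpcScores {p : ℕ} {ψ : Fin p → L2I} (hψ : Orthonormal ℝ ψ) (x y : L2I) :
    InnerProductGeometry.angle (fpcScores ψ x) (fpcScores ψ y) =
      InnerProductGeometry.angle (onProj ψ x) (onProj ψ y) := by
  have h : ∀ x y : L2I, inner ℝ (fpcScores ψ x) (fpcScores ψ y) =
      inner ℝ (onProj ψ x) (onProj ψ y) := by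
    intro x y
    rw [inner_onProj hψ]
    simp only [fpcScores, PiLp.inner_apply, RCLike.inner_apply, conj_trivial]
    refine Finset.sum_congr rfl fun ν _ => ?_
    rw [real_inner_comm (ψ ν) x, real_inner_comm (ψ ν) y]; ring
  have hn : ∀ x : L2I, ‖fpcScores ψ x‖ = ‖onProj ψ x‖ := by
    intro x
    rw [norm_eq_sqrt_real_inner, norm_eq_sqrt_real_inner, h]
  rw [InnerProductGeometry.angle, InnerProductGeometry.angle, h, hn, hn]

lemma fpcScores_sub {p : ℕ} (ψ : Fin p → L2I) (x y : L2I) :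
    fpcScores ψ (x - y) = fpcScores ψ x - fpcScores ψ y := by
  ext ν
  simp [fpcScores, inner_sub_left]

lemma inner_sampleCov (n : ℕ) (X : ℕ → L2I) (u v : L2I) :
    inner ℝ (sampleCov n X u) v =
      avg n (fun i => inner ℝ (X i - sampleMean n X) u * inner ℝ (X i - sampleMean n X) v) := by
  simp [sampleCov, avg, inner_smul_left, sum_inner]

/-- The Rayleigh quotient of a vector, in terms of the leading eigenvalues of the sample covariance
operator and a bound for the quadratic form on the orthogonal complement. -/
lemma IsEstimatedFPC.inner_sampleCov_le {n p : ℕ} {X : ℕ → L2I} {ψ : Fin p → L2I} {κ : Fin p → ℝ}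
    (hψ : Orthonormal ℝ ψ) (heig : ∀ ν, sampleCov n X (ψ ν) = κ ν • ψ ν) {κm : ℝ}
    (hκm : ∀ u : L2I, (∀ ν, inner ℝ (ψ ν) u = 0) → inner ℝ (sampleCov n X u) u ≤ κm * ‖u‖ ^ 2)
    (e : L2I) :
    inner ℝ (sampleCov n X e) e ≤
      ∑ ν, κ ν * inner ℝ (ψ ν) e ^ 2 + κm * (‖e‖ ^ 2 - ∑ ν, inner ℝ (ψ ν) e ^ 2) := by
  set w := e - onProj ψ e with hw
  have hwν : ∀ ν, inner ℝ (ψ ν) w = 0 := by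
    intro ν
    rw [hw, inner_sub_right, onProj, inner_sum]
    simp only [inner_smul_right]
    rw [Finset.sum_eq_single ν]
    · rw [real_inner_self_eq_norm_sq, hψ.1 ν]; simp
    · intro μ _ hμ; rw [hψ.2 hμ.symm]; simp
    · simp
  have he : e = onProj ψ e + w := by rw [hw]; abel
  have hadd : ∀ u v, sampleCov n X (u + v) = sampleCov n X u + sampleCov n X v := by
    intro u v
    simp [sampleCov, inner_add_right, add_smul, Finset.sum_add_distrib]
  have hsmul : ∀ (c : ℝ) u, sampleCov n X (c • u) = c • sampleCov n X u := by
    intro c u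
    simp only [sampleCov, inner_smul_right, mul_smul, ← Finset.smul_sum]
    rw [smul_comm]
  have hzero : sampleCov n X 0 = 0 := by simpa using hsmul 0 0
  have hproj : sampleCov n X (onProj ψ e) = ∑ ν, (κ ν * inner ℝ (ψ ν) e) • ψ ν := by
    have hsum : ∀ s : Finset (Fin p), sampleCov n X (∑ ν ∈ s, inner ℝ (ψ ν) e • ψ ν) =
        ∑ ν ∈ s, (κ ν * inner ℝ (ψ ν) e) • ψ ν := by
      intro s
      induction s using Finset.cons_induction with
      | empty => simpa using hzero
      | cons a s ha ih =>
        rw [Finset.sum_cons, Finset.sum_cons, hadd, ih, hsmul, heig, smul_smul, mul_comm]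
    exact hsum Finset.univ
  have hsymm : ∀ u v, inner ℝ (sampleCov n X u) v = inner ℝ (sampleCov n X v) u := by
    intro u v
    rw [inner_sampleCov, inner_sampleCov]
    exact avg_congr fun i _ => mul_comm _ _
  have h1 : inner ℝ (sampleCov n X (onProj ψ e)) w = 0 := by
    rw [hproj, sum_inner]
    exact Finset.sum_eq_zero fun ν _ => by rw [inner_smul_left, hwν]; simp
  have h2 : inner ℝ (sampleCov n X (onProj ψ e)) (onProj ψ e) =
      ∑ ν, κ ν * inner ℝ (ψ ν) e ^ 2 := by
    rw [hproj, onProj]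
    rw [hψ.inner_sum (fun ν => κ ν * inner ℝ (ψ ν) e) (fun ν => inner ℝ (ψ ν) e) Finset.univ]
    refine Finset.sum_congr rfl fun ν _ => ?_
    simp; ring
  have h3 : inner ℝ (sampleCov n X e) e =
      inner ℝ (sampleCov n X (onProj ψ e)) (onProj ψ e) + inner ℝ (sampleCov n X w) w := by
    conv_lhs => rw [he]
    rw [hadd, inner_add_left, inner_add_right, inner_add_right, h1, hsymm w, h1]
    ring
  rw [h3, h2, ← norm_sub_onProj_sq hψ]
  have := hκm w hwν
  rw [← hw]
  linarith

/-- Optimality of the estimated principal components: no orthonormal family of at most as many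
vectors explains more of the sample variance. -/
lemma IsEstimatedFPC.sum_inner_le {n p r : ℕ} {X : ℕ → L2I} {ψ : Fin p → L2I}
    (h : IsEstimatedFPC n p X ψ) {e : Fin r → L2I} (he : Orthonormal ℝ e) (hr : r ≤ p) :
    ∑ j, inner ℝ (sampleCov n X (e j)) (e j) ≤ ∑ ν, inner ℝ (sampleCov n X (ψ ν)) (ψ ν) := by
  obtain ⟨hψ, κ, hκ, heig, hmax⟩ := h
  have hnn : ∀ u, 0 ≤ inner ℝ (sampleCov n X u) u := by
    intro u
    rw [inner_sampleCov]
    exact avg_nonneg fun i _ => mul_self_nonneg _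
  have hκν : ∀ ν, inner ℝ (sampleCov n X (ψ ν)) (ψ ν) = κ ν := by
    intro ν
    rw [heig, inner_smul_left, real_inner_self_eq_norm_sq, hψ.1 ν]; simp
  rcases Nat.eq_zero_or_pos p with hp | hp
  · have hr0 : r = 0 := by omega
    subst hr0
    simp only [Finset.univ_eq_empty, Finset.sum_empty]
    exact Finset.sum_nonneg fun ν _ => hnn _
  set l : Fin p := ⟨p - 1, by omega⟩ with hl
  have hle : ∀ ν, κ l ≤ κ ν := fun ν => hκ (by rw [Fin.le_def]; simp only [hl]; omega)
  have hl0 : 0 ≤ κ l := by rw [← hκν]; exact hnn _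
  simp only [hκν]
  set s : Fin p → ℝ := fun ν => ∑ j, inner ℝ (ψ ν) (e j) ^ 2 with hs
  have hs1 : ∀ ν, s ν ≤ 1 := by
    intro ν
    have := he.sum_inner_products_le (ψ ν) (s := Finset.univ)
    rw [hψ.1 ν] at this
    simpa [hs, real_inner_comm] using this
  have h1 : ∀ j, inner ℝ (sampleCov n X (e j)) (e j) ≤
      ∑ ν, (κ ν - κ l) * inner ℝ (ψ ν) (e j) ^ 2 + κ l := by
    intro j
    have h2 := inner_sampleCov_le hψ heig (fun u hu => hmax u hu l) (e j)
    rw [he.1 j] at h2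
    simp only [sub_mul, Finset.sum_sub_distrib, ← Finset.mul_sum]
    linarith
  calc _ ≤ ∑ j : Fin r, (∑ ν, (κ ν - κ l) * inner ℝ (ψ ν) (e j) ^ 2 + κ l) :=
        Finset.sum_le_sum fun j _ => h1 j
    _ = ∑ ν, (κ ν - κ l) * s ν + r * κ l := by
        rw [Finset.sum_add_distrib, Finset.sum_comm]
        simp [hs, Finset.mul_sum]
    _ ≤ ∑ ν, (κ ν - κ l) + p * κ l := by
        refine add_le_add (Finset.sum_le_sum fun ν _ => ?_) ?_
        · have := hle ν
          nlinarith [hs1 ν]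
        · exact mul_le_mul_of_nonneg_right (by exact_mod_cast hr) hl0
    _ = ∑ ν, κ ν := by simp

/-- The mean squared distance of the centred curves from the span of the estimated principal
components is at most that of the curves from any subspace of at most the same dimension. -/
lemma IsEstimatedFPC.avg_norm_sub_onProj_le {n p r : ℕ} {X : ℕ → L2I} {ψ : Fin p → L2I}
    (h : IsEstimatedFPC n p X ψ) {e : Fin r → L2I} (he : Orthonormal ℝ e) (hr : r ≤ p) :
    avg n (fun i => ‖(X i - sampleMean n X) - onProj ψ (X i - sampleMean n X)‖ ^ 2) ≤
      avg n (fun i => ‖X i - onProj e (X i)‖ ^ 2) := by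
  set y : ℕ → L2I := fun i => X i - sampleMean n X with hy
  have hsum : ∀ {q : ℕ} (f : Fin q → L2I), avg n (fun i => ∑ ν, inner ℝ (f ν) (y i) ^ 2) =
      ∑ ν, inner ℝ (sampleCov n X (f ν)) (f ν) := by
    intro q f
    simp only [inner_sampleCov, avg, ← Finset.mul_sum]
    rw [Finset.sum_comm]
    congr 1
    refine Finset.sum_congr rfl fun ν _ => Finset.sum_congr rfl fun i _ => ?_
    rw [hy, real_inner_comm, sq]
  have h1 : avg n (fun i => ‖y i - onProj ψ (y i)‖ ^ 2) ≤
      avg n (fun i => ‖y i - onProj e (y i)‖ ^ 2) := by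
    simp only [norm_sub_onProj_sq h.1, norm_sub_onProj_sq he]
    rw [avg_sub, avg_sub, hsum, hsum]
    have := h.sum_inner_le he hr
    linarith
  refine h1.trans ?_
  rcases eq_or_ne n 0 with rfl | hn
  · simp [avg]
  have hn' : (n : ℝ) ≠ 0 := by exact_mod_cast hn
  set c := sampleMean n X - onProj e (sampleMean n X) with hc
  set z : ℕ → L2I := fun i => X i - onProj e (X i) with hz
  have hzy : ∀ i, y i - onProj e (y i) = z i - c := by
    intro i
    simp only [hy, onProj_sub, hz, hc]; abel
  have hzc : avg n (fun i => inner ℝ (z i) c) = ‖c‖ ^ 2 := by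
    have h3 : c = (1 / n : ℝ) • ∑ i ∈ Finset.range n, z i := by
      have h4 : onProj e (sampleMean n X) = (1 / n : ℝ) • ∑ i ∈ Finset.range n, onProj e (X i) := by
        simp only [onProj, sampleMean, inner_smul_right, inner_sum, Finset.smul_sum]
        rw [Finset.sum_comm]
        refine Finset.sum_congr rfl fun ν _ => ?_
        rw [← Finset.smul_sum, ← Finset.sum_smul, smul_smul, Finset.mul_sum]
      rw [hc, h4, sampleMean, ← smul_sub, ← Finset.sum_sub_distrib]
    have h6 : inner ℝ ((1 / n : ℝ) • ∑ i ∈ Finset.range n, z i) c =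
        avg n (fun i => inner ℝ (z i) c) := by
      simp [avg, inner_smul_left, sum_inner]
    rw [← h3, real_inner_self_eq_norm_sq] at h6
    exact h6.symm
  have h5 : ∀ i, ‖y i - onProj e (y i)‖ ^ 2 = ‖z i‖ ^ 2 - 2 * inner ℝ (z i) c + ‖c‖ ^ 2 := by
    intro i
    rw [hzy, norm_sub_sq_real]
  simp only [h5]
  rw [avg_add, avg_sub, avg_mul_left, hzc, avg_const hn]
  nlinarith [sq_nonneg ‖c‖]

/-! ### The angles between estimated scores -/

lemma normalizer_nonneg {n : ℕ} (hn : 3 ≤ n) : 0 < (n : ℝ) * (n - 1) * (n - 2) := by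
  have hn' : (3 : ℝ) ≤ n := by exact_mod_cast hn
  exact mul_pos (mul_pos (by linarith) (by linarith)) (by linarith)

lemma tripleAvg_mono {n : ℕ} (hn : 3 ≤ n) {G G' : ℕ → ℕ → ℕ → ℝ}
    (h : ∀ i < n, ∀ j < n, ∀ k < n, G i j k ≤ G' i j k) : tripleAvg n G ≤ tripleAvg n G' := by
  refine mul_le_mul_of_nonneg_left (Finset.sum_le_sum fun t ht => ?_)
    (one_div_nonneg.2 (normalizer_nonneg hn).le)
  simp only [distinctTriples, Finset.mem_filter, Finset.mem_product, Finset.mem_range] at ht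
  exact h _ ht.1.1 _ ht.1.2.1 _ ht.1.2.2

lemma tripleAvg_add (n : ℕ) (G G' : ℕ → ℕ → ℕ → ℝ) :
    tripleAvg n (fun i j k => G i j k + G' i j k) = tripleAvg n G + tripleAvg n G' := by
  simp [tripleAvg, Finset.sum_add_distrib, mul_add]

lemma tripleAvg_sub (n : ℕ) (G G' : ℕ → ℕ → ℕ → ℝ) :
    tripleAvg n (fun i j k => G i j k - G' i j k) = tripleAvg n G - tripleAvg n G' := by
  simp [tripleAvg, Finset.sum_sub_distrib, mul_sub]

lemma tripleAvg_mul_left (n : ℕ) (c : ℝ) (G : ℕ → ℕ → ℕ → ℝ) :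
    tripleAvg n (fun i j k => c * G i j k) = c * tripleAvg n G := by
  simp only [tripleAvg, ← Finset.mul_sum]; ring

lemma tripleAvg_nonneg {n : ℕ} (hn : 3 ≤ n) {G : ℕ → ℕ → ℕ → ℝ} (h : ∀ i j k, 0 ≤ G i j k) :
    0 ≤ tripleAvg n G :=
  mul_nonneg (one_div_nonneg.2 (normalizer_nonneg hn).le) (Finset.sum_nonneg fun _ _ => h _ _ _)

lemma abs_tripleAvg_le {n : ℕ} (hn : 3 ≤ n) (G : ℕ → ℕ → ℕ → ℝ) :
    |tripleAvg n G| ≤ tripleAvg n (fun i j k => |G i j k|) := by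
  rw [tripleAvg, abs_mul, abs_of_nonneg (one_div_nonneg.2 (normalizer_nonneg hn).le)]
  exact mul_le_mul_of_nonneg_left (Finset.abs_sum_le_sum_abs _ _)
    (one_div_nonneg.2 (normalizer_nonneg hn).le)

lemma tripleAvg_mul_sq_le {n : ℕ} (hn : 3 ≤ n) (G G' : ℕ → ℕ → ℕ → ℝ) :
    tripleAvg n (fun i j k => G i j k * G' i j k) ^ 2 ≤
      tripleAvg n (fun i j k => G i j k ^ 2) * tripleAvg n (fun i j k => G' i j k ^ 2) := by
  simp only [tripleAvg]
  have h := Finset.sum_mul_sq_le_sq_mul_sq (distinctTriples n)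
    (fun t => G t.1 t.2.1 t.2.2) (fun t => G' t.1 t.2.1 t.2.2)
  have hN := normalizer_nonneg hn
  generalize (1 / (n * (n - 1) * (n - 2)) : ℝ) = c
  calc _ = c ^ 2 * (∑ t ∈ distinctTriples n, G t.1 t.2.1 t.2.2 * G' t.1 t.2.1 t.2.2) ^ 2 := by ring
    _ ≤ c ^ 2 * _ := mul_le_mul_of_nonneg_left h (by positivity)
    _ = _ := by ring

/-- The average over triples of distinct indices is at most five times the average over all
triples. -/
lemma tripleAvg_le {n : ℕ} (hn : 3 ≤ n) {G : ℕ → ℕ → ℕ → ℝ} (h : ∀ i j k, 0 ≤ G i j k) :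
    tripleAvg n G ≤ 5 * avg n fun i => avg n fun j => avg n fun k => G i j k := by
  have hn' : (3 : ℝ) ≤ n := by exact_mod_cast hn
  have hN := normalizer_nonneg hn
  have h1 : ∑ t ∈ distinctTriples n, G t.1 t.2.1 t.2.2 ≤
      ∑ i ∈ Finset.range n, ∑ j ∈ Finset.range n, ∑ k ∈ Finset.range n, G i j k := by
    rw [sum_distinctTriples]
    refine Finset.sum_le_sum fun i _ => Finset.sum_le_sum fun j _ => Finset.sum_le_sum fun k _ => ?_
    split_ifs
    · exact le_rfl
    · exact h i j k
  have h0 : 0 ≤ ∑ i ∈ Finset.range n, ∑ j ∈ Finset.range n, ∑ k ∈ Finset.range n, G i j k :=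
    Finset.sum_nonneg fun i _ => Finset.sum_nonneg fun j _ => Finset.sum_nonneg fun k _ => h i j k
  have h2 : (5 * avg n fun i => avg n fun j => avg n fun k => G i j k) =
      5 * ((n : ℝ)⁻¹) ^ 3 *
        ∑ i ∈ Finset.range n, ∑ j ∈ Finset.range n, ∑ k ∈ Finset.range n, G i j k := by
    simp only [avg, ← Finset.mul_sum]; ring
  rw [h2, tripleAvg]
  refine mul_le_mul ?_ h1 (Finset.sum_nonneg fun _ _ => h _ _ _) (by positivity)
  rw [inv_pow, ← div_eq_mul_inv, div_le_div_iff₀ hN (by positivity)]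
  have h6 : 0 ≤ 4 * (n : ℝ) ^ 2 - 15 * n + 10 := by nlinarith
  nlinarith [mul_nonneg (by linarith : (0:ℝ) ≤ n) h6]

section

variable {Ω : Type*} [MeasurableSpace Ω] {P : Measure Ω}

/-- A square integrable random curve is close in mean square to a finite dimensional subspace. -/
lemma exists_integral_norm_sub_onProj_lt {X : Ω → L2I} (hX : MemLp X 2 P) {ε : ℝ} (hε : 0 < ε) :
    ∃ (r : ℕ) (e : Fin r → L2I), Orthonormal ℝ e ∧ ∫ ω, ‖X ω - onProj e (X ω)‖ ^ 2 ∂P < ε := by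
  obtain ⟨g, hg, hg2⟩ := hX.exists_simpleFunc_eLpNorm_sub_lt (by simp)
    (ε := ENNReal.ofReal (Real.sqrt ε)) (by simpa using Real.sqrt_pos.2 hε)
  set V : Submodule ℝ L2I := Submodule.span ℝ (Set.range g) with hV
  have : FiniteDimensional ℝ V := FiniteDimensional.span_of_finite ℝ g.finite_range
  set b := stdOrthonormalBasis ℝ V with hb
  set e : Fin (Module.finrank ℝ V) → L2I := fun ν => (b ν : L2I) with he
  have heo : Orthonormal ℝ e := b.orthonormal.comp_linearIsometry V.subtypeₗᵢ
  refine ⟨_, e, heo, ?_⟩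
  have hproj : ∀ v ∈ V, onProj e v = v := by
    intro v hv
    have := b.sum_repr' ⟨v, hv⟩
    have h2 := congrArg (Subtype.val) this
    simpa [onProj, he] using h2
  have hle : ∀ ω, ‖X ω - onProj e (X ω)‖ ^ 2 ≤ ‖X ω - g ω‖ ^ 2 := by
    intro ω
    have h1 : onProj e (g ω) = g ω := hproj _ (Submodule.subset_span ⟨ω, rfl⟩)
    have h2 : X ω - onProj e (X ω) = (X ω - g ω) - onProj e (X ω - g ω) := by
      rw [onProj_sub, h1]; abel
    rw [h2]
    exact pow_le_pow_left₀ (norm_nonneg _) (norm_sub_onProj_le heo _) 2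
  have hXg : MemLp (X - ⇑g) 2 P := hX.sub hg2
  have hint : Integrable (fun ω => ‖X ω - g ω‖ ^ 2) P := by
    simpa using hXg.norm.integrable_sq
  refine (integral_mono_of_nonneg (Eventually.of_forall fun _ => by positivity) hint
    (Eventually.of_forall hle)).trans_lt ?_
  have h3 : eLpNorm (X - ⇑g) 2 P = ENNReal.ofReal (Real.sqrt (∫ ω, ‖X ω - g ω‖ ^ 2 ∂P)) := by
    rw [hXg.eLpNorm_eq_integral_rpow_norm (by norm_num) (by simp)]
    simp [Real.sqrt_eq_rpow]
  rw [h3, ENNReal.ofReal_lt_ofReal_iff (Real.sqrt_pos.2 hε)] at hg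
  exact (Real.sqrt_lt_sqrt_iff (integral_nonneg fun _ => by positivity)).1 hg

variable [IsProbabilityMeasure P]

lemma continuous_onProj {r : ℕ} (e : Fin r → L2I) : Continuous (onProj e) := by
  unfold onProj; fun_prop

/-- The estimated principal components of growing number capture the curves: they do so at least as
well as any fixed finite dimensional subspace. -/
lemma tendsto_avg_norm_sub_onProj {X : ℕ → Ω → L2I} (hX : IsIID P X) (h2 : MemLp (X 0) 2 P)
    {p : ℕ → ℕ} (hp : Tendsto p atTop atTop) {ψ : (n : ℕ) → Ω → Fin (p n) → L2I}
    (hψ : ∀ n, ∀ᵐ ω ∂P, IsEstimatedFPC n (p n) (fun i => X i ω) (ψ n ω)) :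
    Tendsto (fun q : ℕ × Ω => avg q.1 (fun i =>
      ‖(X i q.2 - sampleMean q.1 (fun i => X i q.2)) -
        onProj (ψ q.1 q.2) (X i q.2 - sampleMean q.1 (fun i => X i q.2))‖ ^ 2))
      (probFilter P) (𝓝 0) := by
  rw [Metric.tendsto_nhds]
  intro ε hε
  obtain ⟨r, e, he, hlt⟩ := exists_integral_norm_sub_onProj_lt h2 hε
  have hf : Measurable fun x : L2I => ‖x - onProj e x‖ ^ 2 :=
    ((continuous_id.sub (continuous_onProj e)).norm.pow 2).measurable
  have hint : Integrable (fun ω => ‖X 0 ω - onProj e (X 0 ω)‖ ^ 2) P := by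
    refine Integrable.mono' (g := fun ω => ‖X 0 ω‖ ^ 2) (by simpa using h2.norm.integrable_sq)
      (hf.comp (hX.meas 0)).aestronglyMeasurable (Eventually.of_forall fun ω => ?_)
    rw [Real.norm_of_nonneg (by positivity)]
    exact pow_le_pow_left₀ (norm_nonneg _) (norm_sub_onProj_le he _) 2
  have hl := hX.tendsto_avg hf hint
  have hl' := hl.eventually (Iio_mem_nhds hlt)
  have hr : ∀ᶠ q in probFilter P, r ≤ p q.1 :=
    tendsto_fst_probFilter.eventually (hp.eventually_ge_atTop r)
  have hψ' : ∀ᶠ q in probFilter P,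
      IsEstimatedFPC q.1 (p q.1) (fun i => X i q.2) (ψ q.1 q.2) := eventually_probFilter_of_ae hψ
  filter_upwards [hl', hr, hψ'] with q h1 h3 h4
  rw [Real.dist_eq, sub_zero, abs_of_nonneg (avg_nonneg fun i _ => by positivity)]
  exact (h4.avg_norm_sub_onProj_le he h3).trans_lt h1

/-- Short nonzero curves are rare; ties `X i = X k` are harmless because the projected difference
vanishes as well. -/
lemma tendsto_integral_indicator_norm {X : Ω → L2I} (hX : Measurable X) :
    Tendsto (fun m : ℕ => ∫ ω, (Ioo 0 ((m : ℝ) + 1)⁻¹).indicator (1 : ℝ → ℝ) ‖X ω‖ ∂P)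
      atTop (𝓝 0) := by
  suffices h : Tendsto (fun m : ℕ => ∫ ω, (Ioo 0 ((m : ℝ) + 1)⁻¹).indicator (1 : ℝ → ℝ) ‖X ω‖ ∂P)
      atTop (𝓝 (∫ _ω, (0 : ℝ) ∂P)) by
    simpa only [integral_zero] using h
  refine tendsto_integral_of_dominated_convergence (fun _ => 1) (fun m => ?_) (integrable_const _)
    (fun m => Eventually.of_forall fun ω => ?_) (Eventually.of_forall fun ω => ?_)
  · exact ((measurable_one.indicator measurableSet_Ioo).comp hX.norm).aestronglyMeasurable
  · rw [indicator_apply]; split_ifs <;> simp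
  · refine tendsto_const_nhds.congr' ?_
    rcases eq_or_lt_of_le (norm_nonneg (X ω)) with h0 | h0
    · refine Eventually.of_forall fun m => ?_
      exact (indicator_of_notMem (fun hc => hc.1.ne h0) _).symm
    · have : Tendsto (fun m : ℕ => ((m : ℝ) + 1)⁻¹) atTop (𝓝 0) := by
        simpa using tendsto_one_div_add_atTop_nhds_zero_nat (𝕜 := ℝ)
      filter_upwards [this.eventually (Iio_mem_nhds h0)] with m hm
      exact (indicator_of_notMem (fun hc => lt_asymm hc.2 hm) _).symm

/-- Replacing the curves by their estimated principal component scores changes the angles by a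
quantity that vanishes on average. -/
lemma tendsto_tripleAvg_angle {X : ℕ → Ω → L2I} (hX : IsIID P X) (h2 : MemLp (X 0) 2 P)
    {p : ℕ → ℕ} (hp : Tendsto p atTop atTop) {ψ : (n : ℕ) → Ω → Fin (p n) → L2I}
    (hψ : ∀ n, ∀ᵐ ω ∂P, IsEstimatedFPC n (p n) (fun i => X i ω) (ψ n ω)) :
    Tendsto (fun q : ℕ × Ω => tripleAvg q.1 (fun i j k =>
      |InnerProductGeometry.angle
          (fpcScores (ψ q.1 q.2) (X i q.2) - fpcScores (ψ q.1 q.2) (X k q.2))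
          (fpcScores (ψ q.1 q.2) (X k q.2) - fpcScores (ψ q.1 q.2) (X j q.2)) -
        InnerProductGeometry.angle (X i q.2 - X k q.2) (X k q.2 - X j q.2)|))
      (probFilter P) (𝓝 0) := by
  have hpi := Real.pi_pos
  set A : ℕ × Ω → ℝ := fun q => avg q.1 (fun i =>
      ‖(X i q.2 - sampleMean q.1 (fun i => X i q.2)) -
        onProj (ψ q.1 q.2) (X i q.2 - sampleMean q.1 (fun i => X i q.2))‖ ^ 2) with hA
  have hA0 : Tendsto A (probFilter P) (𝓝 0) := tendsto_avg_norm_sub_onProj hX h2 hp hψ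
  rw [Metric.tendsto_nhds]
  intro ε hε
  -- the radius below which differences of curves are considered short
  obtain ⟨m, hm1, hm2⟩ := (((tendsto_integral_indicator_norm (P := P)
    ((hX.meas 0).sub (hX.meas 2))).eventually
        (Iio_mem_nhds (by positivity : 0 < ε / (2 * Real.pi)))).and
    ((tendsto_integral_indicator_norm (P := P)
    ((hX.meas 2).sub (hX.meas 1))).eventually
      (Iio_mem_nhds (by positivity : 0 < ε / (2 * Real.pi))))).exists
  set τ : ℝ := ((m : ℝ) + 1)⁻¹ with hτ
  have hτ0 : 0 < τ := by positivity
  have hmeas : Measurable fun x : L2I => (Ioo 0 τ).indicator (1 : ℝ → ℝ) ‖x‖ :=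
    (measurable_one.indicator measurableSet_Ioo).comp measurable_norm
  have hb : ∀ Y : Ω → L2I, Measurable Y →
      MemLp (fun ω => (Ioo 0 τ).indicator (1 : ℝ → ℝ) ‖Y ω‖) 2 P := by
    intro Y hY
    refine MemLp.of_bound (hmeas.comp hY).aestronglyMeasurable 1 (Eventually.of_forall fun ω => ?_)
    rw [indicator_apply]; split_ifs <;> simp
  have l1 := hX.tendsto_tripleAvg (G := fun z => (Ioo 0 τ).indicator (1 : ℝ → ℝ) ‖z.1 - z.2.2‖)
    (hmeas.comp (measurable_fst.sub measurable_snd.snd)) (hb _ ((hX.meas 0).sub (hX.meas 2)))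
  have l2 := hX.tendsto_tripleAvg (G := fun z => (Ioo 0 τ).indicator (1 : ℝ → ℝ) ‖z.2.2 - z.2.1‖)
    (hmeas.comp (measurable_snd.snd.sub measurable_snd.fst)) (hb _ ((hX.meas 2).sub (hX.meas 1)))
  have l3 := ((l1.add l2).const_mul (Real.pi / 2)).add
    ((hA0.sqrt.const_mul (20 * τ⁻¹)).const_mul (Real.pi / 2))
  have hlt : Real.pi / 2 * ((∫ ω, (Ioo 0 τ).indicator (1 : ℝ → ℝ) ‖X 0 ω - X 2 ω‖ ∂P) +
      ∫ ω, (Ioo 0 τ).indicator (1 : ℝ → ℝ) ‖X 2 ω - X 1 ω‖ ∂P) +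
      Real.pi / 2 * (20 * τ⁻¹ * Real.sqrt 0) < ε := by
    rw [Real.sqrt_zero, mul_zero, mul_zero, add_zero]
    have h5 := add_lt_add hm1 hm2
    calc _ < Real.pi / 2 * (ε / (2 * Real.pi) + ε / (2 * Real.pi)) :=
          mul_lt_mul_of_pos_left h5 (by positivity)
      _ = ε / 2 := by field_simp; ring
      _ < ε := by linarith
  have hψ' : ∀ᶠ q in probFilter P,
      IsEstimatedFPC q.1 (p q.1) (fun i => X i q.2) (ψ q.1 q.2) := eventually_probFilter_of_ae hψ
  filter_upwards [l3.eventually (Iio_mem_nhds hlt), hψ',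
    (tendsto_fst_probFilter (P := P)).eventually_ge_atTop 3] with q hq hψq hn
  rw [Real.dist_eq, sub_zero, abs_of_nonneg (tripleAvg_nonneg hn fun _ _ _ => abs_nonneg _)]
  refine lt_of_le_of_lt ?_ hq
  set Xq : ℕ → L2I := fun i => X i q.2 with hXq
  set w : ℕ → ℝ := fun i => ‖(Xq i - sampleMean q.1 Xq) -
    onProj (ψ q.1 q.2) (Xq i - sampleMean q.1 Xq)‖ with hw
  have hwd : ∀ i k, ‖(Xq i - Xq k) - onProj (ψ q.1 q.2) (Xq i - Xq k)‖ ≤ w i + w k := by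
    intro i k
    have h6 : (Xq i - Xq k) - onProj (ψ q.1 q.2) (Xq i - Xq k) =
        ((Xq i - sampleMean q.1 Xq) - onProj (ψ q.1 q.2) (Xq i - sampleMean q.1 Xq)) -
        ((Xq k - sampleMean q.1 Xq) - onProj (ψ q.1 q.2) (Xq k - sampleMean q.1 Xq)) := by
      simp only [onProj_sub]; abel
    rw [h6]
    exact norm_sub_le _ _
  have hterm : ∀ i j k, |InnerProductGeometry.angle
          (fpcScores (ψ q.1 q.2) (Xq i) - fpcScores (ψ q.1 q.2) (Xq k))
          (fpcScores (ψ q.1 q.2) (Xq k) - fpcScores (ψ q.1 q.2) (Xq j)) -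
        InnerProductGeometry.angle (Xq i - Xq k) (Xq k - Xq j)| ≤
      Real.pi / 2 * ((Ioo 0 τ).indicator (1 : ℝ → ℝ) ‖Xq i - Xq k‖ +
        (Ioo 0 τ).indicator (1 : ℝ → ℝ) ‖Xq k - Xq j‖) +
      Real.pi / 2 * (τ⁻¹ * (w i + w k + (w k + w j))) := by
    intro i j k
    rw [← fpcScores_sub, ← fpcScores_sub, angle_fpcScores hψq.1, ← mul_add]
    refine (abs_angle_onProj_sub_le hψq.1 _ _).trans
      (mul_le_mul_of_nonneg_left ?_ (by positivity))
    have h7 := norm_sub_onProj_div_le hψq.1 (Xq i - Xq k) hτ0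
    have h8 := norm_sub_onProj_div_le hψq.1 (Xq k - Xq j) hτ0
    have h9 := mul_le_mul_of_nonneg_left (hwd i k) (inv_nonneg.2 hτ0.le)
    have h10 := mul_le_mul_of_nonneg_left (hwd k j) (inv_nonneg.2 hτ0.le)
    rw [mul_add τ⁻¹ (w i + w k)]
    linarith
  refine (tripleAvg_mono hn fun i _ j _ k _ => hterm i j k).trans ?_
  rw [tripleAvg_add, tripleAvg_mul_left, tripleAvg_add, tripleAvg_mul_left, tripleAvg_mul_left]
  refine add_le_add le_rfl (mul_le_mul_of_nonneg_left ?_ (by positivity))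
  rw [mul_comm 20, mul_assoc]
  refine mul_le_mul_of_nonneg_left ?_ (inv_nonneg.2 hτ0.le)
  have hn0 : q.1 ≠ 0 := by omega
  refine (tripleAvg_le hn fun i j k => by positivity).trans ?_
  have h11 : (avg q.1 fun i => avg q.1 fun j => avg q.1 fun k => w i + w k + (w k + w j)) =
      4 * avg q.1 w := by
    simp only [avg_add, avg_const hn0]
    ring
  rw [h11]
  have h12 : avg q.1 w ≤ Real.sqrt (A q) := Real.le_sqrt_of_sq_le (avg_sq_le _ _)
  linarith

end

/-! ### The arcsine series -/

/-- The Taylor coefficients of `arcsin` of odd order are positive. -/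
lemma exists_hasSum_arcsin : ∃ a : ℕ → ℝ, (∀ j, 0 < a j) ∧
    ∀ t : ℝ, |t| < 1 → HasSum (fun j => a j * t ^ (2 * j + 1)) (Real.arcsin t) := by
  set c : ℕ → ℝ := fun j => Ring.choose ((1 / 2 : ℝ) + j - 1) j with hc
  have hcpos : ∀ j, 0 < c j := by
    intro j
    have h1 : c j = Ring.multichoose (1 / 2 : ℝ) j := (Ring.multichoose_eq _ _).symm
    have h2 := Ring.factorial_nsmul_multichoose_eq_ascPochhammer (1 / 2 : ℝ) j
    rw [Polynomial.ascPochhammer_smeval_eq_eval, nsmul_eq_mul] at h2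
    have h3 := ascPochhammer_pos j (1 / 2 : ℝ) (by norm_num)
    rw [← h2, ← h1] at h3
    exact (pos_iff_pos_of_mul_pos h3).1 (by exact_mod_cast j.factorial_pos)
  have hser : ∀ x : ℝ, |x| < 1 → HasSum (fun j => c j * x ^ j) (1 / (1 - x) ^ (1 / 2 : ℝ)) := by
    intro x hx
    have h := (Real.one_div_one_sub_rpow_hasFPowerSeriesOnBall_zero (1 / 2)).hasSum
      (y := x) (by simpa [enorm_eq_nnnorm, ← NNReal.coe_lt_one] using hx)
    simpa [FormalMultilinearSeries.ofScalars_apply_eq, hc, mul_comm] using h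
  refine ⟨fun j => c j / (2 * j + 1), fun j => div_pos (hcpos j) (by positivity), fun t ht => ?_⟩
  obtain ⟨r, hr1, hr2⟩ := exists_between ht
  have hr0 : 0 < r := (abs_nonneg t).trans_lt hr1
  have hsq : ∀ s : ℝ, |s| < 1 → |s ^ 2| < 1 := by
    intro s hs
    rw [abs_pow]
    exact pow_lt_one₀ (abs_nonneg s) hs two_ne_zero
  set g : ℕ → ℝ → ℝ := fun j s => c j / (2 * j + 1) * s ^ (2 * j + 1) with hg
  set g' : ℕ → ℝ → ℝ := fun j s => c j * (s ^ 2) ^ j with hg'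
  have hder : ∀ j s, HasDerivAt (g j) (g' j s) s := by
    intro j s
    have h := (hasDerivAt_pow (2 * j + 1) s).const_mul (c j / (2 * j + 1))
    refine h.congr_deriv ?_
    have hj : (2 * (j : ℝ) + 1) ≠ 0 := by positivity
    rw [Nat.add_sub_cancel, show g' j s = c j * s ^ (2 * j) by rw [pow_mul]]
    push_cast
    field_simp
  have hr' : |r| < 1 := by rwa [abs_of_pos hr0]
  have hu : Summable (g' · r) := (hser (r ^ 2) (hsq r hr')).summable
  have hopen : IsOpen (Ioo (-r) r) := isOpen_Ioo
  have hbound : ∀ j s, s ∈ Ioo (-r) r → ‖g' j s‖ ≤ g' j r := by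
    intro j s hs
    simp only [hg']
    rw [norm_mul, Real.norm_of_nonneg (hcpos j).le, norm_pow, Real.norm_of_nonneg (sq_nonneg s)]
    refine mul_le_mul_of_nonneg_left (pow_le_pow_left₀ (sq_nonneg s) ?_ j) (hcpos j).le
    exact sq_le_sq' hs.1.le hs.2.le
  have h0mem : (0 : ℝ) ∈ Ioo (-r) r := ⟨by linarith, hr0⟩
  have hg0 : Summable fun j => g j 0 := by
    have : (fun j => g j 0) = fun _ => (0 : ℝ) := by ext j; simp [hg]
    rw [this]; exact summable_zero
  have hD : ∀ s ∈ Ioo (-r) r, HasDerivAt (fun z => ∑' j, g j z) (∑' j, g' j s) s := fun s hs =>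
    hasDerivAt_tsum_of_isPreconnected hu hopen isPreconnected_Ioo (fun j y _ => hder j y)
      hbound h0mem hg0 hs
  have habs : ∀ s ∈ Ioo (-r) r, |s| < 1 := fun s hs => (abs_lt.2 hs).trans hr2
  have heq : EqOn (fun z => ∑' j, g j z) Real.arcsin (Ioo (-r) r) := by
    have hA : ∀ s ∈ Ioo (-r) r, HasDerivAt Real.arcsin (1 / Real.sqrt (1 - s ^ 2)) s := by
      intro s hs
      have := abs_lt.1 (habs s hs)
      exact Real.hasDerivAt_arcsin (by linarith [this.1]) (by linarith [this.2])
    refine IsOpen.eqOn_of_deriv_eq (x := 0) hopen isPreconnected_Ioo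
      (fun s hs => (hD s hs).differentiableAt.differentiableWithinAt)
      (fun s hs => (hA s hs).differentiableAt.differentiableWithinAt) (fun s hs => ?_) h0mem ?_
    · rw [(hD s hs).deriv, (hA s hs).deriv, (hser (s ^ 2) (hsq s (habs s hs))).tsum_eq,
        Real.sqrt_eq_rpow]
    · simp [hg]
  have htm : t ∈ Ioo (-r) r := abs_lt.1 hr1
  have hsumm : Summable fun j => g j t := by
    refine Summable.of_norm_bounded (g := fun j => g' j r) hu fun j => ?_
    have h1 : ‖g j t‖ = c j / (2 * j + 1) * |t| ^ (2 * j + 1) := by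
      simp only [hg]
      rw [norm_mul, Real.norm_of_nonneg (div_pos (hcpos j) (by positivity)).le, norm_pow,
        Real.norm_eq_abs]
    rw [h1]
    simp only [hg', ← pow_mul]
    refine mul_le_mul (div_le_self (hcpos j).le (by linarith [(Nat.cast_nonneg j : (0:ℝ) ≤ j)])) ?_
      (by positivity) (hcpos j).le
    calc |t| ^ (2 * j + 1) ≤ |t| ^ (2 * j) :=
          pow_le_pow_of_le_one (abs_nonneg t) ht.le (by omega)
      _ ≤ r ^ (2 * j) := pow_le_pow_left₀ (abs_nonneg t) hr1.le _
  have hfin := hsumm.hasSum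
  have h2 := heq htm
  simp only at h2
  rw [h2] at hfin
  exact hfin

/-! ### Positive definiteness of the angle kernel -/

section Kernel

variable {H : Type*} [NormedAddCommGroup H] [InnerProductSpace ℝ H]

lemma Orthonormal.countable' [TopologicalSpace.SeparableSpace H] {ι : Type*} {v : ι → H}
    (hv : Orthonormal ℝ v) : Countable ι := by
  rw [← Set.countable_univ_iff]
  refine Set.PairwiseDisjoint.countable_of_isOpen (s := fun i => Metric.ball (v i) (1 / 2)) ?_
    (fun i _ => Metric.isOpen_ball) (fun i _ => ⟨v i, by simp⟩)
  intro i _ j _ hij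
  refine Metric.ball_disjoint_ball ?_
  rw [dist_eq_norm]
  refine le_of_sq_le_sq ?_ (norm_nonneg _)
  rw [norm_sub_sq_real, hv.1 i, hv.1 j, hv.2 hij]
  norm_num

variable [SecondCountableTopology H] [MeasurableSpace H] [BorelSpace H]
  {S : Type*} [MeasurableSpace S] {μ : Measure S}

/-- The quadratic form of the kernel `⟨u, v⟩ ^ j` at the image under `U` of the signed measure
with density `f`. -/
def powForm (μ : Measure S) (U : S → H) (j : ℕ) (f : S → ℝ) : ℝ :=
  ∫ z, f z.1 * f z.2 * inner ℝ (U z.1) (U z.2) ^ j ∂(μ.prod μ)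

lemma integrable_mul_inner {U : S → H} (hU : Measurable U) (hU1 : ∀ s, ‖U s‖ ≤ 1) {f : S → ℝ}
    (hf : Integrable f μ) {v : H} (hv : ‖v‖ ≤ 1) :
    Integrable (fun s => f s * inner ℝ v (U s)) μ := by
  refine hf.mul_bdd (c := 1) (measurable_const.inner hU).aestronglyMeasurable
    (Eventually.of_forall fun s => ?_)
  refine (norm_inner_le_norm _ _).trans ?_
  exact mul_le_one₀ hv (norm_nonneg _) (hU1 s)

lemma hasSum_powForm {U : S → H} (hU : Measurable U) (hU1 : ∀ s, ‖U s‖ ≤ 1) {f : S → ℝ}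
    (hf : Integrable f μ) {ι : Type*} (b : HilbertBasis ι ℝ H) (j : ℕ) :
    HasSum (fun i => powForm μ U j (fun s => f s * inner ℝ (b i) (U s)))
      (powForm μ U (j + 1) f) := by
  have : Countable ι := Orthonormal.countable' b.orthonormal
  have hff : Integrable (fun z : S × S => f z.1 * f z.2) (μ.prod μ) := hf.mul_prod hf
  have hm1 : Measurable fun z : S × S => U z.1 := hU.comp measurable_fst
  have hm2 : Measurable fun z : S × S => U z.2 := hU.comp measurable_snd
  have hin : Measurable fun z : S × S => inner ℝ (U z.1) (U z.2) := hm1.inner hm2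
  have hle : ∀ z : S × S, ‖inner ℝ (U z.1) (U z.2)‖ ≤ 1 := fun z =>
    (norm_inner_le_norm _ _).trans (mul_le_one₀ (hU1 _) (norm_nonneg _) (hU1 _))
  have hpars : ∀ u : H, HasSum (fun i => inner ℝ (b i) u ^ 2) (‖u‖ ^ 2) := by
    intro u
    have h := b.hasSum_inner_mul_inner u u
    rw [real_inner_self_eq_norm_sq] at h
    refine h.congr_fun ?_
    intro i; rw [real_inner_comm u (b i), sq]
  set bound : ι → S × S → ℝ := fun i z =>
    |f z.1 * f z.2| * (2⁻¹ * (inner ℝ (b i) (U z.1) ^ 2 + inner ℝ (b i) (U z.2) ^ 2)) with hbd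
  have hbs : ∀ z, HasSum (fun i => bound i z)
      (|f z.1 * f z.2| * (2⁻¹ * (‖U z.1‖ ^ 2 + ‖U z.2‖ ^ 2))) := fun z =>
    (((hpars (U z.1)).add (hpars (U z.2))).mul_left 2⁻¹).mul_left _
  refine hasSum_integral_of_dominated_convergence bound ?_ ?_ ?_ ?_ ?_
  · intro i
    have h1 : AEStronglyMeasurable (fun z : S × S => f z.1 * f z.2 *
        (inner ℝ (b i) (U z.1) * inner ℝ (b i) (U z.2) * inner ℝ (U z.1) (U z.2) ^ j))
        (μ.prod μ) := hff.1.mul (((measurable_const.inner hm1).mul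
          (measurable_const.inner hm2)).mul (hin.pow_const j)).aestronglyMeasurable
    refine h1.congr (Eventually.of_forall fun z => ?_)
    simp only; ring
  · intro i
    refine Eventually.of_forall fun z => ?_
    have h1 : f z.1 * inner ℝ (b i) (U z.1) * (f z.2 * inner ℝ (b i) (U z.2)) *
        inner ℝ (U z.1) (U z.2) ^ j = f z.1 * f z.2 *
        (inner ℝ (b i) (U z.1) * inner ℝ (b i) (U z.2)) * inner ℝ (U z.1) (U z.2) ^ j := by ring
    rw [h1, norm_mul, norm_mul, norm_pow, Real.norm_eq_abs (f z.1 * f z.2)]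
    have h2 : ‖inner ℝ (U z.1) (U z.2)‖ ^ j ≤ 1 := pow_le_one₀ (norm_nonneg _) (hle z)
    refine (mul_le_of_le_one_right (by positivity) h2).trans ?_
    refine mul_le_mul_of_nonneg_left ?_ (abs_nonneg _)
    rw [Real.norm_eq_abs, abs_mul]
    nlinarith [sq_nonneg (|inner ℝ (b i) (U z.1)| - |inner ℝ (b i) (U z.2)|),
      sq_abs (inner ℝ (b i) (U z.1)), sq_abs (inner ℝ (b i) (U z.2))]
  · exact Eventually.of_forall fun z => (hbs z).summable
  · simp_rw [fun z => (hbs z).tsum_eq]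
    refine hff.abs.mul_bdd (c := 1) ?_ (Eventually.of_forall fun z => ?_)
    · exact (((hm1.norm.pow_const 2).add (hm2.norm.pow_const 2)).const_mul _).aestronglyMeasurable
    · rw [Real.norm_of_nonneg (by positivity)]
      have h1 := pow_le_one₀ (n := 2) (norm_nonneg _) (hU1 z.1)
      have h2 := pow_le_one₀ (n := 2) (norm_nonneg _) (hU1 z.2)
      linarith
  · refine Eventually.of_forall fun z => ?_
    have h := ((b.hasSum_inner_mul_inner (U z.1) (U z.2)).mul_left (f z.1 * f z.2)).mul_right
      (inner ℝ (U z.1) (U z.2) ^ j)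
    rw [mul_assoc, ← pow_succ'] at h
    refine h.congr_fun ?_
    intro i
    simp only [real_inner_comm (U z.1) (b i)]; ring

variable [CompleteSpace H] [IsFiniteMeasure μ]

/-- Power kernels are positive semidefinite: expanding one factor in a Hilbert basis writes the form
of degree `j + 1` as a sum of forms of degree `j`. -/
lemma powForm_nonneg {U : S → H} (hU : Measurable U) (hU1 : ∀ s, ‖U s‖ ≤ 1) (j : ℕ) {f : S → ℝ}
    (hf : Integrable f μ) : 0 ≤ powForm μ U j f := by
  obtain ⟨w, b, hb⟩ := exists_hilbertBasis ℝ H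
  induction j generalizing f with
  | zero =>
    simp only [powForm, pow_zero, mul_one]
    rw [integral_prod_mul]
    exact mul_self_nonneg _
  | succ j ih =>
    exact (hasSum_powForm hU hU1 hf b j).nonneg fun i =>
      ih (integrable_mul_inner hU hU1 hf (b.orthonormal.1 i).le)

/-- A signed measure in the kernel of the form of degree `j` has vanishing directional moments of
that degree. -/
lemma integral_mul_inner_pow_eq_zero {U : S → H} (hU : Measurable U) (hU1 : ∀ s, ‖U s‖ ≤ 1) (j : ℕ)
    {f : S → ℝ} (hf : Integrable f μ) (h0 : powForm μ U j f = 0) {γ : H} (hγ : ‖γ‖ = 1) :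
    ∫ s, f s * inner ℝ γ (U s) ^ j ∂μ = 0 := by
  have ho : Orthonormal ℝ ((↑) : ({γ} : Set H) → H) := by
    refine ⟨fun v => ?_, fun u v huv => absurd (Subsingleton.elim u v) huv⟩
    rw [show (v : H) = γ from v.2, hγ]
  obtain ⟨w, b, hw, hb⟩ := ho.exists_hilbertBasis_extension
  have hγw : γ ∈ w := hw rfl
  have hbγ : b ⟨γ, hγw⟩ = γ := by rw [hb]
  induction j generalizing f with
  | zero =>
    simp only [powForm, pow_zero, mul_one] at h0 ⊢
    rw [integral_prod_mul] at h0
    exact mul_self_eq_zero.1 h0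
  | succ j ih =>
    have hs := hasSum_powForm hU hU1 hf b j
    rw [h0, hasSum_zero_iff_of_nonneg fun i => powForm_nonneg hU hU1 j
      (integrable_mul_inner hU hU1 hf (b.orthonormal.1 i).le)] at hs
    have h1 := congrFun hs ⟨γ, hγw⟩
    simp only [hbγ, Pi.zero_apply] at h1
    have h2 := ih (integrable_mul_inner hU hU1 hf hγ.le) h1
    rw [← h2]
    refine integral_congr_ae (Eventually.of_forall fun s => ?_)
    simp only; ring

/-- The quadratic form of the kernel `arcsin ⟨u, v⟩`. -/
def arcsinForm (μ : Measure S) (U : S → H) (f : S → ℝ) : ℝ :=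
  ∫ z, f z.1 * f z.2 * Real.arcsin (inner ℝ (U z.1) (U z.2)) ∂(μ.prod μ)

/-- The arcsine kernel dominates a positive multiple of each of its odd power kernels. -/
lemma exists_mul_powForm_le_arcsinForm : ∃ a : ℕ → ℝ, (∀ j, 0 < a j) ∧
    ∀ {U : S → H} (_ : Measurable U) (_ : ∀ s, ‖U s‖ ≤ 1) {f : S → ℝ} (_ : Integrable f μ) (j : ℕ),
      a j * powForm μ U (2 * j + 1) f ≤ arcsinForm μ U f := by
  obtain ⟨a, ha, hsum⟩ := exists_hasSum_arcsin
  refine ⟨a, ha, fun {U} hU hU1 {f} hf j => ?_⟩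
  have hff : Integrable (fun z : S × S => f z.1 * f z.2) (μ.prod μ) := hf.mul_prod hf
  have hin : Measurable fun z : S × S => inner ℝ (U z.1) (U z.2) :=
    (hU.comp measurable_fst).inner (hU.comp measurable_snd)
  have hle : ∀ z : S × S, |inner ℝ (U z.1) (U z.2)| ≤ 1 := fun z =>
    (abs_real_inner_le_norm _ _).trans (mul_le_one₀ (hU1 _) (norm_nonneg _) (hU1 _))
  have hr : ∀ r : ℝ, 0 < r → r < 1 → a j * r ^ (2 * j + 1) * powForm μ U (2 * j + 1) f ≤
      ∫ z, f z.1 * f z.2 * Real.arcsin (r * inner ℝ (U z.1) (U z.2)) ∂(μ.prod μ) := by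
    intro r hr0 hr1
    have hS : HasSum (fun i => a i * r ^ (2 * i + 1) * powForm μ U (2 * i + 1) f)
        (∫ z, f z.1 * f z.2 * Real.arcsin (r * inner ℝ (U z.1) (U z.2)) ∂(μ.prod μ)) := by
      simp only [powForm, ← integral_const_mul]
      refine hasSum_integral_of_dominated_convergence
        (fun i z => |f z.1 * f z.2| * (a i * r ^ (2 * i + 1))) (fun i => ?_) (fun i => ?_) ?_ ?_ ?_
      · exact (hff.1.mul (hin.pow_const _).aestronglyMeasurable).const_mul _
      · refine Eventually.of_forall fun z => ?_
        rw [norm_mul, norm_mul (f z.1 * f z.2),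
          Real.norm_of_nonneg (by have := ha i; positivity : 0 ≤ a i * r ^ (2 * i + 1)),
          Real.norm_eq_abs (f z.1 * f z.2), mul_comm]
        refine mul_le_mul_of_nonneg_right ?_ (by have := ha i; positivity)
        refine mul_le_of_le_one_right (abs_nonneg _) ?_
        rw [norm_pow, Real.norm_eq_abs]
        exact pow_le_one₀ (abs_nonneg _) (hle z)
      · exact Eventually.of_forall fun z =>
          (hsum r (by rwa [abs_of_pos hr0])).summable.mul_left _
      · simp_rw [tsum_mul_left]
        exact hff.abs.mul_const _
      · refine Eventually.of_forall fun z => ?_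
        have hlt : |r * inner ℝ (U z.1) (U z.2)| < 1 := by
          rw [abs_mul, abs_of_pos hr0]
          exact (mul_le_of_le_one_right hr0.le (hle z)).trans_lt hr1
        refine ((hsum _ hlt).mul_left (f z.1 * f z.2)).congr_fun ?_
        intro i
        rw [mul_pow]; ring
    refine le_hasSum hS j fun i _ => ?_
    have := powForm_nonneg hU hU1 (2 * i + 1) hf
    have := ha i
    positivity
  have hlim : Tendsto (fun m : ℕ => (1 : ℝ) - 1 / ((m : ℝ) + 2)) atTop (𝓝 1) := by
    have h1 := (tendsto_add_atTop_iff_nat 1).2 (tendsto_one_div_add_atTop_nhds_zero_nat (𝕜 := ℝ))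
    have h2 := h1.const_sub 1
    rw [sub_zero] at h2
    refine h2.congr fun m => ?_
    push_cast; ring
  have hpos : ∀ m : ℕ, 0 < (1 : ℝ) - 1 / ((m : ℝ) + 2) ∧ (1 : ℝ) - 1 / ((m : ℝ) + 2) < 1 := by
    intro m
    have h1 : (0 : ℝ) < m + 2 := by positivity
    have h2 : 1 / ((m : ℝ) + 2) < 1 := by
      rw [div_lt_one h1]; linarith [(Nat.cast_nonneg m : (0:ℝ) ≤ m)]
    exact ⟨by linarith, by linarith [one_div_pos.2 h1]⟩
  have hL : Tendsto (fun m : ℕ => a j * (1 - 1 / ((m : ℝ) + 2)) ^ (2 * j + 1) *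
      powForm μ U (2 * j + 1) f) atTop (𝓝 (a j * powForm μ U (2 * j + 1) f)) := by
    simpa using ((hlim.pow (2 * j + 1)).const_mul (a j)).mul_const (powForm μ U (2 * j + 1) f)
  have hR : Tendsto (fun m : ℕ => ∫ z, f z.1 * f z.2 *
      Real.arcsin ((1 - 1 / ((m : ℝ) + 2)) * inner ℝ (U z.1) (U z.2)) ∂(μ.prod μ)) atTop
      (𝓝 (arcsinForm μ U f)) := by
    refine tendsto_integral_of_dominated_convergence (fun z => |f z.1 * f z.2| * (Real.pi / 2))
      (fun m => ?_) (hff.abs.mul_const _) (fun m => Eventually.of_forall fun z => ?_)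
      (Eventually.of_forall fun z => ?_)
    · exact hff.1.mul (Real.continuous_arcsin.measurable.comp
        (hin.const_mul _)).aestronglyMeasurable
    · rw [norm_mul, Real.norm_eq_abs (f z.1 * f z.2)]
      exact mul_le_mul_of_nonneg_left
        (abs_le.2 ⟨Real.neg_pi_div_two_le_arcsin _, Real.arcsin_le_pi_div_two _⟩) (abs_nonneg _)
    · refine Tendsto.const_mul _ ((Real.continuous_arcsin.tendsto _).comp ?_)
      simpa using hlim.mul_const (inner ℝ (U z.1) (U z.2))
  exact le_of_tendsto_of_tendsto' hL hR fun m => hr _ (hpos m).1 (hpos m).2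

lemma arcsinForm_nonneg {U : S → H} (hU : Measurable U) (hU1 : ∀ s, ‖U s‖ ≤ 1) {f : S → ℝ}
    (hf : Integrable f μ) : 0 ≤ arcsinForm μ U f := by
  obtain ⟨a, ha, h⟩ := exists_mul_powForm_le_arcsinForm (μ := μ) (H := H)
  exact (mul_nonneg (ha 0).le (powForm_nonneg hU hU1 _ hf)).trans (h hU hU1 hf 0)

/-- If the arcsine form vanishes at a signed measure on the unit ball, then so do the differences
of its masses of opposite half-spaces: the odd directional moments vanish, and odd polynomials
approximate odd continuous functions, which in turn approximate the sign. -/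
lemma integral_mul_sign_inner_eq_zero {U : S → H} (hU : Measurable U) (hU1 : ∀ s, ‖U s‖ ≤ 1)
    {f : S → ℝ} (hf : Integrable f μ) (h0 : arcsinForm μ U f = 0) (γ : H) :
    ∫ s, f s * Real.sign (inner ℝ γ (U s)) ∂μ = 0 := by
  rcases eq_or_ne γ 0 with rfl | hγ0
  · simp
  wlog hγ : ‖γ‖ = 1 generalizing γ
  · have h1 := this (‖γ‖⁻¹ • γ) (by simpa using hγ0) (by
      rw [norm_smul, norm_inv, norm_norm, inv_mul_cancel₀ (norm_ne_zero_iff.2 hγ0)])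
    rw [← h1]
    refine integral_congr_ae (Eventually.of_forall fun s => ?_)
    simp only
    rw [inner_smul_left]
    have : 0 < ‖γ‖⁻¹ := inv_pos.2 (norm_pos_iff.2 hγ0)
    rw [conj_trivial]
    congr 1
    rcases lt_trichotomy (inner ℝ γ (U s)) 0 with h | h | h
    · rw [Real.sign_of_neg h, Real.sign_of_neg (mul_neg_of_pos_of_neg this h)]
    · rw [h, mul_zero]
    · rw [Real.sign_of_pos h, Real.sign_of_pos (mul_pos this h)]
  obtain ⟨a, ha, hle⟩ := exists_mul_powForm_le_arcsinForm (μ := μ) (H := H)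
  set W : S → ℝ := fun s => inner ℝ γ (U s) with hW
  have hWm : Measurable W := measurable_const.inner hU
  have hW1 : ∀ s, W s ∈ Icc (-1 : ℝ) 1 := fun s => abs_le.1
    ((abs_real_inner_le_norm _ _).trans (mul_le_one₀ hγ.le (norm_nonneg _) (hU1 s)))
  have hodd : ∀ j, ∫ s, f s * W s ^ (2 * j + 1) ∂μ = 0 := by
    intro j
    refine integral_mul_inner_pow_eq_zero hU hU1 _ hf ?_ hγ
    have h1 := powForm_nonneg hU hU1 (2 * j + 1) hf
    have h2 := hle hU hU1 hf j
    rw [h0] at h2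
    exact le_antisymm (nonpos_of_mul_nonpos_right h2 (ha j)) h1
  have hintc : ∀ φ : ℝ → ℝ, Continuous φ → Integrable (fun s => f s * φ (W s)) μ := by
    intro φ hφ
    obtain ⟨C, hC⟩ := isCompact_Icc.exists_bound_of_continuousOn (hφ.continuousOn (s := Icc (-1) 1))
    exact hf.mul_bdd (c := C) (hφ.measurable.comp hWm).aestronglyMeasurable
      (Eventually.of_forall fun s => hC _ (hW1 s))
  have hpoly : ∀ q : Polynomial ℝ, ∫ s, f s * (q.eval (W s) - q.eval (-W s)) ∂μ = 0 := by
    intro q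
    induction q using Polynomial.induction_on' with
    | add q r hq hr =>
      have h1 : ∀ s, f s * ((q + r).eval (W s) - (q + r).eval (-W s)) =
          f s * (q.eval (W s) - q.eval (-W s)) + f s * (r.eval (W s) - r.eval (-W s)) := by
        intro s; simp only [Polynomial.eval_add]; ring
      simp_rw [h1]
      rw [integral_add, hq, hr, add_zero]
      · exact hintc (fun t => q.eval t - q.eval (-t)) (by fun_prop)
      · exact hintc (fun t => r.eval t - r.eval (-t)) (by fun_prop)
    | monomial n c =>
      simp only [Polynomial.eval_monomial]
      rcases Nat.even_or_odd n with hn | ⟨j, rfl⟩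
      · simp [hn.neg_pow]
      · have h1 : ∀ s, f s * (c * W s ^ (2 * j + 1) - c * (-W s) ^ (2 * j + 1)) =
            2 * c * (f s * W s ^ (2 * j + 1)) := by
          intro s; rw [Odd.neg_pow ⟨j, rfl⟩]; ring
        simp_rw [h1]
        rw [integral_const_mul, hodd, mul_zero]
  have hcont : ∀ φ : ℝ → ℝ, Continuous φ → (∀ t, φ (-t) = - φ t) → ∫ s, f s * φ (W s) ∂μ = 0 := by
    intro φ hφ hφodd
    by_contra hne
    have hI := abs_pos.2 hne
    set I := ∫ s, f s * φ (W s) ∂μ with hIdef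
    set M := ∫ s, |f s| ∂μ with hM
    have hM0 : 0 ≤ M := integral_nonneg fun _ => abs_nonneg _
    obtain ⟨q, hq⟩ := exists_polynomial_near_of_continuousOn (-1) 1 φ hφ.continuousOn
      (|I| / (M + 1)) (by positivity)
    have h1 : I = ∫ s, f s * (φ (W s) - 2⁻¹ * (q.eval (W s) - q.eval (-W s))) ∂μ := by
      have h2 : ∀ s, f s * (φ (W s) - 2⁻¹ * (q.eval (W s) - q.eval (-W s))) =
          f s * φ (W s) - 2⁻¹ * (f s * (q.eval (W s) - q.eval (-W s))) := by intro s; ring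
      simp_rw [h2]
      rw [integral_sub (hintc φ hφ), integral_const_mul, hpoly, mul_zero, sub_zero]
      exact (hintc (fun t => q.eval t - q.eval (-t)) (by fun_prop)).const_mul _
    have h3 : |I| ≤ |I| / (M + 1) * M := by
      conv_lhs => rw [h1]
      rw [hM, ← integral_const_mul]
      refine (norm_integral_le_integral_norm (fun s =>
        f s * (φ (W s) - 2⁻¹ * (q.eval (W s) - q.eval (-W s))))).trans ?_
      refine integral_mono_of_nonneg (Eventually.of_forall fun _ => norm_nonneg _)
        (hf.abs.const_mul _) (Eventually.of_forall fun s => ?_)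
      simp only
      rw [norm_mul, mul_comm, Real.norm_eq_abs (f s)]
      refine mul_le_mul_of_nonneg_right ?_ (abs_nonneg _)
      have e1 := hq (W s) (hW1 s)
      have e2 := hq (-W s) ⟨by linarith [(hW1 s).2], by linarith [(hW1 s).1]⟩
      rw [hφodd] at e2
      rw [abs_lt] at e1 e2
      rw [Real.norm_eq_abs, abs_le]
      constructor <;> linarith [e1.1, e1.2, e2.1, e2.2]
    have h4 : |I| / (M + 1) * M < |I| := by
      rw [div_mul_eq_mul_div, div_lt_iff₀ (by linarith)]
      nlinarith
    linarith
  have hlim : Tendsto (fun m : ℕ => ∫ s, f s * (W s / (|W s| + 1 / ((m : ℝ) + 1))) ∂μ) atTop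
      (𝓝 (∫ s, f s * Real.sign (W s) ∂μ)) := by
    have hcm : ∀ m : ℕ, Continuous fun t : ℝ => t / (|t| + 1 / ((m : ℝ) + 1)) := fun m =>
      continuous_id.div (by fun_prop) fun t => by positivity
    refine tendsto_integral_of_dominated_convergence (fun s => |f s|)
      (fun m => (hintc _ (hcm m)).1) hf.abs (fun m => Eventually.of_forall fun s => ?_)
      (Eventually.of_forall fun s => Tendsto.const_mul _ ?_)
    · rw [norm_mul, Real.norm_eq_abs (f s)]
      refine mul_le_of_le_one_right (abs_nonneg _) ?_
      have h1 : 0 < 1 / ((m : ℝ) + 1) := by positivity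
      have h2 : 0 < |W s| + 1 / ((m : ℝ) + 1) := by positivity
      rw [norm_div, Real.norm_eq_abs, Real.norm_of_nonneg h2.le, div_le_one h2]
      linarith
    · rcases eq_or_ne (W s) 0 with h1 | h1
      · simp [h1]
      · have h2 := (tendsto_one_div_add_atTop_nhds_zero_nat (𝕜 := ℝ)).const_add (|W s|)
        rw [add_zero] at h2
        have h3 := (tendsto_const_nhds (x := W s)).div h2 (abs_ne_zero.2 h1)
        have h4 : W s / |W s| = Real.sign (W s) := by
          rcases lt_or_gt_of_ne h1 with h | h
          · rw [Real.sign_of_neg h, abs_of_neg h, div_neg, div_self h1]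
          · rw [Real.sign_of_pos h, abs_of_pos h, div_self h1]
        rw [h4] at h3
        exact h3
  refine tendsto_nhds_unique hlim (tendsto_const_nhds.congr fun m => ?_)
  refine (hcont (fun t => t / (|t| + 1 / ((m : ℝ) + 1))) ?_ fun t => ?_).symm
  · exact continuous_id.div (by fun_prop) fun t => by positivity
  · rw [abs_neg, neg_div]

end Kernel

/-! ### From symmetric half-space masses to a vanishing regression function -/

section Tails

variable {S : Type*} [MeasurableSpace S] {μ : Measure S}

lemma tendsto_integral_indicator {ι : Type*} {l : Filter ι} [l.IsCountablyGenerated] {f : S → ℝ}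
    (hf : Integrable f μ) {A : ι → Set S} {B : Set S} (hA : ∀ i, MeasurableSet (A i))
    (h : ∀ s, ∀ᶠ i in l, (s ∈ A i ↔ s ∈ B)) :
    Tendsto (fun i => ∫ s, (A i).indicator f s ∂μ) l (𝓝 (∫ s, B.indicator f s ∂μ)) := by
  refine tendsto_integral_filter_of_dominated_convergence (fun s => ‖f s‖)
    (Eventually.of_forall fun i => hf.1.indicator (hA i))
    (Eventually.of_forall fun i => Eventually.of_forall fun s => norm_indicator_le_norm_self _ _)
    hf.norm (Eventually.of_forall fun s => ?_)
  refine tendsto_const_nhds.congr' ?_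
  filter_upwards [h s] with i hi
  by_cases hs : s ∈ B
  · rw [indicator_of_mem hs, indicator_of_mem (hi.2 hs)]
  · rw [indicator_of_notMem hs, indicator_of_notMem fun hc => hs (hi.1 hc)]

/-- A signed measure on the line of total mass zero whose masses above and below almost every point
(with respect to a dominating measure) balance has no mass in any half-line.

Let `G` be the upper tail, suppose that `|G|` exceeds `c > 0` somewhere, and let `a` be the infimum of
the points where it does. One-sided limits and the balance at `a` give `|G a| = c`. The measure charges every
`(a, t]` with `|G t| > c`, so there are points of balance in it; at such a point `v` the value
`2 |G v|` is at most the mass of `{v}`, hence small, whereas `G v` is close to `G a` by right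
continuity. -/
lemma integral_indicator_Ioi_eq_zero {f W : S → ℝ} (hf : Integrable f μ) (hW : Measurable W)
    (hf0 : ∫ s, f s ∂μ = 0)
    (h : ∀ᵐ s' ∂μ, ∫ s, f s * Real.sign (W s - W s') ∂μ = 0) (w : ℝ) :
    ∫ s, (W ⁻¹' Ioi w).indicator f s ∂μ = 0 := by
  classical
  set G : ℝ → ℝ := fun t => ∫ s, (W ⁻¹' Ioi t).indicator f s ∂μ with hG
  set G' : ℝ → ℝ := fun t => ∫ s, (W ⁻¹' Ici t).indicator f s ∂μ with hG'
  have hI : ∀ {B : Set ℝ}, MeasurableSet B → Integrable (fun s => (W ⁻¹' B).indicator f s) μ :=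
    fun hB => hf.indicator (hW hB)
  have hgood : ∀ t, ∫ s, f s * Real.sign (W s - t) ∂μ = G t + G' t := by
    intro t
    have h1 : ∀ s, f s * Real.sign (W s - t) =
        (W ⁻¹' Ioi t).indicator f s + (W ⁻¹' Ici t).indicator f s - f s := by
      intro s
      simp only [indicator_apply, mem_preimage, mem_Ioi, mem_Ici]
      rcases lt_trichotomy (W s) t with h2 | h2 | h2
      · rw [Real.sign_of_neg (by linarith), if_neg (by linarith), if_neg (by linarith)]; ring
      · rw [h2, sub_self, Real.sign_zero, if_neg (lt_irrefl _), if_pos le_rfl]; ring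
      · rw [Real.sign_of_pos (by linarith), if_pos h2, if_pos h2.le]; ring
    simp_rw [h1]
    rw [integral_sub (by exact (hI measurableSet_Ioi).add (hI measurableSet_Ici)) hf, hf0, sub_zero,
      integral_add (hI measurableSet_Ioi) (hI measurableSet_Ici)]
  simp_rw [hgood] at h
  have hex : ∀ B : Set ℝ, μ (W ⁻¹' B) ≠ 0 → ∃ t ∈ B, G t + G' t = 0 := by
    intro B hB
    by_contra hc
    push Not at hc
    refine hB (measure_mono_null ?_ h)
    intro s hs
    exact hc (W s) hs
  have hright : ∀ t, Tendsto G (𝓝[≥] t) (𝓝 (G t)) := by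
    intro t
    refine tendsto_integral_indicator hf (fun i => hW measurableSet_Ioi) fun s => ?_
    simp only [mem_preimage, mem_Ioi]
    by_cases h1 : t < W s
    · filter_upwards [mem_nhdsWithin_of_mem_nhds (Iio_mem_nhds h1)] with i hi
      exact ⟨fun _ => h1, fun _ => hi⟩
    · filter_upwards [self_mem_nhdsWithin] with i hi
      exact ⟨fun h2 => absurd (lt_of_le_of_lt hi h2) h1, fun h2 => absurd h2 h1⟩
  have hleft : ∀ t, Tendsto G (𝓝[<] t) (𝓝 (G' t)) := by
    intro t
    refine tendsto_integral_indicator hf (fun i => hW measurableSet_Ioi) fun s => ?_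
    simp only [mem_preimage, mem_Ioi, mem_Ici]
    by_cases h1 : t ≤ W s
    · filter_upwards [self_mem_nhdsWithin] with i hi
      exact ⟨fun _ => h1, fun _ => lt_of_lt_of_le hi h1⟩
    · filter_upwards [mem_nhdsWithin_of_mem_nhds (Ioi_mem_nhds (not_le.1 h1))] with i hi
      exact ⟨fun h2 => absurd h2 (lt_asymm hi), fun h2 => absurd h2 h1⟩
  have hbot : Tendsto G atBot (𝓝 0) := by
    have := tendsto_integral_indicator (l := atBot) (B := univ) hf
      (A := fun t : ℝ => W ⁻¹' Ioi t) (fun i => hW measurableSet_Ioi) (fun s => by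
        filter_upwards [eventually_lt_atBot (W s)] with i hi
        exact ⟨fun _ => mem_univ _, fun _ => hi⟩)
    simpa [hf0] using this
  by_contra hne
  set c := |G w| / 2 with hc
  have hGw : 0 < |G w| := abs_pos.2 hne
  have hc0 : 0 < c := by positivity
  set A : Set ℝ := {t | c < |G t|} with hA
  have hwA : w ∈ A := by show |G w| / 2 < |G w|; linarith
  have hAbdd : BddBelow A := by
    have h1 := hbot.abs.eventually (Iio_mem_nhds (show |(0 : ℝ)| < c by simpa using hc0))
    obtain ⟨N, hN⟩ := eventually_atBot.1 h1
    refine ⟨N, fun t ht => ?_⟩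
    by_contra hlt
    exact lt_asymm ht (hN t (not_le.1 hlt).le)
  set a := sInf A with ha
  have hAa : ∀ t ∈ A, a ≤ t := fun t ht => csInf_le hAbdd ht
  -- right continuity bounds `|G a|` from below, the left limit and the balance at `a` from above
  have h1 : c ≤ |G a| := by
    have hcl : a ∈ closure A := csInf_mem_closure ⟨w, hwA⟩ hAbdd
    rw [mem_closure_iff_nhdsWithin_neBot] at hcl
    have hle : 𝓝[A] a ≤ 𝓝[≥] a := nhdsWithin_mono _ hAa
    refine ge_of_tendsto (((hright a).mono_left hle).abs) ?_
    filter_upwards [self_mem_nhdsWithin] with t ht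
    exact le_of_lt ht
  have h2 : |G' a| ≤ c := by
    refine le_of_tendsto (hleft a).abs ?_
    filter_upwards [self_mem_nhdsWithin] with t ht
    by_contra hlt
    exact absurd (hAa t (not_le.1 hlt)) (not_le.2 ht)
  have h3 : |G a| = |G' a| := by
    by_cases hz : μ (W ⁻¹' {a}) = 0
    · congr 1
      refine integral_congr_ae ?_
      filter_upwards [measure_eq_zero_iff_ae_notMem.1 hz] with s hs
      have hs' : W s ≠ a := hs
      simp only [indicator_apply, mem_preimage, mem_Ioi, mem_Ici]
      rcases lt_or_gt_of_ne hs' with h4 | h4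
      · rw [if_neg (by linarith), if_neg (by linarith)]
      · rw [if_pos h4, if_pos h4.le]
    · obtain ⟨t, ht, h4⟩ := hex {a} hz
      rw [mem_singleton_iff.1 ht] at h4
      rw [eq_neg_of_add_eq_zero_left h4, abs_neg]
  have h4 : |G a| = c := le_antisymm (h3 ▸ h2) h1
  have hK : Tendsto (fun t => ∫ s, (W ⁻¹' Ioc a t).indicator (fun s => |f s|) s ∂μ) (𝓝[≥] a)
      (𝓝 0) := by
    have := tendsto_integral_indicator (l := 𝓝[≥] a) (B := ∅) hf.abs
      (A := fun t : ℝ => W ⁻¹' Ioc a t) (fun i => hW measurableSet_Ioc) (fun s => by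
        by_cases h5 : a < W s
        · filter_upwards [mem_nhdsWithin_of_mem_nhds (Iio_mem_nhds h5)] with i hi
          exact ⟨fun h6 => absurd h6.2 (not_le.2 hi), fun h6 => absurd h6 (notMem_empty _)⟩
        · exact Eventually.of_forall fun i =>
            ⟨fun h6 => absurd h6.1 h5, fun h6 => absurd h6 (notMem_empty _)⟩)
    simpa using this
  have hev := ((hright a).abs.eventually (Ioi_mem_nhds (show c / 2 < |G a| by linarith))).and
    (hK.eventually (Iio_mem_nhds (show (0 : ℝ) < c / 2 by linarith)))
  rw [eventually_iff, mem_nhdsGE_iff_exists_Ico_subset] at hev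
  obtain ⟨u, hu, hsub⟩ := hev
  -- a point above `a`, near `a`, at which `|G|` exceeds `c`
  obtain ⟨t, htA, htu⟩ := exists_lt_of_csInf_lt ⟨w, hwA⟩ (show sInf A < u from hu)
  have hat : a < t := by
    refine lt_of_le_of_ne (hAa t htA) fun h5 => ?_
    have : c < |G t| := htA
    rw [← h5, h4] at this
    exact lt_irrefl _ this
  have hpos : μ (W ⁻¹' Ioc a t) ≠ 0 := by
    intro hz
    have h5 : G a = G t := by
      refine integral_congr_ae ?_
      filter_upwards [measure_eq_zero_iff_ae_notMem.1 hz] with s hs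
      have hs' : ¬ (a < W s ∧ W s ≤ t) := hs
      simp only [indicator_apply, mem_preimage, mem_Ioi]
      by_cases h6 : a < W s
      · rw [if_pos h6, if_pos (not_le.1 fun h7 => hs' ⟨h6, h7⟩)]
      · rw [if_neg h6, if_neg fun h7 => h6 (hat.trans h7)]
    have : c < |G t| := htA
    rw [← h5, h4] at this
    exact lt_irrefl _ this
  obtain ⟨v, hv, hv0⟩ := hex _ hpos
  have hva := hsub (show v ∈ Ico a u from ⟨hv.1.le, hv.2.trans_lt htu⟩)
  have hta := hsub (show t ∈ Ico a u from ⟨hat.le, htu⟩)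
  simp only [mem_ofPred_eq] at hva hta
  have h5 : G' v - G v = ∫ s, (W ⁻¹' {v}).indicator f s ∂μ := by
    rw [← integral_sub (hI measurableSet_Ici) (hI measurableSet_Ioi)]
    refine integral_congr_ae (Eventually.of_forall fun s => ?_)
    simp only [indicator_apply, mem_preimage, mem_Ioi, mem_Ici, mem_singleton_iff]
    rcases lt_trichotomy (W s) v with h6 | h6 | h6
    · rw [if_neg (by linarith), if_neg (by linarith), if_neg h6.ne, sub_self]
    · rw [if_pos h6.ge, if_neg (by linarith), if_pos h6, sub_zero]
    · rw [if_pos h6.le, if_pos h6, if_neg h6.ne', sub_self]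
  have h6 : |G' v - G v| ≤ ∫ s, (W ⁻¹' Ioc a t).indicator (fun s => |f s|) s ∂μ := by
    rw [h5]
    refine (abs_integral_le_integral_abs).trans ?_
    refine integral_mono_of_nonneg (Eventually.of_forall fun _ => abs_nonneg _)
      (hf.abs.indicator (hW measurableSet_Ioc)) (Eventually.of_forall fun s => ?_)
    simp only [indicator_apply, mem_preimage, mem_singleton_iff]
    split_ifs with h7 h8
    · exact le_rfl
    · exact absurd (h7 ▸ hv) h8
    · simp
    · simp
  have h7 : G' v - G v = -(2 * G v) := by linarith
  rw [h7, abs_neg, abs_mul, abs_two] at h6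
  have h8 : c / 2 < |G v| := hva.1
  have h9 : ∫ s, (W ⁻¹' Ioc a t).indicator (fun s => |f s|) s ∂μ < c / 2 := hta.2
  linarith

/-- A signed measure on a Hilbert space that charges no half-space vanishes. -/
lemma setIntegral_preimage_eq_zero {H : Type*} [NormedAddCommGroup H] [InnerProductSpace ℝ H]
    [SecondCountableTopology H] [MeasurableSpace H] [BorelSpace H] [CompleteSpace H]
    {f : S → ℝ} {X : S → H} (hf : Integrable f μ) (hX : Measurable X)
    (hf0 : ∫ s, f s ∂μ = 0)
    (h : ∀ (γ : H) (w : ℝ), ∫ s, ((fun s => inner ℝ (X s) γ) ⁻¹' Ioi w).indicator f s ∂μ = 0)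
    {A : Set H} (hA : MeasurableSet A) : ∫ s in X ⁻¹' A, f s ∂μ = 0 := by
  set μp := μ.withDensity (fun s => ENNReal.ofReal (f s)) with hμp
  set μm := μ.withDensity (fun s => ENNReal.ofReal (-f s)) with hμm
  have hfp : IsFiniteMeasure μp := isFiniteMeasure_withDensity_ofReal hf.2
  have hfm : IsFiniteMeasure μm := isFiniteMeasure_withDensity_ofReal hf.neg.2
  have key : ∀ B : Set S, MeasurableSet B → (∫ s in B, f s ∂μ = 0 ↔ μp B = μm B) := by
    intro B hB
    rw [integral_eq_lintegral_pos_part_sub_lintegral_neg_part hf.restrict, hμp, hμm,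
      withDensity_apply _ hB, withDensity_apply _ hB, sub_eq_zero]
    have e1 : ∫⁻ s in B, ENNReal.ofReal (f s) ∂μ ≠ ⊤ := by
      have := measure_ne_top μp B; rwa [hμp, withDensity_apply _ hB] at this
    have e2 : ∫⁻ s in B, ENNReal.ofReal (-f s) ∂μ ≠ ⊤ := by
      have := measure_ne_top μm B; rwa [hμm, withDensity_apply _ hB] at this
    exact ENNReal.toReal_eq_toReal_iff' e1 e2
  rw [key _ (hX hA), ← Measure.map_apply hX hA, ← Measure.map_apply hX hA]
  suffices hmap : μp.map X = μm.map X by rw [hmap]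
  refine Measure.ext_of_charFun ?_
  ext γ
  have hγ : Measurable fun s => inner ℝ (X s) γ := hX.inner measurable_const
  have h1d : μp.map (fun s => inner ℝ (X s) γ) = μm.map (fun s => inner ℝ (X s) γ) := by
    refine Measure.ext_of_Iic _ _ fun w => ?_
    rw [Measure.map_apply hγ measurableSet_Iic, Measure.map_apply hγ measurableSet_Iic,
      ← key _ (hγ measurableSet_Iic)]
    have h2 := integral_add_compl (hγ (measurableSet_Ioi (a := w))) hf
    rw [hf0, ← integral_indicator (hγ measurableSet_Ioi), h, zero_add, ← preimage_compl,
      compl_Ioi] at h2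
    exact h2
  have hm : Continuous fun r : ℝ => Complex.exp (r * Complex.I) := by fun_prop
  have hcf : ∀ m : Measure S, charFun (m.map X) γ =
      ∫ r, Complex.exp (r * Complex.I) ∂(m.map fun s => inner ℝ (X s) γ) := by
    intro m
    rw [charFun_apply, integral_map hX.aemeasurable, integral_map hγ.aemeasurable]
    · exact hm.aestronglyMeasurable
    · exact (hm.comp (by fun_prop : Continuous fun x : H => inner ℝ x γ)).aestronglyMeasurable
  rw [hcf, hcf, h1d]

end Tails

/-! ### Positivity of the limit -/

section Positivity

variable {H : Type*} [NormedAddCommGroup H] [InnerProductSpace ℝ H]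

lemma angle_sub_sub_eq (x y z : H) :
    InnerProductGeometry.angle (x - z) (z - y) = Real.pi / 2 + Real.arcsin
      (inner ℝ (‖x - z‖⁻¹ • (x - z)) (‖y - z‖⁻¹ • (y - z))) := by
  rw [← neg_sub y z, InnerProductGeometry.angle_neg_right, InnerProductGeometry.angle,
    Real.arccos, inner_smul_left, inner_smul_right]
  have : inner ℝ (x - z) (y - z) / (‖x - z‖ * ‖y - z‖) =
      (starRingEnd ℝ) ‖x - z‖⁻¹ * (‖y - z‖⁻¹ * inner ℝ (x - z) (y - z)) := by
    rw [conj_trivial, div_eq_mul_inv, mul_inv]; ring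
  rw [this]; ring

variable [SecondCountableTopology H] [MeasurableSpace H] [BorelSpace H]

lemma measurable_angle {T : Type*} [MeasurableSpace T] {u v : T → H} (hu : Measurable u)
    (hv : Measurable v) : Measurable fun t => InnerProductGeometry.angle (u t) (v t) :=
  Real.continuous_arccos.measurable.comp ((hu.inner hv).div (hu.norm.mul hv.norm))

variable [CompleteSpace H] {S : Type*} [MeasurableSpace S] {μ : Measure S} [IsProbabilityMeasure μ]

/-- The mean of `f(s) f(t) Ang(X(s) - X(r), X(r) - X(t))` is positive for `f` with vanishing
integral, unless `f` has conditional mean zero given `X`. -/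
lemma integral_mul_angle_pos {f : S → ℝ} {X : S → H} (hf : Integrable f μ) (hX : Measurable X)
    (hf0 : ∫ s, f s ∂μ = 0) (hne : ∃ A : Set H, MeasurableSet A ∧ ∫ s in X ⁻¹' A, f s ∂μ ≠ 0) :
    0 < ∫ z, f z.2.1 * f z.2.2 *
      InnerProductGeometry.angle (X z.2.1 - X z.1) (X z.1 - X z.2.2) ∂(μ.prod (μ.prod μ)) := by
  have hff : Integrable (fun z : S × S => f z.1 * f z.2) (μ.prod μ) := hf.mul_prod hf
  have hint : Integrable (fun z : S × S × S => f z.2.1 * f z.2.2 *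
      InnerProductGeometry.angle (X z.2.1 - X z.1) (X z.1 - X z.2.2)) (μ.prod (μ.prod μ)) := by
    refine (hff.comp_snd μ).mul_bdd (c := Real.pi) (measurable_angle
      ((hX.comp measurable_snd.fst).sub (hX.comp measurable_fst))
      ((hX.comp measurable_fst).sub (hX.comp measurable_snd.snd))).aestronglyMeasurable
      (Eventually.of_forall fun z => ?_)
    rw [Real.norm_of_nonneg (InnerProductGeometry.angle_nonneg _ _)]
    exact InnerProductGeometry.angle_le_pi _ _
  set U : H → S → H := fun x s => ‖X s - x‖⁻¹ • (X s - x) with hU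
  have hUm : ∀ x, Measurable (U x) := fun x =>
    (hX.sub_const x).norm.inv.smul (hX.sub_const x)
  have hU1 : ∀ x s, ‖U x s‖ ≤ 1 := by
    intro x s
    simp only [hU]
    rw [norm_smul, norm_inv, norm_norm]
    exact inv_mul_le_one
  have hQ : ∀ r, ∫ z, f z.1 * f z.2 *
      InnerProductGeometry.angle (X z.1 - X r) (X r - X z.2) ∂(μ.prod μ) =
      arcsinForm μ (U (X r)) f := by
    intro r
    simp only [angle_sub_sub_eq, mul_add, arcsinForm, hU]
    rw [integral_add (hff.mul_const _), integral_mul_const, integral_prod_mul, hf0, zero_mul,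
      zero_mul, zero_add]
    refine hff.mul_bdd (c := Real.pi / 2) (Real.continuous_arcsin.measurable.comp
      (((hUm (X r)).comp measurable_fst).inner
        ((hUm (X r)).comp measurable_snd))).aestronglyMeasurable
      (Eventually.of_forall fun z => ?_)
    exact abs_le.2 ⟨Real.neg_pi_div_two_le_arcsin _, Real.arcsin_le_pi_div_two _⟩
  rw [integral_prod _ hint]
  have hintQ := hint.integral_prod_left
  simp only [hQ] at hintQ ⊢
  have hnn : ∀ r, 0 ≤ arcsinForm μ (U (X r)) f := fun r => arcsinForm_nonneg (hUm _) (hU1 _) hf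
  refine lt_of_le_of_ne (integral_nonneg hnn) fun h0 => ?_
  have hae := (integral_eq_zero_iff_of_nonneg hnn hintQ).1 h0.symm
  obtain ⟨A, hA, hAne⟩ := hne
  refine hAne (setIntegral_preimage_eq_zero hf hX hf0 (fun γ w => ?_) hA)
  refine integral_indicator_Ioi_eq_zero hf (hX.inner measurable_const) hf0 ?_ w
  filter_upwards [hae] with r hr
  have h1 := integral_mul_sign_inner_eq_zero (hUm (X r)) (hU1 (X r)) hf hr γ
  rw [← h1]
  refine integral_congr_ae (Eventually.of_forall fun s => ?_)
  simp only
  congr 1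
  simp only [hU]
  rw [inner_smul_right, ← inner_sub_left, real_inner_comm]
  rcases eq_or_ne (X s - X r) 0 with h2 | h2
  · simp [h2]
  have h3 : 0 < ‖X s - X r‖⁻¹ := inv_pos.2 (norm_pos_iff.2 h2)
  rcases lt_trichotomy (inner ℝ γ (X s - X r)) 0 with h | h | h
  · rw [Real.sign_of_neg h, Real.sign_of_neg (mul_neg_of_pos_of_neg h3 h)]
  · rw [h, mul_zero]
  · rw [Real.sign_of_pos h, Real.sign_of_pos (mul_pos h3 h)]

end Positivity

/-! ### Empirical averages over ellipsoids -/

/-- Random features `g i (Z 0)` whose linear combinations have second moments comparable to the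
sum of the squared coefficients, and comparable fourth and squared second moments. -/
structure IsFeatureSystem {Ω 𝒵 : Type*} [MeasurableSpace Ω] [MeasurableSpace 𝒵] (P : Measure Ω)
    (Z : ℕ → Ω → 𝒵) (g : ℕ → 𝒵 → ℝ) (K : ℝ) : Prop where
  meas : ∀ i, Measurable (g i)
  int4 : ∀ i, Integrable (fun ω => g i (Z 0 ω) ^ 4) P
  one_le : 1 ≤ K
  upper : ∀ (c : ℕ → ℝ) (N : ℕ), ∫ ω, (∑ i ∈ Finset.range N, c i * g i (Z 0 ω)) ^ 2 ∂P ≤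
    K * ∑ i ∈ Finset.range N, c i ^ 2
  lower : ∀ (c : ℕ → ℝ) (N : ℕ), ∑ i ∈ Finset.range N, c i ^ 2 ≤
    K * ∫ ω, (∑ i ∈ Finset.range N, c i * g i (Z 0 ω)) ^ 2 ∂P
  fourth : ∀ (c : ℕ → ℝ) (N : ℕ), ∫ ω, (∑ i ∈ Finset.range N, c i * g i (Z 0 ω)) ^ 4 ∂P ≤
    K * (∑ i ∈ Finset.range N, c i ^ 2) ^ 2

/-- Weights `w n i ≥ 1`, increasing in `i`, whose inverses have a sum `Λ n = o(n ^ (1 / 2))`. -/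
structure IsWeightSystem (w : ℕ → ℕ → ℝ) : Prop where
  one_le : ∀ n i, 1 ≤ w n i
  mono : ∀ n, Monotone (w n)
  summable : ∀ n, Summable fun i => (w n i)⁻¹
  rate : Tendsto (fun n : ℕ => (∑' i, (w n i)⁻¹) ^ 2 / n) atTop (𝓝 0)

/-- The function `u` is the pointwise sum of the series with coefficients `c` in the features. -/
def Expands {𝒵 : Type*} (g : ℕ → 𝒵 → ℝ) (c : ℕ → ℝ) (u : 𝒵 → ℝ) : Prop :=
  ∀ z, HasSum (fun i => c i * g i z) (u z)

/-- The coefficients `c` lie in the ellipsoid with squared semi-axes `R / w i`. -/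
def InEllipsoid (w : ℕ → ℝ) (c : ℕ → ℝ) (R : ℝ) : Prop :=
  ∀ N, ∑ i ∈ Finset.range N, w i * c i ^ 2 ≤ R

/-- The coefficients `c`, cut off at the index `N`. -/
def cutoff (c : ℕ → ℝ) (N : ℕ) (i : ℕ) : ℝ := if i < N then c i else 0

lemma expands_cutoff {𝒵 : Type*} (g : ℕ → 𝒵 → ℝ) (c : ℕ → ℝ) (N : ℕ) :
    Expands g (cutoff c N) (fun z => ∑ i ∈ Finset.range N, c i * g i z) := by
  intro z
  have h : HasSum (fun i => cutoff c N i * g i z)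
      (∑ i ∈ Finset.range N, cutoff c N i * g i z) :=
    hasSum_sum_of_ne_finset_zero fun i hi => by
      simp only [cutoff]; rw [if_neg fun h => hi (Finset.mem_range.2 h), zero_mul]
  have h2 : ∑ i ∈ Finset.range N, cutoff c N i * g i z = ∑ i ∈ Finset.range N, c i * g i z :=
    Finset.sum_congr rfl fun i hi => by
      simp only [cutoff]; rw [if_pos (Finset.mem_range.1 hi)]
  rwa [h2] at h

lemma cutoff_sq_le (c : ℕ → ℝ) (N i : ℕ) : cutoff c N i ^ 2 ≤ c i ^ 2 := by
  unfold cutoff; split_ifs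
  · exact le_rfl
  · simpa using sq_nonneg (c i)

lemma InEllipsoid.of_sq_le {w c c' : ℕ → ℝ} {R : ℝ} (h : InEllipsoid w c R) (hw : ∀ i, 0 ≤ w i)
    (hc : ∀ i, c' i ^ 2 ≤ c i ^ 2) : InEllipsoid w c' R := fun N =>
  (Finset.sum_le_sum fun i _ => mul_le_mul_of_nonneg_left (hc i) (hw i)).trans (h N)

lemma IsFeatureSystem.integral_pow_four_le {Ω 𝒵 : Type*} [MeasurableSpace Ω]
    [MeasurableSpace 𝒵] {P : Measure Ω} {Z : ℕ → Ω → 𝒵} {g : ℕ → 𝒵 → ℝ} {K : ℝ}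
    (hg : IsFeatureSystem P Z g K) (i : ℕ) :
    ∫ ω, g i (Z 0 ω) ^ 4 ∂P ≤ K := by
  have h := hg.fourth (fun j => if j = i then 1 else 0) (i + 1)
  simpa using h

lemma IsFeatureSystem.memLp_mul {Ω 𝒵 : Type*} [MeasurableSpace Ω]
    [MeasurableSpace 𝒵] {P : Measure Ω} {Z : ℕ → Ω → 𝒵} {g : ℕ → 𝒵 → ℝ} {K : ℝ}
    (hg : IsFeatureSystem P Z g K) (hZ : IsIID P Z) (i j : ℕ) :
    MemLp (fun ω => g i (Z 0 ω) * g j (Z 0 ω)) 2 P ∧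
      ∫ ω, (g i (Z 0 ω) * g j (Z 0 ω)) ^ 2 ∂P ≤ K := by
  have hm : Measurable fun ω => g i (Z 0 ω) * g j (Z 0 ω) :=
    ((hg.meas i).comp (hZ.meas 0)).mul ((hg.meas j).comp (hZ.meas 0))
  have hle : ∀ ω, (g i (Z 0 ω) * g j (Z 0 ω)) ^ 2 ≤
      2⁻¹ * g i (Z 0 ω) ^ 4 + 2⁻¹ * g j (Z 0 ω) ^ 4 := by
    intro ω
    nlinarith [sq_nonneg (g i (Z 0 ω) ^ 2 - g j (Z 0 ω) ^ 2)]
  have hint := ((hg.int4 i).const_mul 2⁻¹).add ((hg.int4 j).const_mul 2⁻¹)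
  constructor
  · rw [memLp_two_iff_integrable_sq hm.aestronglyMeasurable]
    refine Integrable.mono' hint (hm.pow_const 2).aestronglyMeasurable
      (Eventually.of_forall fun ω => ?_)
    rw [Real.norm_of_nonneg (sq_nonneg _)]
    exact hle ω
  · refine (integral_mono_of_nonneg (Eventually.of_forall fun _ => sq_nonneg _) hint
      (Eventually.of_forall hle)).trans ?_
    simp only [Pi.add_apply]
    rw [integral_add ((hg.int4 i).const_mul 2⁻¹) ((hg.int4 j).const_mul 2⁻¹),
      integral_const_mul, integral_const_mul]
    linarith [hg.integral_pow_four_le i, hg.integral_pow_four_le j]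

section

variable {Ω 𝒵 : Type*} [MeasurableSpace Ω] [MeasurableSpace 𝒵] {P : Measure Ω}
  [IsProbabilityMeasure P] {Z : ℕ → Ω → 𝒵} {g : ℕ → 𝒵 → ℝ} {K : ℝ} {w : ℕ → ℕ → ℝ}

lemma IsFeatureSystem.memLp_two (hg : IsFeatureSystem P Z g K) (hZ : IsIID P Z) (i : ℕ) :
    MemLp (fun ω => g i (Z 0 ω)) 2 P := by
  have hm : Measurable fun ω => g i (Z 0 ω) := (hg.meas i).comp (hZ.meas 0)
  rw [memLp_two_iff_integrable_sq hm.aestronglyMeasurable]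
  refine Integrable.mono' ((integrable_const (1 : ℝ)).add (hg.int4 i))
    (hm.pow_const 2).aestronglyMeasurable (Eventually.of_forall fun ω => ?_)
  rw [Real.norm_of_nonneg (sq_nonneg _)]
  simp only [Pi.add_apply]
  nlinarith [sq_nonneg (g i (Z 0 ω) ^ 2 - 1)]

lemma IsFeatureSystem.memLp_sum (hg : IsFeatureSystem P Z g K) (hZ : IsIID P Z) (c : ℕ → ℝ)
    (N : ℕ) : MemLp (fun ω => ∑ i ∈ Finset.range N, c i * g i (Z 0 ω)) 2 P :=
  memLp_finsetSum _ fun i _ => (hg.memLp_two hZ i).const_mul _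

lemma IsWeightSystem.pos (hw : IsWeightSystem w) (n i : ℕ) : 0 < w n i :=
  one_pos.trans_le (hw.one_le n i)

lemma IsWeightSystem.tsum_nonneg (hw : IsWeightSystem w) (n : ℕ) : 0 ≤ ∑' i, (w n i)⁻¹ :=
  _root_.tsum_nonneg fun i => (inv_pos.2 (hw.pos n i)).le

lemma IsWeightSystem.tsum_ofReal (hw : IsWeightSystem w) (n : ℕ) :
    ∑' i, ENNReal.ofReal (w n i)⁻¹ = ENNReal.ofReal (∑' i, (w n i)⁻¹) :=
  (ENNReal.ofReal_tsum_of_nonneg (fun i => (inv_pos.2 (hw.pos n i)).le) (hw.summable n)).symm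

/-- The mean of the squared error of an average, as an extended nonnegative real. -/
lemma lintegral_avg_sub_sq_le (hZ : IsIID P Z) {f : 𝒵 → ℝ} (hf : Measurable f)
    (h : MemLp (fun ω => f (Z 0 ω)) 2 P) {C : ℝ} (hC : ∫ ω, f (Z 0 ω) ^ 2 ∂P ≤ C) {n : ℕ}
    (hn : n ≠ 0) (v : ℝ) :
    ∫⁻ ω, ENNReal.ofReal ((avg n (fun i => f (Z i ω)) - ∫ ω', f (Z 0 ω') ∂P) ^ 2 * v) ∂P ≤
      ENNReal.ofReal (C / n) * ENNReal.ofReal v := by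
  set L : Ω → ℝ := fun ω => avg n (fun i => f (Z i ω)) - ∫ ω', f (Z 0 ω') ∂P with hLdef
  have hL : MemLp L 2 P :=
    ((memLp_finsetSum (Finset.range n) fun i _ => hZ.memLp hf h i).const_mul
      ((n : ℝ)⁻¹)).sub (memLp_const (∫ ω', f (Z 0 ω') ∂P))
  have h1 : ∫ ω, L ω ^ 2 ∂P ≤ C / n :=
    (hZ.integral_avg_sub_sq_le hf h hn).trans (div_le_div_of_nonneg_right hC n.cast_nonneg)
  have h2 : ∀ ω, ENNReal.ofReal (L ω ^ 2 * v) = ENNReal.ofReal (L ω ^ 2) * ENNReal.ofReal v :=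
    fun ω => ENNReal.ofReal_mul (sq_nonneg _)
  change ∫⁻ ω, ENNReal.ofReal (L ω ^ 2 * v) ∂P ≤ _
  simp_rw [h2]
  clear_value L
  rw [lintegral_mul_const' _ _ ENNReal.ofReal_ne_top]
  refine mul_le_mul_left ?_ _
  rw [← ofReal_integral_eq_lintegral_ofReal hL.integrable_sq
    (Eventually.of_forall fun _ => sq_nonneg _)]
  exact ENNReal.ofReal_le_ofReal h1

/-- The empirical second moment of a function in an ellipsoid is uniformly controlled by its
coefficients. By the Cauchy–Schwarz inequality it differs from the population moment by at most `R`
times the square root of the sum `Q` of the squared deviations of the empirical Gram matrix, weighted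
by `1 / (w i * w j)`, and the mean of `Q` is at most `K Λ ^ 2 / n`. -/
lemma IsFeatureSystem.eventually_avg_sq_le (hg : IsFeatureSystem P Z g K) (hZ : IsIID P Z)
    (hw : IsWeightSystem w) {ε : ℝ} (hε : 0 < ε) :
    ∀ᶠ q : ℕ × Ω in probFilter P, ∀ (c : ℕ → ℝ) (u : 𝒵 → ℝ) (R s : ℝ), Expands g c u →
      InEllipsoid (w q.1) c R → (∀ N, ∑ i ∈ Finset.range N, c i ^ 2 ≤ s) →
      avg q.1 (fun i => u (Z i q.2) ^ 2) ≤ K * s + ε * R := by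
  set m : ℕ → ℕ → ℝ := fun i j => ∫ ω, g i (Z 0 ω) * g j (Z 0 ω) ∂P with hm
  set D : ℕ → Ω → ℕ → ℕ → ℝ := fun n ω i j =>
    avg n (fun l => g i (Z l ω) * g j (Z l ω)) - m i j with hD
  set Q : ℕ → Ω → ENNReal := fun n ω =>
    ∑' i, ∑' j, ENNReal.ofReal (D n ω i j ^ 2 * ((w n i)⁻¹ * (w n j)⁻¹)) with hQ
  have hDm : ∀ n i j, Measurable fun ω => D n ω i j := by
    intro n i j
    refine Measurable.sub_const ?_ _
    exact (Finset.measurable_sum _ fun l _ =>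
      ((hg.meas i).comp (hZ.meas l)).mul ((hg.meas j).comp (hZ.meas l))).const_mul _
  have hQm : ∀ n, AEMeasurable (Q n) P := fun n =>
    (Measurable.tsum fun i => Measurable.tsum fun j =>
      (((hDm n i j).pow_const 2).mul_const _).ennreal_ofReal).aemeasurable
  have hev : ∀ᶠ q : ℕ × Ω in probFilter P, Q q.1 q.2 < ENNReal.ofReal (ε ^ 2) := by
    refine eventually_lt_of_lintegral hQm
      (a := fun n => ENNReal.ofReal (K * ((∑' i, (w n i)⁻¹) ^ 2 / n))) ?_ ?_
      (by simpa using hε.ne') ENNReal.ofReal_ne_top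
    · simpa using ENNReal.tendsto_ofReal (hw.rate.const_mul K)
    · filter_upwards [eventually_ne_atTop 0] with n hn
      simp only [hQ]
      rw [lintegral_tsum fun i => (Measurable.tsum fun j =>
        (((hDm n i j).pow_const 2).mul_const _).ennreal_ofReal).aemeasurable]
      simp_rw [fun i => lintegral_tsum (μ := P) fun j =>
        (((hDm n i j).pow_const 2).mul_const ((w n i)⁻¹ * (w n j)⁻¹)).ennreal_ofReal.aemeasurable]
      calc _ ≤ ∑' i, ∑' j, ENNReal.ofReal (K / n) *
            (ENNReal.ofReal (w n i)⁻¹ * ENNReal.ofReal (w n j)⁻¹) := by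
            refine ENNReal.tsum_le_tsum fun i => ENNReal.tsum_le_tsum fun j => ?_
            rw [← ENNReal.ofReal_mul (inv_pos.2 (hw.pos n i)).le]
            exact lintegral_avg_sub_sq_le hZ (f := fun z => g i z * g j z)
              ((hg.meas i).mul (hg.meas j)) (hg.memLp_mul hZ i j).1 (hg.memLp_mul hZ i j).2 hn
              _
        _ = ENNReal.ofReal (K / n) * (ENNReal.ofReal (∑' i, (w n i)⁻¹) *
            ENNReal.ofReal (∑' i, (w n i)⁻¹)) := by
            simp_rw [ENNReal.tsum_mul_left, ENNReal.tsum_mul_right, hw.tsum_ofReal]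
        _ ≤ _ := by
            rw [← ENNReal.ofReal_mul (hw.tsum_nonneg n), ← ENNReal.ofReal_mul
              (by have := hg.one_le; positivity)]
            refine ENNReal.ofReal_le_ofReal (le_of_eq ?_)
            ring
  filter_upwards [hev] with q hq c u R s hu hc hs
  obtain ⟨n, ω⟩ := q
  simp only at hq hc ⊢
  -- the bound for the partial sums of the expansion
  have hfin : ∀ N, avg n (fun l => (∑ i ∈ Finset.range N, c i * g i (Z l ω)) ^ 2) ≤
      K * s + ε * R := by
    intro N
    have hexp : ∀ z, (∑ i ∈ Finset.range N, c i * g i z) ^ 2 =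
        ∑ i ∈ Finset.range N, ∑ j ∈ Finset.range N, c i * c j * (g i z * g j z) := by
      intro z
      rw [sq, Finset.sum_mul_sum]
      exact Finset.sum_congr rfl fun i _ => Finset.sum_congr rfl fun j _ => by ring
    have hE : ∫ ω, (∑ i ∈ Finset.range N, c i * g i (Z 0 ω)) ^ 2 ∂P =
        ∑ i ∈ Finset.range N, ∑ j ∈ Finset.range N, c i * c j * m i j := by
      simp_rw [hexp]
      have hi : ∀ i j, Integrable (fun ω => c i * c j * (g i (Z 0 ω) * g j (Z 0 ω))) P :=
        fun i j => ((hg.memLp_mul hZ i j).1.integrable one_le_two).const_mul _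
      rw [integral_finsetSum _ fun i _ => integrable_finsetSum _ fun j _ => hi i j]
      refine Finset.sum_congr rfl fun i _ => ?_
      rw [integral_finsetSum _ fun j _ => hi i j]
      exact Finset.sum_congr rfl fun j _ => integral_const_mul _ _
    have hA : avg n (fun l => (∑ i ∈ Finset.range N, c i * g i (Z l ω)) ^ 2) =
        ∑ i ∈ Finset.range N, ∑ j ∈ Finset.range N, c i * c j *
          avg n (fun l => g i (Z l ω) * g j (Z l ω)) := by
      simp_rw [hexp, avg, Finset.mul_sum]
      rw [Finset.sum_comm]
      refine Finset.sum_congr rfl fun i _ => ?_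
      rw [Finset.sum_comm]
      exact Finset.sum_congr rfl fun j _ => Finset.sum_congr rfl fun l _ => by ring
    have hdiff : avg n (fun l => (∑ i ∈ Finset.range N, c i * g i (Z l ω)) ^ 2) -
        ∫ ω, (∑ i ∈ Finset.range N, c i * g i (Z 0 ω)) ^ 2 ∂P =
        ∑ p ∈ Finset.range N ×ˢ Finset.range N, c p.1 * c p.2 * D n ω p.1 p.2 := by
      rw [hA, hE, Finset.sum_product, ← Finset.sum_sub_distrib]
      refine Finset.sum_congr rfl fun i _ => ?_
      rw [← Finset.sum_sub_distrib]
      exact Finset.sum_congr rfl fun j _ => by simp only [hD]; ring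
    have hR : 0 ≤ R := by simpa using hc 0
    have hcs : (∑ p ∈ Finset.range N ×ˢ Finset.range N, c p.1 * c p.2 * D n ω p.1 p.2) ^ 2 ≤
        R ^ 2 * ε ^ 2 := by
      have h1 := Finset.sum_mul_sq_le_sq_mul_sq (Finset.range N ×ˢ Finset.range N)
        (fun p => c p.1 * c p.2 * (Real.sqrt (w n p.1) * Real.sqrt (w n p.2)))
        (fun p => D n ω p.1 p.2 * (Real.sqrt (w n p.1) * Real.sqrt (w n p.2))⁻¹)
      have h2 : ∀ p : ℕ × ℕ, c p.1 * c p.2 * (Real.sqrt (w n p.1) * Real.sqrt (w n p.2)) *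
          (D n ω p.1 p.2 * (Real.sqrt (w n p.1) * Real.sqrt (w n p.2))⁻¹) =
          c p.1 * c p.2 * D n ω p.1 p.2 := by
        intro p
        have h3 : Real.sqrt (w n p.1) ≠ 0 := (Real.sqrt_pos.2 (hw.pos n _)).ne'
        have h4 : Real.sqrt (w n p.2) ≠ 0 := (Real.sqrt_pos.2 (hw.pos n _)).ne'
        field_simp
      simp_rw [h2] at h1
      refine h1.trans (mul_le_mul ?_ ?_ (Finset.sum_nonneg fun _ _ => sq_nonneg _)
        (by positivity))
      · have h5 : ∀ p : ℕ × ℕ, (c p.1 * c p.2 *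
            (Real.sqrt (w n p.1) * Real.sqrt (w n p.2))) ^ 2 =
            (w n p.1 * c p.1 ^ 2) * (w n p.2 * c p.2 ^ 2) := by
          intro p
          rw [mul_pow, mul_pow, mul_pow, Real.sq_sqrt (hw.pos n _).le,
            Real.sq_sqrt (hw.pos n _).le]; ring
        simp_rw [h5]
        rw [Finset.sum_product]
        simp only []
        rw [← Finset.sum_mul_sum, ← sq]
        exact pow_le_pow_left₀ (Finset.sum_nonneg fun i _ =>
          mul_nonneg (hw.pos n i).le (sq_nonneg _)) (hc N) 2
      · have h6 : ∀ p : ℕ × ℕ, (D n ω p.1 p.2 *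
            (Real.sqrt (w n p.1) * Real.sqrt (w n p.2))⁻¹) ^ 2 =
            D n ω p.1 p.2 ^ 2 * ((w n p.1)⁻¹ * (w n p.2)⁻¹) := by
          intro p
          rw [mul_pow, inv_pow, mul_pow, Real.sq_sqrt (hw.pos n _).le,
            Real.sq_sqrt (hw.pos n _).le, mul_inv]
        simp_rw [h6]
        have hnn : ∀ p : ℕ × ℕ, 0 ≤ D n ω p.1 p.2 ^ 2 * ((w n p.1)⁻¹ * (w n p.2)⁻¹) := fun p =>
          mul_nonneg (sq_nonneg _) (mul_nonneg (inv_pos.2 (hw.pos n _)).le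
            (inv_pos.2 (hw.pos n _)).le)
        rw [← ENNReal.ofReal_le_ofReal_iff (sq_nonneg ε),
          ENNReal.ofReal_sum_of_nonneg fun p _ => hnn p, Finset.sum_product]
        refine le_trans ?_ hq.le
        exact (Finset.sum_le_sum fun i _ => ENNReal.sum_le_tsum _).trans (ENNReal.sum_le_tsum _)
    have h7 := abs_le_of_sq_le_sq (hcs.trans_eq (mul_pow R ε 2).symm) (mul_nonneg hR hε.le)
    rw [← hdiff, abs_le] at h7
    have h8 := hg.upper c N
    have h9 : K * ∑ i ∈ Finset.range N, c i ^ 2 ≤ K * s :=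
      mul_le_mul_of_nonneg_left (hs N) (by linarith [hg.one_le])
    linarith [h7.2]
  have hlim : Tendsto (fun N => avg n (fun l => (∑ i ∈ Finset.range N, c i * g i (Z l ω)) ^ 2))
      atTop (𝓝 (avg n (fun l => u (Z l ω) ^ 2))) :=
    (tendsto_finsetSum _ fun l _ => ((hu (Z l ω)).tendsto_sum_nat.pow 2)).const_mul _
  exact le_of_tendsto' hlim hfin

end

/-! ### Empirical correlations over ellipsoids -/

lemma Expands.tendsto_avg_mul {𝒵 : Type*} {g : ℕ → 𝒵 → ℝ} {c : ℕ → ℝ} {u : 𝒵 → ℝ}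
    (hu : Expands g c u) (e : 𝒵 → ℝ) (n : ℕ) (z : ℕ → 𝒵) :
    Tendsto (fun N => avg n fun l => e (z l) * ∑ i ∈ Finset.range N, c i * g i (z l)) atTop
      (𝓝 (avg n fun l => e (z l) * u (z l))) :=
  (tendsto_finsetSum _ fun l _ => (hu (z l)).tendsto_sum_nat.const_mul _).const_mul _

lemma InEllipsoid.sum_sq_le {v c : ℕ → ℝ} {R : ℝ} (h : InEllipsoid v c R) (hv : ∀ i, 1 ≤ v i)
    (N : ℕ) : ∑ i ∈ Finset.range N, c i ^ 2 ≤ R :=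
  (Finset.sum_le_sum fun i _ => le_mul_of_one_le_left (sq_nonneg _) (hv i)).trans (h N)

/-- The Cauchy–Schwarz inequality for integrals. -/
lemma integral_mul_sq_le {S : Type*} [MeasurableSpace S] {μ : Measure S} {f g : S → ℝ}
    (hf : MemLp f 2 μ) (hg : MemLp g 2 μ) :
    (∫ s, f s * g s ∂μ) ^ 2 ≤ (∫ s, f s ^ 2 ∂μ) * ∫ s, g s ^ 2 ∂μ := by
  have h : ∀ t : ℝ, 0 ≤ (∫ s, g s ^ 2 ∂μ) * (t * t) + (2 * ∫ s, f s * g s ∂μ) * t +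
      ∫ s, f s ^ 2 ∂μ := by
    intro t
    have hfg : Integrable (fun s => f s * g s) μ := hf.integrable_mul hg
    have e : ∫ s, (f s + t * g s) ^ 2 ∂μ = (∫ s, g s ^ 2 ∂μ) * (t * t) +
        (2 * ∫ s, f s * g s ∂μ) * t + ∫ s, f s ^ 2 ∂μ := by
      have e1 : ∀ s, (f s + t * g s) ^ 2 =
          (t * t) * g s ^ 2 + (2 * t) * (f s * g s) + f s ^ 2 := fun s => by ring
      have i1 : Integrable (fun s => t * t * g s ^ 2) μ := hg.integrable_sq.const_mul _
      have i2 : Integrable (fun s => 2 * t * (f s * g s)) μ := hfg.const_mul _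
      have i3 : Integrable (fun s => t * t * g s ^ 2 + 2 * t * (f s * g s)) μ := i1.add i2
      simp_rw [e1]
      rw [integral_add i3 hf.integrable_sq, integral_add i1 i2, integral_const_mul,
        integral_const_mul]
      ring
    rw [← e]
    exact integral_nonneg fun s => sq_nonneg _
  have := discrim_le_zero h
  rw [discrim] at this
  nlinarith

section

variable {Ω 𝒵 : Type*} [MeasurableSpace Ω] [MeasurableSpace 𝒵] {P : Measure Ω}
  {Z : ℕ → Ω → 𝒵} {g : ℕ → 𝒵 → ℝ} {K : ℝ} {w : ℕ → ℕ → ℝ}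

/-- Bounded functions are dense in mean square, by truncation. -/
lemma exists_bounded_integral_sq_sub_le {e : 𝒵 → ℝ} (he : Measurable e)
    {Z₀ : Ω → 𝒵} (hZ₀ : Measurable Z₀) (h2 : MemLp (fun ω => e (Z₀ ω)) 2 P) {δ : ℝ}
    (hδ : 0 < δ) : ∃ e' : 𝒵 → ℝ, Measurable e' ∧ (∃ R, 0 ≤ R ∧ ∀ z, |e' z| ≤ R) ∧
      MemLp (fun ω => e (Z₀ ω) - e' (Z₀ ω)) 2 P ∧
      ∫ ω, (e (Z₀ ω) - e' (Z₀ ω)) ^ 2 ∂P ≤ δ := by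
  have hA : ∀ R : ℕ, MeasurableSet {ω | (R : ℝ) < |e (Z₀ ω)|} := fun R =>
    measurableSet_lt measurable_const (he.comp hZ₀).abs
  have ht := tendsto_integral_indicator (l := atTop) h2.integrable_sq hA (B := ∅) fun s => by
    filter_upwards [tendsto_natCast_atTop_atTop.eventually_ge_atTop |e (Z₀ s)|] with R hR
    simp [hR]
  simp only [indicator_empty, integral_zero] at ht
  obtain ⟨R, hR⟩ := (ht.eventually_lt_const hδ).exists
  have hm : MeasurableSet {z | |e z| ≤ (R : ℝ)} := measurableSet_le he.abs measurable_const
  have hsub : ∀ ω, e (Z₀ ω) - {z | |e z| ≤ (R : ℝ)}.indicator e (Z₀ ω) =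
      {ω | (R : ℝ) < |e (Z₀ ω)|}.indicator (fun ω => e (Z₀ ω)) ω := by
    intro ω
    by_cases h : |e (Z₀ ω)| ≤ (R : ℝ)
    · simp [indicator, h, not_lt.2 h]
    · simp [indicator, h, not_le.1 h]
  refine ⟨{z | |e z| ≤ (R : ℝ)}.indicator e, he.indicator hm, ⟨R, R.cast_nonneg, fun z => ?_⟩,
    ?_, ?_⟩
  · by_cases h : |e z| ≤ (R : ℝ)
    · simp [indicator, h]
    · simp [indicator, h]
  · simp_rw [hsub]
    exact h2.indicator (hA R)
  · simp_rw [hsub]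
    refine le_trans (le_of_eq (integral_congr_ae (Eventually.of_forall fun ω => ?_))) hR.le
    by_cases h : (R : ℝ) < |e (Z₀ ω)|
    · simp [indicator, h]
    · simp [indicator, h]

lemma IsFeatureSystem.integral_sq_le (hg : IsFeatureSystem P Z g K) (i : ℕ) :
    ∫ ω, g i (Z 0 ω) ^ 2 ∂P ≤ K := by
  have h := hg.upper (fun j => if j = i then 1 else 0) (i + 1)
  simpa using h

variable [IsProbabilityMeasure P]

/-- The empirical correlations of a bounded function with the functions in an ellipsoid converge
uniformly to the population correlations. -/
lemma IsFeatureSystem.eventually_avg_mul_sub_le (hg : IsFeatureSystem P Z g K) (hZ : IsIID P Z)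
    (hw : IsWeightSystem w) {e : 𝒵 → ℝ} (he : Measurable e) {R : ℝ} (hR : 0 ≤ R)
    (heR : ∀ z, |e z| ≤ R) {ε : ℝ} (hε : 0 < ε) :
    ∀ᶠ q : ℕ × Ω in probFilter P, ∀ c : ℕ → ℝ, InEllipsoid (w q.1) c 1 → ∀ N,
      |avg q.1 (fun l => e (Z l q.2) * ∑ i ∈ Finset.range N, c i * g i (Z l q.2)) -
        ∫ ω, e (Z 0 ω) * ∑ i ∈ Finset.range N, c i * g i (Z 0 ω) ∂P| ≤ ε := by
  have hmem : ∀ i, MemLp (fun ω => e (Z 0 ω) * g i (Z 0 ω)) 2 P := by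
    intro i
    refine ((hg.memLp_two hZ i).const_mul R).mono
      ((he.comp (hZ.meas 0)).mul ((hg.meas i).comp (hZ.meas 0))).aestronglyMeasurable
      (Eventually.of_forall fun ω => ?_)
    rw [norm_mul, norm_mul, Real.norm_of_nonneg hR]
    exact mul_le_mul_of_nonneg_right (heR _) (norm_nonneg _)
  have hle : ∀ i, ∫ ω, (e (Z 0 ω) * g i (Z 0 ω)) ^ 2 ∂P ≤ R ^ 2 * K := by
    intro i
    refine (integral_mono (hmem i).integrable_sq ((hg.memLp_two hZ i).integrable_sq.const_mul
      (R ^ 2)) fun ω => ?_).trans ?_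
    · simp only [mul_pow]
      exact mul_le_mul_of_nonneg_right (sq_le_sq.2 ((heR _).trans (le_abs_self R))) (sq_nonneg _)
    · rw [integral_const_mul]
      exact mul_le_mul_of_nonneg_left (hg.integral_sq_le i) (sq_nonneg _)
  set m : ℕ → ℝ := fun i => ∫ ω, e (Z 0 ω) * g i (Z 0 ω) ∂P with hm
  set D : ℕ → Ω → ℕ → ℝ := fun n ω i => avg n (fun l => e (Z l ω) * g i (Z l ω)) - m i with hD
  set Q : ℕ → Ω → ENNReal := fun n ω => ∑' i, ENNReal.ofReal (D n ω i ^ 2 * (w n i)⁻¹) with hQ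
  have hDm : ∀ n i, Measurable fun ω => D n ω i := by
    intro n i
    refine Measurable.sub_const ?_ _
    exact (Finset.measurable_sum _ fun l _ =>
      (he.comp (hZ.meas l)).mul ((hg.meas i).comp (hZ.meas l))).const_mul _
  have hQm : ∀ n, AEMeasurable (Q n) P := fun n => (Measurable.tsum fun i =>
    (((hDm n i).pow_const 2).mul_const _).ennreal_ofReal).aemeasurable
  have hK : 0 ≤ R ^ 2 * K := by have := hg.one_le; positivity
  have hlim : Tendsto (fun n : ℕ => R ^ 2 * K * (1 / (n : ℝ) + (∑' i, (w n i)⁻¹) ^ 2 / n)) atTop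
      (𝓝 0) := by
    simpa using (tendsto_one_div_atTop_nhds_zero_nat.add hw.rate).const_mul (R ^ 2 * K)
  have hev : ∀ᶠ q : ℕ × Ω in probFilter P, Q q.1 q.2 < ENNReal.ofReal (ε ^ 2) := by
    refine eventually_lt_of_lintegral hQm
      (a := fun n => ENNReal.ofReal (R ^ 2 * K * (1 / (n : ℝ) + (∑' i, (w n i)⁻¹) ^ 2 / n)))
      ?_ ?_ (by simpa using hε.ne') ENNReal.ofReal_ne_top
    · simpa using ENNReal.tendsto_ofReal hlim
    · filter_upwards [eventually_ne_atTop 0] with n hn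
      simp only [hQ]
      rw [lintegral_tsum fun i =>
        (((hDm n i).pow_const 2).mul_const _).ennreal_ofReal.aemeasurable]
      calc _ ≤ ∑' i, ENNReal.ofReal (R ^ 2 * K / n) * ENNReal.ofReal (w n i)⁻¹ :=
            ENNReal.tsum_le_tsum fun i =>
              lintegral_avg_sub_sq_le hZ (f := fun z => e z * g i z) (he.mul (hg.meas i))
                (hmem i) (hle i) hn _
        _ = ENNReal.ofReal (R ^ 2 * K / n * ∑' i, (w n i)⁻¹) := by
            rw [ENNReal.tsum_mul_left, hw.tsum_ofReal, ← ENNReal.ofReal_mul (by positivity)]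
        _ ≤ _ := by
            refine ENNReal.ofReal_le_ofReal ?_
            rw [← add_div, mul_div_assoc', div_mul_eq_mul_div]
            have := hw.tsum_nonneg n
            gcongr
            nlinarith [sq_nonneg ((∑' i, (w n i)⁻¹) - 1)]
  filter_upwards [hev] with q hq c hc N
  obtain ⟨n, ω⟩ := q
  simp only at hq hc ⊢
  have hdiff : avg n (fun l => e (Z l ω) * ∑ i ∈ Finset.range N, c i * g i (Z l ω)) -
      ∫ ω, e (Z 0 ω) * ∑ i ∈ Finset.range N, c i * g i (Z 0 ω) ∂P =
      ∑ i ∈ Finset.range N, c i * D n ω i := by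
    have hE : ∫ ω, e (Z 0 ω) * ∑ i ∈ Finset.range N, c i * g i (Z 0 ω) ∂P =
        ∑ i ∈ Finset.range N, c i * m i := by
      simp_rw [Finset.mul_sum, mul_left_comm (e _) (c _)]
      rw [integral_finsetSum _ fun i _ => ((hmem i).integrable one_le_two).const_mul _]
      exact Finset.sum_congr rfl fun i _ => integral_const_mul _ _
    have hA : avg n (fun l => e (Z l ω) * ∑ i ∈ Finset.range N, c i * g i (Z l ω)) =
        ∑ i ∈ Finset.range N, c i * avg n (fun l => e (Z l ω) * g i (Z l ω)) := by
      simp_rw [avg, Finset.mul_sum]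
      rw [Finset.sum_comm]
      exact Finset.sum_congr rfl fun i _ => Finset.sum_congr rfl fun l _ => by ring
    rw [hE, hA, ← Finset.sum_sub_distrib]
    exact Finset.sum_congr rfl fun i _ => by simp only [hD]; ring
  rw [hdiff]
  refine abs_le_of_sq_le_sq ?_ hε.le
  have h1 := Finset.sum_mul_sq_le_sq_mul_sq (Finset.range N)
    (fun i => c i * Real.sqrt (w n i)) (fun i => D n ω i * (Real.sqrt (w n i))⁻¹)
  have h2 : ∀ i, c i * Real.sqrt (w n i) * (D n ω i * (Real.sqrt (w n i))⁻¹) =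
      c i * D n ω i := by
    intro i
    have h3 : Real.sqrt (w n i) ≠ 0 := (Real.sqrt_pos.2 (hw.pos n _)).ne'
    field_simp
  have h3 : ∀ i, (c i * Real.sqrt (w n i)) ^ 2 = w n i * c i ^ 2 := by
    intro i; rw [mul_pow, Real.sq_sqrt (hw.pos n _).le, mul_comm]
  have h4 : ∀ i, (D n ω i * (Real.sqrt (w n i))⁻¹) ^ 2 = D n ω i ^ 2 * (w n i)⁻¹ := by
    intro i; rw [mul_pow, inv_pow, Real.sq_sqrt (hw.pos n _).le]
  have hnn : ∀ i, 0 ≤ D n ω i ^ 2 * (w n i)⁻¹ := fun i =>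
    mul_nonneg (sq_nonneg _) (inv_pos.2 (hw.pos n _)).le
  simp_rw [h2, h3, h4] at h1
  refine h1.trans ?_
  rw [← one_mul (ε ^ 2)]
  refine mul_le_mul (hc N) ?_ (Finset.sum_nonneg fun i _ => hnn i) zero_le_one
  rw [← ENNReal.ofReal_le_ofReal_iff (sq_nonneg ε),
    ENNReal.ofReal_sum_of_nonneg fun i _ => hnn i]
  exact (ENNReal.sum_le_tsum _).trans hq.le

/-- The empirical correlation of a square integrable function orthogonal to all features with the
functions in an ellipsoid tends to zero uniformly. -/
lemma IsFeatureSystem.eventually_abs_avg_mul_le (hg : IsFeatureSystem P Z g K) (hZ : IsIID P Z)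
    (hw : IsWeightSystem w) {e : 𝒵 → ℝ} (he : Measurable e) (h2 : MemLp (fun ω => e (Z 0 ω)) 2 P)
    (h0 : ∀ i, ∫ ω, e (Z 0 ω) * g i (Z 0 ω) ∂P = 0) {ε : ℝ} (hε : 0 < ε) :
    ∀ᶠ q : ℕ × Ω in probFilter P, ∀ (c : ℕ → ℝ) (u : 𝒵 → ℝ), Expands g c u →
      InEllipsoid (w q.1) c 1 → |avg q.1 (fun l => e (Z l q.2) * u (Z l q.2))| ≤ ε := by
  have hK := hg.one_le
  set δ : ℝ := ε ^ 2 / (18 * (K + 1)) with hδ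
  have hδ0 : 0 < δ := by positivity
  have hδ1 : δ * (18 * (K + 1)) = ε ^ 2 := by rw [hδ]; field_simp
  obtain ⟨e', he', ⟨R, hR, heR⟩, hm2, hsq⟩ :=
    exists_bounded_integral_sq_sub_le he (hZ.meas 0) h2 hδ0
  have hlln := hZ.tendsto_avg ((he.sub he').pow_const 2) hm2.integrable_sq
  filter_upwards [hg.eventually_avg_mul_sub_le hZ hw he' hR heR (by positivity : 0 < ε / 3),
    hlln.eventually_lt_const (hsq.trans_lt (by linarith : δ < 2 * δ)),
    hg.eventually_avg_sq_le hZ hw one_pos] with q hq1 hq2 hq3 c u hu hc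
  refine le_of_tendsto' ((hu.tendsto_avg_mul e q.1 fun l => Z l q.2).abs) fun N => ?_
  set S : 𝒵 → ℝ := fun z => ∑ i ∈ Finset.range N, c i * g i z with hS
  have hSm : MemLp (fun ω => S (Z 0 ω)) 2 P := hg.memLp_sum hZ c N
  have hc1 : ∀ M, ∑ i ∈ Finset.range M, c i ^ 2 ≤ 1 := hc.sum_sq_le (hw.one_le _)
  have hS2 : ∫ ω, S (Z 0 ω) ^ 2 ∂P ≤ K := (hg.upper c N).trans (by nlinarith [hc1 N])
  have hcut := hq3 (cutoff c N) S 1 1 (expands_cutoff g c N)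
    (hc.of_sq_le (fun i => (hw.pos _ i).le) (cutoff_sq_le c N))
    fun M => (Finset.sum_le_sum fun i _ => cutoff_sq_le c N i).trans (hc1 M)
  have hE0 : ∫ ω, e (Z 0 ω) * S (Z 0 ω) ∂P = 0 := by
    simp only [hS, Finset.mul_sum, mul_left_comm (e _) (c _)]
    have hi : ∀ i, Integrable (fun ω => c i * (e (Z 0 ω) * g i (Z 0 ω))) P := fun i =>
      (h2.integrable_mul (hg.memLp_two hZ i)).const_mul _
    rw [integral_finsetSum _ fun i _ => hi i]
    exact Finset.sum_eq_zero fun i _ => by rw [integral_const_mul, h0, mul_zero]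
  have hint : Integrable (fun ω => (e (Z 0 ω) - e' (Z 0 ω)) * S (Z 0 ω)) P :=
    hm2.integrable_mul hSm
  have hE1 : ∫ ω, e' (Z 0 ω) * S (Z 0 ω) ∂P =
      -∫ ω, (e (Z 0 ω) - e' (Z 0 ω)) * S (Z 0 ω) ∂P := by
    have hint2 : Integrable (fun ω => e (Z 0 ω) * S (Z 0 ω)) P := h2.integrable_mul hSm
    have h5 : ∀ ω, e' (Z 0 ω) * S (Z 0 ω) =
        e (Z 0 ω) * S (Z 0 ω) - (e (Z 0 ω) - e' (Z 0 ω)) * S (Z 0 ω) := fun ω => by ring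
    simp_rw [h5]
    rw [integral_sub hint2 hint, hE0, zero_sub]
  have hE2 : |∫ ω, (e (Z 0 ω) - e' (Z 0 ω)) * S (Z 0 ω) ∂P| ≤ ε / 3 := by
    refine abs_le_of_sq_le_sq ((integral_mul_sq_le hm2 hSm).trans ((mul_le_mul hsq hS2
      (integral_nonneg fun _ => sq_nonneg _) hδ0.le).trans ?_)) (by positivity)
    nlinarith
  have h3 := hq1 c hc N
  have hsplit : avg q.1 (fun l => e (Z l q.2) * S (Z l q.2)) =
      avg q.1 (fun l => e' (Z l q.2) * S (Z l q.2)) +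
      avg q.1 (fun l => (e (Z l q.2) - e' (Z l q.2)) * S (Z l q.2)) := by
    rw [← avg_add]; exact avg_congr fun i _ => by ring
  have h4 : |avg q.1 (fun l => (e (Z l q.2) - e' (Z l q.2)) * S (Z l q.2))| ≤ ε / 3 := by
    refine abs_le_of_sq_le_sq ((avg_mul_sq_le _ _ _).trans ((mul_le_mul hq2.le hcut
      (avg_nonneg fun _ _ => sq_nonneg _) (by positivity)).trans ?_)) (by positivity)
    nlinarith
  change |avg q.1 (fun l => e (Z l q.2) * S (Z l q.2))| ≤ ε
  rw [hsplit]
  rw [abs_le] at *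
  constructor <;> linarith [h3.1, h3.2, h4.1, h4.2, hE2.1, hE2.2]

end

/-! ### The small ball estimate -/

/-- A lower bound for the truncated absolute value by moments of order two and four. -/
lemma sub_sq_le_min_abs_one {L : ℝ} (hL : 1 ≤ L) (x : ℝ) :
    L⁻¹ * x ^ 2 - L⁻¹ ^ 2 * x ^ 4 ≤ min |x| 1 := by
  have hL0 : 0 ≤ L⁻¹ := by positivity
  have hL1 : L⁻¹ ≤ 1 := inv_le_one_of_one_le₀ hL
  have h : L⁻¹ * x ^ 2 - L⁻¹ ^ 2 * x ^ 4 = L⁻¹ * x ^ 2 - (L⁻¹ * x ^ 2) ^ 2 := by ring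
  refine le_min ?_ ?_
  · rcases le_total |x| 1 with h1 | h1
    · have : x ^ 2 ≤ |x| := by rw [← sq_abs]; nlinarith [abs_nonneg x]
      nlinarith [sq_nonneg x, sq_nonneg (L⁻¹ * x ^ 2)]
    · nlinarith [sq_nonneg (L⁻¹ * x ^ 2 - 1 / 2)]
  · nlinarith [sq_nonneg (L⁻¹ * x ^ 2 - 1 / 2)]

lemma exists_int_abs_le (x : ℝ) :
    ∃ z : ℤ, |(z : ℝ)| ≤ |x| ∧ |x - z| ≤ 1 ∧ |x - z| ≤ |x| := by
  rcases le_total 0 x with h | h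
  · have h1 := Int.floor_le x
    have h2 := (Int.lt_floor_add_one x).le
    have h3 : (0 : ℝ) ≤ ⌊x⌋ := by exact_mod_cast Int.floor_nonneg.2 h
    refine ⟨⌊x⌋, ?_, ?_, ?_⟩
    · rwa [abs_of_nonneg h3, abs_of_nonneg h]
    · rw [abs_of_nonneg (by linarith)]; linarith
    · rw [abs_of_nonneg (by linarith), abs_of_nonneg h]; linarith
  · have h1 := Int.le_ceil x
    have h2 := (Int.ceil_lt_add_one x).le
    have h3 : ((⌈x⌉ : ℤ) : ℝ) ≤ 0 := by exact_mod_cast Int.ceil_le.2 (by simpa using h)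
    refine ⟨⌈x⌉, ?_, ?_, ?_⟩
    · rw [abs_of_nonpos h3, abs_of_nonpos h]; linarith
    · rw [abs_of_nonpos (by linarith)]; linarith
    · rw [abs_of_nonpos (by linarith), abs_of_nonpos h]; linarith

section

variable {Ω 𝒵 : Type*} [MeasurableSpace Ω] [MeasurableSpace 𝒵] {P : Measure Ω}
  [IsProbabilityMeasure P] {Z : ℕ → Ω → 𝒵} {g : ℕ → 𝒵 → ℝ} {K : ℝ} {w : ℕ → ℕ → ℝ}

/-- Hoeffding's inequality for the lower tail of the average of a function with values in
`[0, 1]`. -/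
lemma IsIID.measure_avg_lt_le (hZ : IsIID P Z) {f : 𝒵 → ℝ} (hf : Measurable f)
    (hf0 : ∀ z, 0 ≤ f z) (hf1 : ∀ z, f z ≤ 1) {r : ℝ} (hr : 0 ≤ r)
    (hE : r ≤ ∫ ω, f (Z 0 ω) ∂P) (n : ℕ) :
    P {ω | avg n (fun i => f (Z i ω)) < r / 2} ≤ ENNReal.ofReal (Real.exp (-(n * r ^ 2 / 2))) := by
  have hsub : ∀ i < n, HasSubgaussianMGF
      (fun ω => -f (Z i ω) - ∫ ω', -f (Z i ω') ∂P) ((‖(0 : ℝ) - -1‖₊ / 2) ^ 2) P := by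
    intro i _
    refine hasSubgaussianMGF_of_mem_Icc (hf.comp (hZ.meas i)).neg.aemeasurable
      (Eventually.of_forall fun ω => ⟨?_, ?_⟩)
    · simpa using hf1 (Z i ω)
    · simpa using hf0 (Z i ω)
  have hind : iIndepFun (fun i ω => -f (Z i ω) - ∫ ω', -f (Z i ω') ∂P) P :=
    hZ.indep.comp (fun i z => -f z - ∫ ω', -f (Z i ω') ∂P) fun i => hf.neg.sub_const _
  have h := HasSubgaussianMGF.measure_sum_range_ge_le_of_iIndepFun hind hsub
    (ε := n * r / 2) (by positivity)
  rcases eq_or_ne n 0 with rfl | hn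
  · simpa using prob_le_one
  have hn' : (0 : ℝ) < n := by exact_mod_cast Nat.pos_of_ne_zero hn
  have hexp : -(n * r / 2) ^ 2 / (2 * n * (((‖(0 : ℝ) - -1‖₊ / 2) ^ 2 : NNReal) : ℝ)) =
      -(n * r ^ 2 / 2) := by
    have : (((‖(0 : ℝ) - -1‖₊ / 2) ^ 2 : NNReal) : ℝ) = 1 / 4 := by
      simp; norm_num
    rw [this]; field_simp; ring
  rw [hexp] at h
  rw [← ENNReal.ofReal_toReal (measure_ne_top P _)]
  refine ENNReal.ofReal_le_ofReal (le_trans ?_ h)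
  refine measureReal_mono fun ω hω => ?_
  simp only [mem_ofPred_eq, avg] at hω ⊢
  rw [inv_mul_lt_iff₀ hn'] at hω
  simp only [integral_neg, hZ.integral_eq hf, sub_neg_eq_add, Finset.sum_add_distrib,
    Finset.sum_neg_distrib, Finset.sum_const, Finset.card_range, nsmul_eq_mul]
  nlinarith

/-- A linear combination of features whose coefficients are bounded away from zero is not small in
mean, also after truncation and after restriction to an event of large probability. -/
lemma IsFeatureSystem.le_integral_indicator_min (hg : IsFeatureSystem P Z g K) (hZ : IsIID P Z)
    {A : Set 𝒵} (hA : MeasurableSet A)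
    (hPA : ∫ ω, Aᶜ.indicator (fun _ => (1 : ℝ)) (Z 0 ω) ∂P ≤ 1 / (2048 * K ^ 3))
    {c : ℕ → ℝ} {N : ℕ} (h0 : 1 / 16 ≤ ∑ i ∈ Finset.range N, c i ^ 2)
    (h1 : ∑ i ∈ Finset.range N, c i ^ 2 ≤ 1) :
    1 / (2048 * K ^ 3) ≤ ∫ ω, A.indicator
      (fun z => min |∑ i ∈ Finset.range N, c i * g i z| 1) (Z 0 ω) ∂P := by
  have hK := hg.one_le
  set S : 𝒵 → ℝ := fun z => ∑ i ∈ Finset.range N, c i * g i z with hS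
  have hSm : Measurable S := Finset.measurable_sum _ fun i _ => (hg.meas i).const_mul _
  have hS2 : Integrable (fun ω => S (Z 0 ω) ^ 2) P := (hg.memLp_sum hZ c N).integrable_sq
  have hmin : Measurable fun z => min |S z| 1 := hSm.abs.min measurable_const
  have hbdd : ∀ {f : 𝒵 → ℝ}, Measurable f → (∀ z, |f z| ≤ 1) →
      Integrable (fun ω => f (Z 0 ω)) P := fun hf hb =>
    Integrable.of_bound (hf.comp (hZ.meas 0)).aestronglyMeasurable 1
      (Eventually.of_forall fun ω => hb _)
  have hm01 : ∀ z, 0 ≤ min |S z| 1 := fun z => le_min (abs_nonneg _) zero_le_one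
  have i1 : Integrable (fun ω => A.indicator (fun z => min |S z| 1) (Z 0 ω)) P := by
    refine hbdd (hmin.indicator hA) fun z => ?_
    by_cases h : z ∈ A
    · simp only [indicator, h, if_true]
      rw [abs_of_nonneg (hm01 z)]; exact min_le_right _ _
    · simp [indicator, h]
  have i2 : Integrable (fun ω => Aᶜ.indicator (fun _ => (1 : ℝ)) (Z 0 ω)) P := by
    refine hbdd (measurable_const.indicator hA.compl) fun z => ?_
    by_cases h : z ∈ A <;> simp [indicator, h]
  have hS4 : Integrable (fun ω => S (Z 0 ω) ^ 4) P := by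
    have hi : Integrable (fun ω => (N : ℝ) ^ 3 *
        ∑ i ∈ Finset.range N, c i ^ 4 * g i (Z 0 ω) ^ 4) P :=
      (integrable_finsetSum _ fun i _ => (hg.int4 i).const_mul _).const_mul _
    refine hi.mono' ((hSm.comp (hZ.meas 0)).pow_const 4).aestronglyMeasurable
      (Eventually.of_forall fun ω => ?_)
    rw [Real.norm_of_nonneg (by positivity)]
    have q1 := sq_sum_le_card_mul_sum_sq (s := Finset.range N) (f := fun i => c i * g i (Z 0 ω))
    have q2 := sq_sum_le_card_mul_sum_sq (s := Finset.range N)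
      (f := fun i => (c i * g i (Z 0 ω)) ^ 2)
    rw [Finset.card_range] at q1 q2
    calc S (Z 0 ω) ^ 4 = (S (Z 0 ω) ^ 2) ^ 2 := by ring
      _ ≤ (N * ∑ i ∈ Finset.range N, (c i * g i (Z 0 ω)) ^ 2) ^ 2 :=
          pow_le_pow_left₀ (sq_nonneg _) q1 2
      _ = N ^ 2 * (∑ i ∈ Finset.range N, (c i * g i (Z 0 ω)) ^ 2) ^ 2 := by ring
      _ ≤ N ^ 2 * (N * ∑ i ∈ Finset.range N, ((c i * g i (Z 0 ω)) ^ 2) ^ 2) := by gcongr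
      _ = _ := by
          rw [← mul_assoc, ← pow_succ]
          congr 1
          exact Finset.sum_congr rfl fun i _ => by ring
  -- with `L = 32 K ^ 2`, the moment of order four costs at most half of the one of order two
  have hL : 1 ≤ 32 * K ^ 2 := by nlinarith
  have hpt : ∀ ω, (32 * K ^ 2)⁻¹ * S (Z 0 ω) ^ 2 - (32 * K ^ 2)⁻¹ ^ 2 * S (Z 0 ω) ^ 4 ≤
      A.indicator (fun z => min |S z| 1) (Z 0 ω) + Aᶜ.indicator (fun _ => (1 : ℝ)) (Z 0 ω) := by
    intro ω
    have := sub_sq_le_min_abs_one hL (S (Z 0 ω))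
    by_cases h : Z 0 ω ∈ A
    · simpa [indicator, h] using this
    · have h2 := this.trans (min_le_right _ _)
      simpa [indicator, h] using h2
  have hint := integral_mono ((hS2.const_mul _).sub (hS4.const_mul _)) (i1.add i2) hpt
  simp only [Pi.sub_apply, Pi.add_apply] at hint
  rw [integral_sub (hS2.const_mul _) (hS4.const_mul _), integral_add i1 i2, integral_const_mul,
    integral_const_mul] at hint
  have hlow := hg.lower c N
  have hfour := hg.fourth c N
  have hfour' : ∫ ω, S (Z 0 ω) ^ 4 ∂P ≤ K := hfour.trans (by
    have : (∑ i ∈ Finset.range N, c i ^ 2) ^ 2 ≤ 1 := pow_le_one₀ (by linarith) h1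
    nlinarith)
  have e1 : 1 / (512 * K ^ 3) ≤ (32 * K ^ 2)⁻¹ * ∫ ω, S (Z 0 ω) ^ 2 ∂P := by
    have : 1 / (16 * K) ≤ ∫ ω, S (Z 0 ω) ^ 2 ∂P := by
      rw [div_le_iff₀ (by positivity)]; nlinarith
    calc 1 / (512 * K ^ 3) = (32 * K ^ 2)⁻¹ * (1 / (16 * K)) := by field_simp; norm_num
      _ ≤ _ := by gcongr
  have e2 : (32 * K ^ 2)⁻¹ ^ 2 * ∫ ω, S (Z 0 ω) ^ 4 ∂P ≤ 1 / (1024 * K ^ 3) := by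
    calc _ ≤ (32 * K ^ 2)⁻¹ ^ 2 * K := by gcongr
      _ = _ := by field_simp; norm_num
  -- one half of the remainder is spent on the complement of `A`
  have e3 : 1 / (512 * K ^ 3) - 1 / (1024 * K ^ 3) = 2 * (1 / (2048 * K ^ 3)) := by
    field_simp; norm_num
  linarith

lemma exists_integral_indicator_compl_le {η : 𝒵 → ℝ} (hη : Measurable η) {Z₀ : Ω → 𝒵}
    (hZ₀ : Measurable Z₀) {δ : ℝ} (hδ : 0 < δ) :
    ∃ M : ℝ, 0 < M ∧ ∫ ω, {z | |η z| ≤ M}ᶜ.indicator (fun _ => (1 : ℝ)) (Z₀ ω) ∂P ≤ δ := by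
  have hA : ∀ R : ℕ, MeasurableSet {ω | (R : ℝ) < |η (Z₀ ω)|} := fun R =>
    measurableSet_lt measurable_const (hη.comp hZ₀).abs
  have ht := tendsto_integral_indicator (l := atTop) (integrable_const (μ := P) (1 : ℝ)) hA
    (B := ∅) fun s => by
      filter_upwards [tendsto_natCast_atTop_atTop.eventually_ge_atTop |η (Z₀ s)|] with R hR
      simpa using hR
  simp only [indicator_empty, integral_zero] at ht
  obtain ⟨R, hR, hR0⟩ := ((ht.eventually_lt_const hδ).and (eventually_gt_atTop 0)).exists
  refine ⟨R, by exact_mod_cast hR0, le_trans (le_of_eq ?_) hR.le⟩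
  refine integral_congr_ae (Eventually.of_forall fun ω => ?_)
  simp [indicator]

/-- The finite sequence `z / s`, extended by zero: a point of the grid of mesh `1 / s`. -/
def gridPoint {N : ℕ} (s : ℝ) (z : Fin N → ℤ) (i : ℕ) : ℝ :=
  if h : i < N then z ⟨i, h⟩ / s else 0

/-- Monotone weights exceed `R` from an index proportional to the sum of their inverses on. -/
lemma IsWeightSystem.le_of_mul_tsum_le (hw : IsWeightSystem w) {n i : ℕ} {R : ℝ}
    (hR : R * ∑' j, (w n j)⁻¹ ≤ i) : R ≤ w n i := by
  have h1 : ((i : ℝ) + 1) * (w n i)⁻¹ ≤ ∑' j, (w n j)⁻¹ := by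
    calc ((i : ℝ) + 1) * (w n i)⁻¹ = ∑ j ∈ Finset.range (i + 1), (w n i)⁻¹ := by simp
      _ ≤ ∑ j ∈ Finset.range (i + 1), (w n j)⁻¹ := Finset.sum_le_sum fun j hj =>
          inv_anti₀ (hw.pos n j) (hw.mono n (Finset.mem_range_succ_iff.1 hj))
      _ ≤ _ := (hw.summable n).sum_le_tsum _ fun j _ => (inv_pos.2 (hw.pos n j)).le
  have hp := hw.pos n i
  have h0 : 0 < ∑' j, (w n j)⁻¹ := lt_of_lt_of_le (by positivity) h1
  rw [← div_eq_mul_inv, div_le_iff₀ hp] at h1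
  by_contra! hlt
  nlinarith

lemma tendsto_mul_exp_card_sq_sub {Λ : ℕ → ℝ}
    (hΛ : Tendsto (fun n : ℕ => Λ n ^ 2 / n) atTop (𝓝 0)) {R r : ℝ} (hR : 0 ≤ R) (hr : 0 < r)
    {N : ℕ → ℕ} (hN : ∀ n, (N n : ℝ) ≤ R * Λ n + 2) :
    Tendsto (fun n : ℕ => Real.exp (2 * R * N n ^ 2 - n * r)) atTop (𝓝 0) := by
  rw [Real.tendsto_exp_comp_nhds_zero]
  have h1 : Tendsto (fun n : ℕ => 2 * R * (2 * R ^ 2 * (Λ n ^ 2 / n)) - r) atTop (𝓝 (-r)) := by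
    simpa using ((hΛ.const_mul (2 * R ^ 2)).const_mul (2 * R)).sub_const r
  have h2 : Tendsto (fun n : ℕ => (n : ℝ) * (2 * R * (2 * R ^ 2 * (Λ n ^ 2 / n)) - r)) atTop
      atBot := tendsto_natCast_atTop_atTop.atTop_mul_neg (neg_lt_zero.2 hr) h1
  refine tendsto_atBot_mono' _ ?_ (tendsto_atBot_add_const_right _ (2 * R * 8) h2)
  filter_upwards [eventually_ne_atTop 0] with n hn
  have hn' : (n : ℝ) ≠ 0 := by exact_mod_cast hn
  have h3 : (N n : ℝ) ^ 2 ≤ 2 * R ^ 2 * Λ n ^ 2 + 8 := by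
    have h4 : (N n : ℝ) ^ 2 ≤ (R * Λ n + 2) ^ 2 := pow_le_pow_left₀ (Nat.cast_nonneg _) (hN n) 2
    nlinarith [sq_nonneg (R * Λ n - 2)]
  have h5 : (n : ℝ) * (2 * R * (2 * R ^ 2 * (Λ n ^ 2 / n)) - r) =
      2 * R * (2 * R ^ 2 * Λ n ^ 2) - n * r := by field_simp
  rw [h5]
  nlinarith [mul_le_mul_of_nonneg_left h3 (by positivity : 0 ≤ 2 * R)]

/-- The integer vectors of length `N` with entries of absolute value at most `L`. -/
def intBox (N L : ℕ) : Finset (Fin N → ℤ) := Fintype.piFinset fun _ => Finset.Icc (-L : ℤ) L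

lemma card_intBox_le (N L : ℕ) : ((intBox N L).card : ℝ) ≤ Real.exp (2 * L * N) := by
  have hcard : (intBox N L).card = (2 * L + 1) ^ N := by
    simp only [intBox, Fintype.card_piFinset, Int.card_Icc, Finset.prod_const,
      Finset.card_univ, Fintype.card_fin]
    congr 1
    omega
  rw [hcard, mul_comm _ (N : ℝ), Real.exp_nat_mul]
  push_cast
  exact pow_le_pow_left₀ (by positivity) (Real.add_one_le_exp _) _

/-- Rounding the first `N` coefficients of a point of the unit ellipsoid towards zero to multiples
of `1 / (R N)`, and dropping the other ones, has an error of at most `2 / R` in the sum of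
squares if the weights from the index `N` on are at least `R`. -/
lemma InEllipsoid.exists_gridPoint {v c : ℕ → ℝ} (hc : InEllipsoid v c 1) (hv : ∀ i, 1 ≤ v i)
    {N R : ℕ} (hN : 0 < N) (hR : 32 ≤ R) (hvR : ∀ i, N ≤ i → (R : ℝ) ≤ v i)
    (hlow : ∃ L, 1 / 4 ≤ ∑ i ∈ Finset.range L, c i ^ 2) :
    ∃ z ∈ intBox N (R * N), (∀ i, |c i - gridPoint (R * N) z i| ≤ |c i|) ∧
      (∀ L, ∑ i ∈ Finset.range L, (c i - gridPoint (R * N) z i) ^ 2 ≤ 2 / R) ∧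
      1 / 16 ≤ ∑ i ∈ Finset.range N, gridPoint (R * N) z i ^ 2 ∧
      ∑ i ∈ Finset.range N, gridPoint (R * N) z i ^ 2 ≤ 1 := by
  obtain ⟨N', hN'⟩ := hlow
  have hc1 := hc.sum_sq_le hv
  have hR32 : (32 : ℝ) ≤ R := by exact_mod_cast hR
  have hR0 : (0 : ℝ) < R := by linarith
  have hN0 : (0 : ℝ) < N := by exact_mod_cast hN
  have hN1 : (1 : ℝ) ≤ N := by exact_mod_cast hN
  have hRN : (0 : ℝ) < R * N := mul_pos hR0 hN0
  choose ζ hζ1 hζ2 hζ3 using fun i => exists_int_abs_le (c i * (R * N))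
  set z : Fin (N) → ℤ := fun i => ζ i with hz
  set c' : ℕ → ℝ := gridPoint (R * N) z with hc'
  have hin : ∀ i, i < N → c' i = ζ i / (R * N) := fun i hi => by
    simp only [hc', gridPoint, hi, hz, dif_pos]
  have hout : ∀ i, N ≤ i → c' i = 0 := fun i hi => by
    simp only [hc', gridPoint, not_lt.2 hi, dif_neg, not_false_eq_true]
  have hle : ∀ i, |c' i| ≤ |c i| := by
    intro i
    rcases lt_or_ge i (N) with hi | hi
    · rw [hin i hi, abs_div, abs_of_pos hRN, div_le_iff₀ hRN]
      exact (hζ1 i).trans_eq (by rw [abs_mul, abs_of_pos hRN])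
    · rw [hout i hi, abs_zero]; exact abs_nonneg _
  have hdle : ∀ i, |c i - c' i| ≤ |c i| := by
    intro i
    rcases lt_or_ge i (N) with hi | hi
    · have : c i - c' i = (c i * (R * N) - ζ i) / (R * N) := by rw [hin i hi]; field_simp
      rw [this, abs_div, abs_of_pos hRN, div_le_iff₀ hRN]
      exact (hζ3 i).trans_eq (by rw [abs_mul, abs_of_pos hRN])
    · rw [hout i hi, sub_zero]
  have hdle2 : ∀ i, i < N → |c i - c' i| ≤ 1 / (R * N) := by
    intro i hi
    have : c i - c' i = (c i * (R * N) - ζ i) / (R * N) := by rw [hin i hi]; field_simp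
    rw [this, abs_div, abs_of_pos hRN]
    exact div_le_div_of_nonneg_right (hζ2 i) hRN.le
  -- the sum of squares of the rounding errors
  have hds : ∀ L, ∑ i ∈ Finset.range L, (c i - c' i) ^ 2 ≤ 2 / R := by
    intro L
    have hterm : ∀ i, (c i - c' i) ^ 2 ≤ (v i * c i ^ 2) / R +
        if i < N then (1 / (R * N) : ℝ) ^ 2 else 0 := by
      intro i
      have hwp : 0 ≤ v i * c i ^ 2 := mul_nonneg (zero_le_one.trans (hv i)) (sq_nonneg _)
      split_ifs with hi
      · have := sq_le_sq.2 ((hdle2 i hi).trans (le_abs_self _))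
        have h2 : 0 ≤ (v i * c i ^ 2) / R := by positivity
        linarith
      · have h1 := hvR i (not_lt.1 hi)
        rw [hout i (not_lt.1 hi), sub_zero, add_zero, le_div_iff₀ hR0]
        nlinarith [sq_nonneg (c i)]
    refine (Finset.sum_le_sum fun i _ => hterm i).trans ?_
    rw [Finset.sum_add_distrib, ← Finset.sum_div, ← Finset.sum_filter, Finset.sum_const,
      nsmul_eq_mul]
    have h1 : (∑ i ∈ Finset.range L, v i * c i ^ 2) / R ≤ 1 / R :=
      div_le_div_of_nonneg_right (hc L) hR0.le
    have h2 : (((Finset.range L).filter fun i => i < N).card : ℝ) ≤ N := by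
      have : ((Finset.range L).filter fun i => i < N) ⊆ Finset.range (N) := fun i hi =>
        Finset.mem_range.2 (Finset.mem_filter.1 hi).2
      exact_mod_cast (Finset.card_le_card this).trans_eq (Finset.card_range _)
    have h3 : (N : ℝ) * (1 / (R * N)) ^ 2 ≤ 1 / R := by
      rw [div_pow, one_pow, mul_one_div, div_le_div_iff₀ (by positivity) hR0]
      have : (R : ℝ) * N ≤ R * N * (R * N) := le_mul_of_one_le_right hRN.le (by nlinarith)
      nlinarith
    calc _ ≤ 1 / R + N * (1 / (R * N) : ℝ) ^ 2 := by gcongr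
      _ ≤ 1 / R + 1 / R := by gcongr
      _ = _ := by ring
  have hzG : z ∈ intBox N (R * N) := by
    simp only [intBox, Fintype.mem_piFinset, Finset.mem_Icc]
    intro i
    have h1 : c i ^ 2 ≤ 1 := (Finset.single_le_sum (f := fun i => c i ^ 2)
      (fun _ _ => sq_nonneg _) (Finset.self_mem_range_succ (i : ℕ))).trans (hc1 _)
    have h2 : |c i| ≤ 1 := (sq_le_one_iff_abs_le_one _).1 h1
    have h3 : |(ζ i : ℝ)| ≤ ((R * N : ℕ) : ℝ) := by
      refine (hζ1 i).trans ?_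
      rw [abs_mul, abs_of_pos hRN]; push_cast
      exact mul_le_of_le_one_left hRN.le h2
    rw [← abs_le]
    exact_mod_cast h3
  have hsum1 : ∑ i ∈ Finset.range (N), c' i ^ 2 ≤ 1 :=
    (Finset.sum_le_sum fun i _ => sq_le_sq.2 (hle i)).trans (hc1 _)
  have hsum0 : 1 / 16 ≤ ∑ i ∈ Finset.range (N), c' i ^ 2 := by
    have h1 : ∑ i ∈ Finset.range (max (N) N'), c' i ^ 2 =
        ∑ i ∈ Finset.range (N), c' i ^ 2 := by
      symm
      refine Finset.sum_subset (Finset.range_subset_range.2 (le_max_left _ _)) fun i _ hi => ?_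
      rw [hout i (by simpa using hi)]; norm_num
    have h2 : 1 / 4 ≤ ∑ i ∈ Finset.range (max (N) N'), c i ^ 2 :=
      hN'.trans (Finset.sum_le_sum_of_subset_of_nonneg
        (Finset.range_subset_range.2 (le_max_right _ _)) fun _ _ _ => sq_nonneg _)
    have h3 : ∑ i ∈ Finset.range (max (N) N'), c i ^ 2 ≤
        2 * ∑ i ∈ Finset.range (max (N) N'), c' i ^ 2 +
        2 * ∑ i ∈ Finset.range (max (N) N'), (c i - c' i) ^ 2 := by
      rw [Finset.mul_sum, Finset.mul_sum, ← Finset.sum_add_distrib]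
      exact Finset.sum_le_sum fun i _ => by nlinarith [sq_nonneg (c i - 2 * c' i)]
    have h4 := hds (max (N) N')
    have h5 : 2 / (R : ℝ) ≤ 1 / 16 := by rw [div_le_div_iff₀ hR0 (by norm_num)]; linarith
    linarith
  exact ⟨z, hzG, hdle, hds, hsum0, hsum1⟩

/-- The union bound over a finite family of averages, each controlled by Hoeffding's inequality. -/
lemma IsIID.measure_exists_avg_lt_le (hZ : IsIID P Z) {ι : Type*} (G : Finset ι) {f : ι → 𝒵 → ℝ}
    (hf : ∀ z, Measurable (f z)) (hf0 : ∀ z x, 0 ≤ f z x) (hf1 : ∀ z x, f z x ≤ 1) {r : ℝ}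
    (hr : 0 ≤ r) (n : ℕ) :
    P {ω | ∃ z ∈ G, r ≤ ∫ ω', f z (Z 0 ω') ∂P ∧ avg n (fun l => f z (Z l ω)) < r / 2} ≤
      ENNReal.ofReal (G.card * Real.exp (-(n * r ^ 2 / 2))) := by
  classical
  calc _ ≤ P (⋃ z ∈ G, {ω | r ≤ ∫ ω', f z (Z 0 ω') ∂P ∧ avg n (fun l => f z (Z l ω)) < r / 2}) := by
        refine measure_mono fun ω hω => ?_
        obtain ⟨z, hz, h⟩ := hω
        simp only [mem_iUnion]
        exact ⟨z, hz, h⟩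
    _ ≤ ∑ z ∈ G, P {ω | r ≤ ∫ ω', f z (Z 0 ω') ∂P ∧ avg n (fun l => f z (Z l ω)) < r / 2} :=
        measure_biUnion_finset_le _ _
    _ ≤ ∑ z ∈ G, ENNReal.ofReal (Real.exp (-(n * r ^ 2 / 2))) := by
        refine Finset.sum_le_sum fun z _ => ?_
        by_cases h : r ≤ ∫ ω', f z (Z 0 ω') ∂P
        · exact (measure_mono fun ω hω => hω.2).trans
            (hZ.measure_avg_lt_le (hf z) (hf0 z) (hf1 z) hr h n)
        · simp [h]
    _ = _ := by
        rw [Finset.sum_const, nsmul_eq_mul, ENNReal.ofReal_mul (Nat.cast_nonneg _),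
          ENNReal.ofReal_natCast]

/-- The functions in the unit ellipsoid whose coefficients have a sum of squares bounded away from
zero are uniformly bounded away from zero in empirical mean, after truncation and after restriction
to the event that a given function is bounded. The ellipsoid is covered by balls around the points
of a grid in `N = O(Λ)` coordinates; Hoeffding's inequality at each grid point beats the number
`exp (O (N ^ 2))` of grid points because `Λ ^ 2 = o(n)`. -/
theorem IsFeatureSystem.eventually_le_avg_min (hg : IsFeatureSystem P Z g K) (hZ : IsIID P Z)
    (hw : IsWeightSystem w) {η : 𝒵 → ℝ} (hη : Measurable η) :
    ∃ M > 0, ∃ κ > 0, ∀ᶠ q : ℕ × Ω in probFilter P, ∀ (c : ℕ → ℝ) (u : 𝒵 → ℝ), Expands g c u →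
      InEllipsoid (w q.1) c 1 → (∃ N, 1 / 4 ≤ ∑ i ∈ Finset.range N, c i ^ 2) →
      κ ≤ avg q.1 (fun l => {z | |η z| ≤ M}.indicator (fun z => min |u z| 1) (Z l q.2)) := by
  have hK := hg.one_le
  set r : ℝ := 1 / (2048 * K ^ 3) with hr
  have hr0 : 0 < r := by positivity
  obtain ⟨M, hM0, hM⟩ := exists_integral_indicator_compl_le (P := P) hη (hZ.meas 0) hr0
  set A : Set 𝒵 := {z | |η z| ≤ M} with hAdef
  have hA : MeasurableSet A := measurableSet_le hη.abs measurable_const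
  obtain ⟨R, hR⟩ := exists_nat_ge (max 32 (64 * K / r ^ 2))
  have hR32 : (32 : ℝ) ≤ R := (le_max_left _ _).trans hR
  have hR0 : (0 : ℝ) < R := by linarith
  have hRK : 2 * K / R ≤ r ^ 2 / 32 := by
    have := (le_max_right _ _).trans hR
    rw [div_le_iff₀ (by positivity)] at this
    rw [div_le_iff₀ hR0]; linarith
  set Λ : ℕ → ℝ := fun n => ∑' i, (w n i)⁻¹ with hΛ
  set N : ℕ → ℕ := fun n => ⌈R * Λ n⌉₊ + 1 with hN
  have hN0 : ∀ n, (0 : ℝ) < N n := fun n => by simp only [hN]; positivity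
  have hNle : ∀ n, (N n : ℝ) ≤ R * Λ n + 2 := by
    intro n
    have := Nat.ceil_lt_add_one (mul_nonneg hR0.le (hw.tsum_nonneg n))
    simp only [hN, hΛ, Nat.cast_add, Nat.cast_one]
    linarith
  have hwR : ∀ n i, N n ≤ i → (R : ℝ) ≤ w n i := by
    intro n i hi
    refine hw.le_of_mul_tsum_le ((Nat.le_ceil _).trans ?_)
    exact_mod_cast (Nat.le_succ _).trans hi
  set f : (n : ℕ) → (Fin (N n) → ℤ) → 𝒵 → ℝ := fun n z => A.indicator
    (fun x => min |∑ i ∈ Finset.range (N n), gridPoint (R * N n) z i * g i x| 1) with hf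
  have hfm : ∀ n z, Measurable (f n z) := fun n z =>
    (((Finset.measurable_sum _ fun i _ => (hg.meas i).const_mul _).abs).min
      measurable_const).indicator hA
  have hf0 : ∀ n z x, 0 ≤ f n z x := fun n z x =>
    indicator_nonneg (fun y _ => le_min (abs_nonneg _) zero_le_one) x
  have hf1 : ∀ n z x, f n z x ≤ 1 := fun n z x =>
    indicator_le' (fun y _ => min_le_right _ _) (fun y _ => zero_le_one) x
  have hnet : ∀ᶠ q : ℕ × Ω in probFilter P, ¬ ∃ z ∈ intBox (N q.1) (R * N q.1),
      r ≤ ∫ ω', f q.1 z (Z 0 ω') ∂P ∧ avg q.1 (fun l => f q.1 z (Z l q.2)) < r / 2 := by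
    rw [eventually_probFilter]
    have hlim := ENNReal.tendsto_ofReal (tendsto_mul_exp_card_sq_sub hw.rate
      hR0.le (by positivity : 0 < r ^ 2 / 2) hNle)
    rw [ENNReal.ofReal_zero] at hlim
    refine tendsto_of_tendsto_of_tendsto_of_le_of_le tendsto_const_nhds hlim
      (fun n => zero_le) fun n => ?_
    simp only [not_not]
    refine (hZ.measure_exists_avg_lt_le _ (hfm n) (hf0 n) (hf1 n) hr0.le n).trans
      (ENNReal.ofReal_le_ofReal ?_)
    calc _ ≤ Real.exp (2 * (R * N n : ℕ) * N n) * Real.exp (-(n * r ^ 2 / 2)) := by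
          gcongr; exact card_intBox_le _ _
      _ = _ := by
          rw [← Real.exp_add]
          congr 1
          push_cast
          ring
  refine ⟨M, hM0, r / 4, by positivity, ?_⟩
  filter_upwards [hnet, hg.eventually_avg_sq_le hZ hw (by positivity : 0 < r ^ 2 / 32)] with
    q hq1 hq2 c u hu hc ⟨N', hN'⟩
  obtain ⟨n, ω⟩ := q
  simp only at hq1 hq2 hc ⊢
  obtain ⟨z, hzG, hdle, hds, hsum0, hsum1⟩ := hc.exists_gridPoint (hw.one_le n)
    (N := N n) (Nat.succ_pos _) (by exact_mod_cast hR32) (hwR n) ⟨N', hN'⟩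
  set c' : ℕ → ℝ := gridPoint (R * N n) z with hc'
  have hout : ∀ i, N n ≤ i → c' i = 0 := fun i hi => by
    simp only [hc', gridPoint, not_lt.2 hi, dif_neg, not_false_eq_true]
  have hnet' : r / 2 ≤ avg n (fun l => f n z (Z l ω)) := by
    by_contra! hlt
    exact hq1 ⟨z, hzG, hg.le_integral_indicator_min hZ hA hM hsum0 hsum1, hlt⟩
  set u' : 𝒵 → ℝ := fun x => ∑ i ∈ Finset.range (N n), c' i * g i x with hu'
  have hexp : Expands g (fun i => c i - c' i) (fun x => u x - u' x) := by
    intro x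
    have h1 := expands_cutoff g c' (N n) x
    have h2 : cutoff c' (N n) = c' := by
      funext i
      unfold cutoff
      split_ifs with h
      · rfl
      · exact (hout i (not_lt.1 h)).symm
    rw [h2] at h1
    simpa [sub_mul] using (hu x).sub h1
  have hsq := hq2 _ _ 1 (2 / R) hexp (hc.of_sq_le (fun i => (hw.pos n i).le)
    fun i => sq_le_sq.2 (hdle i)) hds
  have hdiff : avg n (fun l => |u (Z l ω) - u' (Z l ω)|) ≤ r / 4 := by
    refine (abs_le_of_sq_le_sq' ((avg_sq_le n _).trans ?_) (by positivity)).2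
    simp only [sq_abs]
    have : K * (2 / R) = 2 * K / R := by ring
    nlinarith
  have hcomp : avg n (fun l => f n z (Z l ω)) ≤
      avg n (fun l => A.indicator (fun x => min |u x| 1) (Z l ω)) +
      avg n (fun l => |u (Z l ω) - u' (Z l ω)|) := by
    rw [← avg_add]
    refine avg_mono fun l _ => ?_
    by_cases h : Z l ω ∈ A
    · simp only [hf, indicator, h, if_true]
      have h1 : |u' (Z l ω)| ≤ |u (Z l ω)| + |u (Z l ω) - u' (Z l ω)| := by
        rw [abs_sub_comm]
        linarith [abs_sub_abs_le_abs_sub (u' (Z l ω)) (u (Z l ω))]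
      change min |u' (Z l ω)| 1 ≤ _
      rcases le_total |u (Z l ω)| 1 with h2 | h2
      · rw [min_eq_left h2]; exact (min_le_left _ _).trans h1
      · rw [min_eq_right h2]
        exact (min_le_right _ _).trans (by linarith [abs_nonneg (u (Z l ω) - u' (Z l ω))])
    · simp [hf, indicator, h]
  linarith

end

/-! ### The Sobolev space and the roughness penalty -/

/-- Lebesgue measure on `[0,1]`. -/
abbrev unitVolume : Measure ℝ := volume.restrict (Icc (0 : ℝ) 1)

lemma intervalIntegral_eq_integral_unitVolume (f : ℝ → ℝ) :
    ∫ t in (0 : ℝ)..1, f t = ∫ t, f t ∂unitVolume := by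
  rw [intervalIntegral.integral_of_le zero_le_one, integral_Icc_eq_integral_Ioc]

lemma AbsolutelyContinuousOnInterval.congr {f g : ℝ → ℝ} {a b : ℝ}
    (hf : AbsolutelyContinuousOnInterval f a b) (h : EqOn f g (uIcc a b)) :
    AbsolutelyContinuousOnInterval g a b := by
  rw [absolutelyContinuousOnInterval_iff] at hf ⊢
  intro ε hε
  obtain ⟨δ, hδ, H⟩ := hf ε hε
  refine ⟨δ, hδ, fun E hE hlt => lt_of_eq_of_lt ?_ (H E hE hlt)⟩
  refine Finset.sum_congr rfl fun i hi => ?_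
  have := hE.1 i hi
  rw [h this.1, h this.2]

variable {m : ℕ} {β γ δ : ℝ → ℝ}

/-- If a derivative within `[0,1]` of an absolutely continuous function is continuous, the function
is differentiable at every point: it is the integral of its derivative. -/
lemma differentiableWithinAt_of_continuousOn_derivWithin {f : ℝ → ℝ}
    (hf : AbsolutelyContinuousOnInterval f 0 1)
    (hc : ContinuousOn (derivWithin f (Icc 0 1)) (Icc 0 1)) {t : ℝ} (ht : t ∈ Icc (0 : ℝ) 1) :
    DifferentiableWithinAt ℝ f (Icc 0 1) t := by
  set D := derivWithin f (Icc 0 1) with hD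
  have hI : ∀ {s}, s ∈ Icc (0 : ℝ) 1 → f s = f 0 + ∫ r in (0 : ℝ)..s, D r := by
    intro s hs
    have hsub : uIcc 0 s ⊆ uIcc (0 : ℝ) 1 := by
      rw [uIcc_of_le hs.1, uIcc_of_le zero_le_one]; exact Icc_subset_Icc_right hs.2
    have h1 := (hf.mono hsub).integral_deriv_eq_sub
    have h2 : ∫ r in (0 : ℝ)..s, deriv f r = ∫ r in (0 : ℝ)..s, D r := by
      rw [intervalIntegral.integral_of_le hs.1, intervalIntegral.integral_of_le hs.1,
        integral_Ioc_eq_integral_Ioo, integral_Ioc_eq_integral_Ioo]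
      refine setIntegral_congr_fun measurableSet_Ioo fun r hr => ?_
      exact (derivWithin_of_mem_nhds (Icc_mem_nhds hr.1 (hr.2.trans_le hs.2))).symm
    rw [← h2, h1]; ring
  have hint : ∀ s ∈ Icc (0 : ℝ) 1, IntervalIntegrable D volume 0 s := fun s hs =>
    (hc.mono (by rw [uIcc_of_le hs.1]; exact Icc_subset_Icc_right hs.2)).intervalIntegrable
  have hder : HasDerivWithinAt (fun s => f 0 + ∫ r in (0 : ℝ)..s, D r) (D t) (Icc 0 1) t := by
    refine HasDerivWithinAt.const_add _ ?_
    have : Fact (t ∈ Icc (0 : ℝ) 1) := ⟨ht⟩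
    exact intervalIntegral.integral_hasDerivWithinAt_right (hint t ht)
      (hc.stronglyMeasurableAtFilter_nhdsWithin measurableSet_Icc t) (hc t ht)
  exact (hder.congr (fun s hs => hI hs) (hI ht)).differentiableWithinAt

lemma uIcc_zero_one : uIcc (0 : ℝ) 1 = Icc 0 1 := uIcc_of_le zero_le_one

lemma MemSobolev.continuousOn (h : MemSobolev m β) {j : ℕ} (hj : j < m) :
    ContinuousOn (iteratedDerivWithin j β (Icc 0 1)) (Icc 0 1) :=
  uIcc_zero_one ▸ (h.1 j hj).continuousOn

lemma MemSobolev.differentiableWithinAt (h : MemSobolev m β) {j : ℕ} (hj : j + 1 < m) {t : ℝ}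
    (ht : t ∈ Icc (0 : ℝ) 1) :
    DifferentiableWithinAt ℝ (iteratedDerivWithin j β (Icc 0 1)) (Icc 0 1) t := by
  refine differentiableWithinAt_of_continuousOn_derivWithin (h.1 j (by omega)) ?_ ht
  refine (h.continuousOn hj).congr fun s hs => ?_
  rw [iteratedDerivWithin_succ]

lemma MemSobolev.ae_differentiableWithinAt (h : MemSobolev m β) {j : ℕ} (hj : j < m) :
    ∀ᵐ t ∂unitVolume,
      DifferentiableWithinAt ℝ (iteratedDerivWithin j β (Icc 0 1)) (Icc 0 1) t := by
  rw [ae_restrict_iff' measurableSet_Icc]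
  filter_upwards [(h.1 j hj).ae_differentiableAt] with t ht hmem
  exact (ht (uIcc_zero_one ▸ hmem)).differentiableWithinAt

lemma derivWithin_add_mul {f g : ℝ → ℝ} {c t : ℝ}
    (hf : DifferentiableWithinAt ℝ f (Icc 0 1) t) (hg : DifferentiableWithinAt ℝ g (Icc 0 1) t)
        (ht : t ∈ Icc (0 : ℝ) 1) :
    derivWithin (fun s => f s + c * g s) (Icc 0 1) t =
      derivWithin f (Icc 0 1) t + c * derivWithin g (Icc 0 1) t :=
  (hf.hasDerivWithinAt.add (hg.hasDerivWithinAt.const_mul c)).derivWithin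
    (uniqueDiffOn_Icc zero_lt_one t ht)

lemma MemSobolev.iteratedDerivWithin_add_mul (hβ : MemSobolev m β) (hγ : MemSobolev m γ) (c : ℝ)
    {j : ℕ} (hj : j < m) : EqOn (iteratedDerivWithin j (fun t => β t + c * γ t) (Icc 0 1))
      (fun t => iteratedDerivWithin j β (Icc 0 1) t + c * iteratedDerivWithin j γ (Icc 0 1) t)
      (Icc 0 1) := by
  induction j with
  | zero => intro t _; simp [iteratedDerivWithin_zero]
  | succ j ih =>
    intro t ht
    simp only [iteratedDerivWithin_succ]
    rw [derivWithin_congr (ih (by omega)) (ih (by omega) ht)]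
    exact derivWithin_add_mul (hβ.differentiableWithinAt hj ht)
      (hγ.differentiableWithinAt hj ht) ht

lemma MemSobolev.iteratedDerivWithin_top_add_mul (hm : 1 ≤ m) (hβ : MemSobolev m β)
    (hγ : MemSobolev m γ) (c : ℝ) :
    iteratedDerivWithin m (fun t => β t + c * γ t) (Icc 0 1) =ᵐ[unitVolume]
      fun t => iteratedDerivWithin m β (Icc 0 1) t + c * iteratedDerivWithin m γ (Icc 0 1) t := by
  obtain ⟨j, rfl⟩ : ∃ j, m = j + 1 := ⟨m - 1, by omega⟩
  have hj : j < j + 1 := j.lt_succ_self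
  filter_upwards [hβ.ae_differentiableWithinAt hj, hγ.ae_differentiableWithinAt hj,
    ae_restrict_mem measurableSet_Icc] with t h1 h2 ht
  simp only [iteratedDerivWithin_succ]
  rw [derivWithin_congr (hβ.iteratedDerivWithin_add_mul hγ c hj)
    (hβ.iteratedDerivWithin_add_mul hγ c hj ht)]
  exact derivWithin_add_mul h1 h2 ht

lemma MemSobolev.add_mul (hm : 1 ≤ m) (hβ : MemSobolev m β) (hγ : MemSobolev m γ) (c : ℝ) :
    MemSobolev m (fun t => β t + c * γ t) := by
  refine ⟨fun j hj => ?_, ?_⟩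
  · refine AbsolutelyContinuousOnInterval.congr ((hβ.1 j hj).add ((hγ.1 j hj).const_mul c)) ?_
    rw [uIcc_zero_one]
    exact (hβ.iteratedDerivWithin_add_mul hγ c hj).symm
  · exact (hβ.2.add (hγ.2.const_mul c)).ae_eq (hβ.iteratedDerivWithin_top_add_mul hm hγ c).symm

lemma MemSobolev.zero (m : ℕ) : MemSobolev m (fun _ => 0) := by
  have h : ∀ j, iteratedDerivWithin j (fun _ : ℝ => (0 : ℝ)) (Icc 0 1) = fun _ => 0 := by
    intro j; funext t; simp
  refine ⟨fun j _ => ?_, ?_⟩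
  · rw [h]
    exact (LipschitzOnWith.of_dist_le_mul (K := 0) (by simp)).absolutelyContinuousOnInterval
  · rw [h]; exact MemLp.zero

lemma MemSobolev.sum (hm : 1 ≤ m) {φ : ℕ → ℝ → ℝ} (hφ : ∀ i, MemSobolev m (φ i)) (c : ℕ → ℝ)
    (N : ℕ) : MemSobolev m (fun t => ∑ i ∈ Finset.range N, c i * φ i t) := by
  induction N with
  | zero => simpa using MemSobolev.zero m
  | succ N ih =>
    simp_rw [Finset.sum_range_succ]
    exact ih.add_mul hm (hφ N) (c N)

lemma roughness_comm (m : ℕ) (β γ : ℝ → ℝ) : roughness m β γ = roughness m γ β := by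
  simp only [roughness, mul_comm]

lemma roughness_self_nonneg (m : ℕ) (β : ℝ → ℝ) : 0 ≤ roughness m β β :=
  intervalIntegral.integral_nonneg zero_le_one fun _ _ => mul_self_nonneg _

lemma roughness_add_mul_left (hm : 1 ≤ m) (hβ : MemSobolev m β) (hγ : MemSobolev m γ)
    (hδ : MemSobolev m δ) (c : ℝ) :
    roughness m (fun t => β t + c * γ t) δ = roughness m β δ + c * roughness m γ δ := by
  simp only [roughness, intervalIntegral_eq_integral_unitVolume]
  have h1 : Integrable (fun t => iteratedDerivWithin m β (Icc 0 1) t *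
      iteratedDerivWithin m δ (Icc 0 1) t) unitVolume := hβ.2.integrable_mul hδ.2
  have h2 : Integrable (fun t => iteratedDerivWithin m γ (Icc 0 1) t *
      iteratedDerivWithin m δ (Icc 0 1) t) unitVolume := hγ.2.integrable_mul hδ.2
  rw [← integral_const_mul, ← integral_add h1 (h2.const_mul c)]
  refine integral_congr_ae ?_
  filter_upwards [hβ.iteratedDerivWithin_top_add_mul hm hγ c] with t ht
  rw [ht]; ring

lemma roughness_add_mul_self (hm : 1 ≤ m) (hβ : MemSobolev m β) (hγ : MemSobolev m γ) (c : ℝ) :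
    roughness m (fun t => β t + c * γ t) (fun t => β t + c * γ t) =
      roughness m β β + 2 * c * roughness m β γ + c ^ 2 * roughness m γ γ := by
  have h := hβ.add_mul hm hγ c
  rw [roughness_add_mul_left hm hβ hγ h, roughness_comm m β, roughness_comm m γ,
    roughness_add_mul_left hm hβ hγ hβ, roughness_add_mul_left hm hβ hγ hγ,
    roughness_comm m γ β]
  ring

/-- The Cauchy–Schwarz inequality for the roughness form. -/
lemma roughness_sq_le (hβ : MemSobolev m β) (hγ : MemSobolev m γ) :
    roughness m β γ ^ 2 ≤ roughness m β β * roughness m γ γ := by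
  simp only [roughness, intervalIntegral_eq_integral_unitVolume, ← sq]
  exact integral_mul_sq_le hβ.2 hγ.2

lemma MemSobolev.memLp (hm : 1 ≤ m) (hβ : MemSobolev m β) : MemLp β 2 unitVolume := by
  have hc : ContinuousOn β (Icc 0 1) := by simpa using hβ.continuousOn hm
  obtain ⟨C, hC⟩ := isCompact_Icc.exists_bound_of_continuousOn hc
  exact MemLp.of_bound (hc.aestronglyMeasurable measurableSet_Icc) C
    ((ae_restrict_iff' measurableSet_Icc).2 (Eventually.of_forall hC))

/-! ### The weighted covariance form -/

lemma inner_toLp_eq {β : ℝ → ℝ} (hβ : MemLp β 2 unitVolume) (x : L2I) :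
    inner ℝ x (hβ.toLp β) = ∫ t in (0 : ℝ)..1, x t * β t := by
  rw [intervalIntegral_eq_integral_unitVolume, L2.inner_def]
  refine integral_congr_ae ?_
  filter_upwards [hβ.coeFn_toLp] with t ht
  rw [ht]
  simp [mul_comm]

lemma linPred_eq {β : ℝ → ℝ} (hβ : MemLp β 2 unitVolume) (x : L2I) (α : ℝ) :
    linPred x (α, β) = α + inner ℝ x (hβ.toLp β) := by
  rw [inner_toLp_eq]; rfl

section

variable {Ω : Type*} [MeasurableSpace Ω] {P : Measure Ω}
  {X : Ω → L2I} {x : Ω → ℝ → ℝ}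

/-- Integrals against the process are inner products with the `L²`-valued predictor. -/
lemma IsProcessOf.ae_integral_eq (hx : IsProcessOf P X x) (u : L2I) :
    ∀ᵐ ω ∂P, Integrable (fun s => x ω s * u s) unitVolume ∧
      ∫ s, x ω s * u s ∂unitVolume = inner ℝ (X ω) u ∧
      ∫ s, |x ω s * u s| ∂unitVolume ≤ ‖X ω‖ * ‖u‖ := by
  filter_upwards [hx.2] with ω hω
  have h1 : Integrable (fun s => X ω s * u s) unitVolume :=
    (Lp.memLp (X ω)).integrable_mul (Lp.memLp u)
  have he : (fun s => X ω s * u s) =ᵐ[unitVolume] fun s => x ω s * u s := by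
    filter_upwards [hω] with s hs; rw [hs]
  refine ⟨h1.congr he, ?_, ?_⟩
  · rw [L2.inner_def, ← integral_congr_ae he]
    simp [mul_comm]
  · have hn : ∀ f : L2I, ∫ s, |f s| ^ 2 ∂unitVolume = ‖f‖ ^ 2 := by
      intro f
      rw [← real_inner_self_eq_norm_sq, L2.inner_def]
      refine integral_congr_ae (Eventually.of_forall fun s => ?_)
      simp only [sq_abs, real_inner_self_eq_norm_sq, Real.norm_eq_abs]
    have h2 := integral_mul_sq_le (Lp.memLp (X ω)).abs (Lp.memLp u).abs
    have h3 : ∫ s, |x ω s * u s| ∂unitVolume = ∫ s, |X ω s| * |u s| ∂unitVolume := by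
      refine integral_congr_ae ?_
      filter_upwards [hω] with s hs; rw [abs_mul, hs]
    rw [h3]
    simp only [Pi.abs_apply] at h2
    rw [hn, hn, ← mul_pow] at h2
    exact (abs_le_of_sq_le_sq' h2 (by positivity)).2

/-- The form `E{B ⟨X, u⟩ ⟨X, v⟩}` on `L²([0,1])`. -/
def wForm (P : Measure Ω) (B : Ω → ℝ) (X : Ω → L2I) (u v : L2I) : ℝ :=
  ∫ ω, B ω * inner ℝ (X ω) u * inner ℝ (X ω) v ∂P

/-- A weight that is bounded away from zero and infinity, together with a square integrable
process that is centred with respect to it. -/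
structure IsWeightedProcess (P : Measure Ω) (B : Ω → ℝ) (X : Ω → L2I) (x : Ω → ℝ → ℝ)
    (C : ℝ) : Prop where
  memLp : MemLp X 2 P
  weight_meas : AEStronglyMeasurable B P
  pos : 0 < C
  bounds : ∀ᵐ ω ∂P, C⁻¹ ≤ B ω ∧ B ω ≤ C
  process : IsProcessOf P X x
  centred : ∀ t ∈ Icc (0 : ℝ) 1, ∫ ω, B ω * x ω t ∂P = 0
  sq_integrable : ∀ t ∈ Icc (0 : ℝ) 1, MemLp (fun ω => x ω t) 2 P

variable {B : Ω → ℝ} {C : ℝ}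

lemma IsWeightedProcess.ae_abs_le (h : IsWeightedProcess P B X x C) : ∀ᵐ ω ∂P, ‖B ω‖ ≤ C := by
  filter_upwards [h.bounds] with ω hω
  rw [Real.norm_of_nonneg ((inv_pos.2 h.pos).le.trans hω.1)]; exact hω.2

lemma IsWeightedProcess.memLp_inner (h : IsWeightedProcess P B X x C) (u : L2I) :
    MemLp (fun ω => inner ℝ (X ω) u) 2 P := h.memLp.inner_const u

lemma IsWeightedProcess.integrable_mul (h : IsWeightedProcess P B X x C) {f g : Ω → ℝ}
    (hf : MemLp f 2 P) (hg : MemLp g 2 P) : Integrable (fun ω => B ω * f ω * g ω) P := by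
  simp_rw [mul_assoc]
  exact (hf.integrable_mul hg).bdd_mul (c := C) h.weight_meas h.ae_abs_le

lemma IsWeightedProcess.wForm_add_mul_left (h : IsWeightedProcess P B X x C) (u v z : L2I)
    (c : ℝ) : wForm P B X (u + c • v) z = wForm P B X u z + c * wForm P B X v z := by
  simp only [wForm]
  rw [← integral_const_mul, ← integral_add (h.integrable_mul (h.memLp_inner u) (h.memLp_inner z))
    ((h.integrable_mul (h.memLp_inner v) (h.memLp_inner z)).const_mul c)]
  refine integral_congr_ae (Eventually.of_forall fun ω => ?_)
  simp only [inner_add_right, real_inner_smul_right]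
  ring

lemma wForm_comm (u v : L2I) : wForm P B X u v = wForm P B X v u := by
  simp only [wForm, mul_right_comm]

variable [IsProbabilityMeasure P]

/-- Fubini's theorem for the process and a random weight. -/
lemma IsProcessOf.integral_integral_mul (hx : IsProcessOf P X x) {W : Ω → ℝ}
    (hW : AEStronglyMeasurable W P)
    (hWX : Integrable (fun ω => W ω * ‖X ω‖) P) (u : L2I) :
    ∫ s, (∫ ω, W ω * x ω s ∂P) * u s ∂unitVolume = ∫ ω, W ω * inner ℝ (X ω) u ∂P := by
  have hum : AEStronglyMeasurable (fun q : Ω × ℝ => u q.2) (P.prod unitVolume) :=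
    (Lp.aestronglyMeasurable u).comp_snd
  have hxm : AEStronglyMeasurable (fun q : Ω × ℝ => x q.1 q.2 * u q.2) (P.prod unitVolume) :=
    (hx.1.aestronglyMeasurable).mul hum
  have hF : AEStronglyMeasurable (fun q : Ω × ℝ => W q.1 * (x q.1 q.2 * u q.2))
      (P.prod unitVolume) := hW.comp_fst.mul hxm
  have hint : Integrable (fun q : Ω × ℝ => W q.1 * (x q.1 q.2 * u q.2)) (P.prod unitVolume) := by
    rw [integrable_prod_iff hF]
    refine ⟨?_, ?_⟩
    · filter_upwards [hx.ae_integral_eq u] with ω hω using hω.1.const_mul _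
    · refine (hWX.norm.mul_const ‖u‖).mono' hF.norm.integral_prod_right' ?_
      filter_upwards [hx.ae_integral_eq u] with ω hω
      rw [Real.norm_of_nonneg (integral_nonneg fun _ => norm_nonneg _)]
      simp only [norm_mul, Real.norm_eq_abs, abs_norm] at hω ⊢
      rw [integral_const_mul]
      simp only [abs_mul] at hω
      rw [mul_assoc]
      exact mul_le_mul_of_nonneg_left hω.2.2 (abs_nonneg _)
  calc _ = ∫ s, ∫ ω, W ω * (x ω s * u s) ∂P ∂unitVolume := by
        refine integral_congr_ae (Eventually.of_forall fun s => ?_)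
        simp only [← mul_assoc]
        rw [integral_mul_const]
    _ = ∫ ω, ∫ s, W ω * (x ω s * u s) ∂unitVolume ∂P :=
        (integral_integral_swap (f := fun ω s => W ω * (x ω s * u s)) hint).symm
    _ = _ := by
        refine integral_congr_ae ?_
        filter_upwards [hx.ae_integral_eq u] with ω hω
        rw [integral_const_mul, hω.2.1]

lemma IsWeightedProcess.integral_weight_mul_inner (h : IsWeightedProcess P B X x C) (u : L2I) :
    ∫ ω, B ω * inner ℝ (X ω) u ∂P = 0 := by
  have hWX : Integrable (fun ω => B ω * ‖X ω‖) P :=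
    (h.memLp.norm.integrable one_le_two).bdd_mul (c := C) h.weight_meas h.ae_abs_le
  rw [← h.process.integral_integral_mul h.weight_meas hWX u]
  refine integral_eq_zero_of_ae ?_
  filter_upwards [ae_restrict_mem measurableSet_Icc] with t ht
  rw [h.centred t ht]; simp

/-- The integral operator with kernel `E{B X(t) X(s)}`. -/
lemma IsWeightedProcess.integral_covFun_mul (h : IsWeightedProcess P B X x C) (u : L2I) {t : ℝ}
    (ht : t ∈ Icc (0 : ℝ) 1) : ∫ s, covFun P B x s t * u s ∂unitVolume =
      ∫ ω, B ω * x ω t * inner ℝ (X ω) u ∂P := by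
  refine h.process.integral_integral_mul (W := fun ω => B ω * x ω t)
    (h.weight_meas.mul (h.sq_integrable t ht).1) ?_ u
  exact h.integrable_mul (h.sq_integrable t ht) h.memLp.norm

/-- The double integral form of the covariance kernel is the form `E{B ⟨X, u⟩ ⟨X, v⟩}`. -/
lemma IsWeightedProcess.formV_eq (h : IsWeightedProcess P B X x C) {β γ : ℝ → ℝ}
    (hβ : MemLp β 2 unitVolume) (hγ : MemLp γ 2 unitVolume) :
    formV (covFun P B x) β γ = wForm P B X (hβ.toLp β) (hγ.toLp γ) := by
  have h1 : ∀ t ∈ Icc (0 : ℝ) 1, ∫ s in (0 : ℝ)..1, covFun P B x s t * β t * γ s =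
      (∫ ω, (B ω * inner ℝ (X ω) (hγ.toLp γ)) * x ω t ∂P) * β t := by
    intro t ht
    have e1 : ∫ s, covFun P B x s t * γ s ∂unitVolume =
        ∫ s, covFun P B x s t * (hγ.toLp γ) s ∂unitVolume := by
      refine integral_congr_ae ?_
      filter_upwards [hγ.coeFn_toLp] with s hs
      rw [hs]
    rw [intervalIntegral_eq_integral_unitVolume]
    simp_rw [mul_right_comm _ (β t)]
    rw [integral_mul_const, e1, h.integral_covFun_mul _ ht]
    simp_rw [mul_right_comm _ _ (x _ t)]
  rw [formV, intervalIntegral_eq_integral_unitVolume]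
  calc _ = ∫ t, (∫ ω, (B ω * inner ℝ (X ω) (hγ.toLp γ)) * x ω t ∂P) * (hβ.toLp β) t
        ∂unitVolume := by
        refine integral_congr_ae ?_
        filter_upwards [hβ.coeFn_toLp, ae_restrict_mem measurableSet_Icc] with t ht htm
        rw [h1 t htm, ht]
    _ = ∫ ω, (B ω * inner ℝ (X ω) (hγ.toLp γ)) * inner ℝ (X ω) (hβ.toLp β) ∂P := by
        refine h.process.integral_integral_mul
          (h.weight_meas.mul (h.memLp_inner _).1) ?_ _
        exact h.integrable_mul (h.memLp_inner _) h.memLp.norm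
    _ = _ := wForm_comm _ _

/-- The second moment of `α + ⟨X, u⟩` is comparable to `α ^ 2 + V(u, u)`: under the weight the
constant and the centred part are orthogonal. -/
lemma IsWeightedProcess.integral_sq_bounds (h : IsWeightedProcess P B X x C) (α : ℝ) (u : L2I) :
    ∫ ω, (α + inner ℝ (X ω) u) ^ 2 ∂P ≤ (C + C ^ 2) * (α ^ 2 + wForm P B X u u) ∧
    α ^ 2 + wForm P B X u u ≤ (C + C ^ 2) * ∫ ω, (α + inner ℝ (X ω) u) ^ 2 ∂P := by
  have hC := h.pos
  have hη : MemLp (fun ω => α + inner ℝ (X ω) u) 2 P := (memLp_const α).add (h.memLp_inner u)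
  have hB : Integrable B P := by
    have := h.integrable_mul (memLp_const (1 : ℝ)) (memLp_const (1 : ℝ))
    simpa using this
  have hBX : Integrable (fun ω => B ω * inner ℝ (X ω) u) P := by
    have := h.integrable_mul (h.memLp_inner u) (memLp_const (1 : ℝ))
    simpa using this
  have hBXX : Integrable (fun ω => B ω * inner ℝ (X ω) u * inner ℝ (X ω) u) P :=
    h.integrable_mul (h.memLp_inner u) (h.memLp_inner u)
  have hBη : Integrable (fun ω => B ω * (α + inner ℝ (X ω) u) ^ 2) P := by
    have := h.integrable_mul hη hη
    simpa only [mul_assoc, ← sq] using this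
  have hEB : C⁻¹ ≤ ∫ ω, B ω ∂P ∧ ∫ ω, B ω ∂P ≤ C := by
    constructor
    · have := integral_mono_ae (integrable_const C⁻¹) hB (h.bounds.mono fun ω hω => hω.1)
      simpa using this
    · have := integral_mono_ae hB (integrable_const C) (h.bounds.mono fun ω hω => hω.2)
      simpa using this
  have hsplit : ∫ ω, B ω * (α + inner ℝ (X ω) u) ^ 2 ∂P =
      α ^ 2 * ∫ ω, B ω ∂P + wForm P B X u u := by
    have e : ∀ ω, B ω * (α + inner ℝ (X ω) u) ^ 2 = α ^ 2 * B ω +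
        (2 * α) * (B ω * inner ℝ (X ω) u) + B ω * inner ℝ (X ω) u * inner ℝ (X ω) u :=
      fun ω => by ring
    have i1 : Integrable (fun ω => α ^ 2 * B ω + (2 * α) * (B ω * inner ℝ (X ω) u)) P :=
      (hB.const_mul _).add (hBX.const_mul _)
    simp_rw [e]
    rw [integral_add i1 hBXX, integral_add (hB.const_mul _) (hBX.const_mul _),
      integral_const_mul, integral_const_mul, h.integral_weight_mul_inner, mul_zero, add_zero]
    rfl
  have hlow : C⁻¹ * ∫ ω, (α + inner ℝ (X ω) u) ^ 2 ∂P ≤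
      ∫ ω, B ω * (α + inner ℝ (X ω) u) ^ 2 ∂P := by
    rw [← integral_const_mul]
    refine integral_mono_ae (hη.integrable_sq.const_mul _) hBη (h.bounds.mono fun ω hω => ?_)
    exact mul_le_mul_of_nonneg_right hω.1 (sq_nonneg _)
  have hup : ∫ ω, B ω * (α + inner ℝ (X ω) u) ^ 2 ∂P ≤
      C * ∫ ω, (α + inner ℝ (X ω) u) ^ 2 ∂P := by
    rw [← integral_const_mul]
    refine integral_mono_ae hBη (hη.integrable_sq.const_mul _) (h.bounds.mono fun ω hω => ?_)
    exact mul_le_mul_of_nonneg_right hω.2 (sq_nonneg _)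
  have hV : 0 ≤ wForm P B X u u := by
    refine integral_nonneg_of_ae (h.bounds.mono fun ω hω => ?_)
    have : 0 ≤ B ω := (inv_pos.2 hC).le.trans hω.1
    simp only [Pi.zero_apply]
    rw [mul_assoc]
    exact mul_nonneg this (mul_self_nonneg _)
  have hE : 0 ≤ ∫ ω, (α + inner ℝ (X ω) u) ^ 2 ∂P := integral_nonneg fun _ => sq_nonneg _
  rw [hsplit] at hlow hup
  have hCC : C * C⁻¹ = 1 := mul_inv_cancel₀ hC.ne'
  set E := ∫ ω, (α + inner ℝ (X ω) u) ^ 2 ∂P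
  set V := wForm P B X u u
  set b := ∫ ω, B ω ∂P
  have hα := sq_nonneg α
  constructor
  · have h1 : E ≤ C * (α ^ 2 * b + V) := by
      calc E = C * (C⁻¹ * E) := by rw [← mul_assoc, hCC, one_mul]
        _ ≤ _ := mul_le_mul_of_nonneg_left hlow hC.le
    have h2 : C * (α ^ 2 * b) ≤ C * (α ^ 2 * C) := by gcongr; exact hEB.2
    nlinarith [mul_nonneg hC.le hα, mul_nonneg (mul_nonneg hC.le hC.le) hV]
  · have h1 : α ^ 2 ≤ C * (α ^ 2 * b) := by
      calc α ^ 2 = C * (α ^ 2 * C⁻¹) := by rw [mul_left_comm, hCC, mul_one]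
        _ ≤ _ := by gcongr; exact hEB.1
    have h2 : α ^ 2 * b ≤ C * E := by linarith
    have h3 : V ≤ C * E := by
      have : 0 ≤ α ^ 2 * b := mul_nonneg hα ((inv_pos.2 hC).le.trans hEB.1)
      linarith
    -- `α ^ 2 ≤ C (α ^ 2 b)` and `α ^ 2 b + V ≤ C E`
    have h4 : C * (α ^ 2 * b) ≤ C * (C * E) - C * V := by nlinarith
    have h5 : V - C * V ≤ C * E := by nlinarith [mul_nonneg hC.le hV]
    nlinarith

end

/-! ### The simultaneous diagonalization -/

open Classical in
/-- The class in `L²([0,1])` of a square integrable function (and `0` for any other function). -/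
def curve (β : ℝ → ℝ) : L2I := if h : MemLp β 2 unitVolume then h.toLp β else 0

lemma curve_eq {β : ℝ → ℝ} (hβ : MemLp β 2 unitVolume) : curve β = hβ.toLp β := dif_pos hβ

lemma curve_add_mul {β γ : ℝ → ℝ} (hβ : MemLp β 2 unitVolume) (hγ : MemLp γ 2 unitVolume)
    (c : ℝ) : curve (fun t => β t + c * γ t) = curve β + c • curve γ := by
  have h : MemLp (fun t => β t + c * γ t) 2 unitVolume := hβ.add (hγ.const_mul c)
  rw [curve_eq h, curve_eq hβ, curve_eq hγ, ← MemLp.toLp_const_smul c hγ, ← MemLp.toLp_add]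
  rfl

lemma linPred_curve {β : ℝ → ℝ} (hβ : MemLp β 2 unitVolume) (x : L2I) (α : ℝ) :
    linPred x (α, β) = α + inner ℝ x (curve β) := by
  rw [curve_eq hβ, linPred_eq]

lemma curve_sum {m : ℕ} (hm : 1 ≤ m) {φ : ℕ → ℝ → ℝ} (hφ : ∀ i, MemSobolev m (φ i)) (c : ℕ → ℝ)
    (N : ℕ) : curve (fun t => ∑ i ∈ Finset.range N, c i * φ i t) =
      ∑ i ∈ Finset.range N, c i • curve (φ i) := by
  induction N with
  | zero =>
    have h : MemLp (fun _ : ℝ => (0 : ℝ)) 2 unitVolume := MemLp.zero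
    simp only [Finset.range_zero, Finset.sum_empty]
    rw [curve_eq h]
    exact MemLp.toLp_zero h
  | succ N ih =>
    simp_rw [Finset.sum_range_succ]
    rw [curve_add_mul ((MemSobolev.sum hm hφ c N).memLp hm) ((hφ N).memLp hm), ih]

lemma roughness_sum_left {m : ℕ} (hm : 1 ≤ m) {φ : ℕ → ℝ → ℝ} (hφ : ∀ i, MemSobolev m (φ i))
    (c : ℕ → ℝ) {δ : ℝ → ℝ} (hδ : MemSobolev m δ) (N : ℕ) :
    roughness m (fun t => ∑ i ∈ Finset.range N, c i * φ i t) δ =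
      ∑ i ∈ Finset.range N, c i * roughness m (φ i) δ := by
  induction N with
  | zero =>
    have h := roughness_add_mul_left hm (MemSobolev.zero m) hδ hδ 0
    have h0 := roughness_add_mul_left hm (MemSobolev.zero m) (MemSobolev.zero m) hδ (-1)
    simp only [Finset.range_zero, Finset.sum_empty]
    simp only [mul_zero, add_zero] at h0
    have h1 := roughness_add_mul_left hm (MemSobolev.zero m) (MemSobolev.zero m) hδ 1
    simp only [mul_zero, add_zero, one_mul] at h1
    linarith
  | succ N ih =>
    simp_rw [Finset.sum_range_succ]
    rw [roughness_add_mul_left hm (MemSobolev.sum hm hφ c N) (hφ N) hδ, ih]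

/-- The functions `φ` and numbers `ρ` diagonalize the covariance form with kernel `C` and the
roughness form simultaneously. -/
structure IsEigenSystem (m : ℕ) (C : ℝ → ℝ → ℝ) (a k : ℝ) (φ : ℕ → ℝ → ℝ) (ρ : ℕ → ℝ) :
    Prop where
  mem : ∀ i, MemSobolev m (φ i)
  norm_le : ∃ Cφ > 0, ∀ i : ℕ, Real.sqrt (∫ t in (0 : ℝ)..1, φ i t ^ 2) ≤
    Cφ * ((i : ℝ) + 1) ^ a
  formV_eq : ∀ i j, formV C (φ i) (φ j) = if i = j then 1 else 0
  roughness_eq : ∀ i j, roughness m (φ i) (φ j) = if i = j then ρ i else 0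
  mono : Monotone ρ
  nonneg : ∀ i, 0 ≤ ρ i
  growth : ∃ c₁ > 0, ∀ᶠ i : ℕ in atTop, c₁ * ((i : ℝ) + 1) ^ (2 * k) ≤ ρ i
  tendsto : ∀ β, MemSobolev m β → Tendsto (fun N : ℕ =>
    let r : ℝ → ℝ := fun t => β t - ∑ i ∈ Finset.range N, formV C β (φ i) * φ i t
    formV C r r + roughness m r r) atTop (𝓝 0)

section

variable {Ω : Type*} [MeasurableSpace Ω] {P : Measure Ω}
  {X : Ω → L2I} {x : Ω → ℝ → ℝ} {B : Ω → ℝ} {C a k : ℝ} {m : ℕ} {φ : ℕ → ℝ → ℝ} {ρ : ℕ → ℝ}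
  {β γ : ℝ → ℝ}

lemma IsWeightedProcess.wForm_self_nonneg (h : IsWeightedProcess P B X x C) (u : L2I) :
    0 ≤ wForm P B X u u := by
  refine integral_nonneg_of_ae (h.bounds.mono fun ω hω => ?_)
  have : 0 ≤ B ω := (inv_pos.2 h.pos).le.trans hω.1
  simp only [Pi.zero_apply]
  rw [mul_assoc]
  exact mul_nonneg this (mul_self_nonneg _)

lemma IsWeightedProcess.wForm_sum_left (h : IsWeightedProcess P B X x C) (Φ : ℕ → L2I)
    (c : ℕ → ℝ) (z : L2I) (N : ℕ) :
    wForm P B X (∑ i ∈ Finset.range N, c i • Φ i) z =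
      ∑ i ∈ Finset.range N, c i * wForm P B X (Φ i) z := by
  induction N with
  | zero => simp [wForm]
  | succ N ih => rw [Finset.sum_range_succ, h.wForm_add_mul_left, ih, Finset.sum_range_succ]

lemma IsWeightedProcess.wForm_sub_self (h : IsWeightedProcess P B X x C) (u v : L2I) :
    wForm P B X (u - v) (u - v) = wForm P B X u u - 2 * wForm P B X u v + wForm P B X v v := by
  have e : u - v = u + (-1 : ℝ) • v := by simp [sub_eq_add_neg]
  rw [e, h.wForm_add_mul_left, wForm_comm u, wForm_comm v, h.wForm_add_mul_left,
    h.wForm_add_mul_left, wForm_comm v u]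
  ring

/-- The coefficients of the expansion of `β` in the functions `φ`. -/
def coeffV (P : Measure Ω) (B : Ω → ℝ) (X : Ω → L2I) (φ : ℕ → ℝ → ℝ) (β : ℝ → ℝ) (i : ℕ) : ℝ :=
  wForm P B X (curve β) (curve (φ i))

lemma IsEigenSystem.memSobolev_sub_sum (hE : IsEigenSystem m (covFun P B x) a k φ ρ)
    (hm : 1 ≤ m) (hβ : MemSobolev m β) (c : ℕ → ℝ) (N : ℕ) :
    MemSobolev m (fun t => β t + (-1) * ∑ i ∈ Finset.range N, c i * φ i t) :=
  hβ.add_mul hm (MemSobolev.sum hm hE.mem c N) (-1)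

lemma norm_curve (hβ : MemLp β 2 unitVolume) :
    ‖curve β‖ = Real.sqrt (∫ t in (0 : ℝ)..1, β t ^ 2) := by
  rw [← Real.sqrt_sq (norm_nonneg (curve β)), ← real_inner_self_eq_norm_sq]
  nth_rw 2 [curve_eq hβ]
  rw [inner_toLp_eq, intervalIntegral_eq_integral_unitVolume,
    intervalIntegral_eq_integral_unitVolume]
  congr 1
  refine integral_congr_ae ?_
  rw [curve_eq hβ]
  filter_upwards [hβ.coeFn_toLp] with t ht
  rw [ht, sq]

variable [IsProbabilityMeasure P]

lemma IsWeightedProcess.formV_curve (h : IsWeightedProcess P B X x C)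
    (hβ : MemLp β 2 unitVolume) (hγ : MemLp γ 2 unitVolume) :
    formV (covFun P B x) β γ = wForm P B X (curve β) (curve γ) := by
  rw [h.formV_eq hβ hγ, curve_eq hβ, curve_eq hγ]

lemma IsEigenSystem.wForm_curve (hE : IsEigenSystem m (covFun P B x) a k φ ρ) (hm : 1 ≤ m)
    (h : IsWeightedProcess P B X x C) (i j : ℕ) :
    wForm P B X (curve (φ i)) (curve (φ j)) = if i = j then 1 else 0 := by
  rw [← h.formV_curve ((hE.mem i).memLp hm) ((hE.mem j).memLp hm), hE.formV_eq]

lemma IsEigenSystem.wForm_sum_self (hE : IsEigenSystem m (covFun P B x) a k φ ρ) (hm : 1 ≤ m)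
    (h : IsWeightedProcess P B X x C) (c : ℕ → ℝ) (N : ℕ) :
    wForm P B X (∑ i ∈ Finset.range N, c i • curve (φ i))
      (∑ i ∈ Finset.range N, c i • curve (φ i)) = ∑ i ∈ Finset.range N, c i ^ 2 := by
  rw [h.wForm_sum_left]
  refine Finset.sum_congr rfl fun i hi => ?_
  rw [wForm_comm, h.wForm_sum_left]
  simp_rw [hE.wForm_curve hm h]
  simp [Finset.mem_range.1 hi, sq]

lemma IsEigenSystem.tendsto_remainder (hE : IsEigenSystem m (covFun P B x) a k φ ρ) (hm : 1 ≤ m)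
    (h : IsWeightedProcess P B X x C) (hβ : MemSobolev m β) :
    Tendsto (fun N => wForm P B X
        (curve β - ∑ i ∈ Finset.range N, coeffV P B X φ β i • curve (φ i))
        (curve β - ∑ i ∈ Finset.range N, coeffV P B X φ β i • curve (φ i))) atTop (𝓝 0) ∧
    Tendsto (fun N =>
        roughness m (fun t => β t + (-1) * ∑ i ∈ Finset.range N, coeffV P B X φ β i * φ i t)
          (fun t => β t + (-1) * ∑ i ∈ Finset.range N, coeffV P B X φ β i * φ i t))
      atTop (𝓝 0) := by
  have ht := hE.tendsto β hβ
  have hr : ∀ N, (fun t => β t - ∑ i ∈ Finset.range N,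
      formV (covFun P B x) β (φ i) * φ i t) =
      fun t => β t + (-1) * ∑ i ∈ Finset.range N, coeffV P B X φ β i * φ i t := by
    intro N; funext t
    rw [sub_eq_add_neg, neg_one_mul]
    congr 2
    exact Finset.sum_congr rfl fun i _ => by
      rw [h.formV_curve (hβ.memLp hm) ((hE.mem i).memLp hm)]; rfl
  have hV : ∀ N, formV (covFun P B x)
      (fun t => β t + (-1) * ∑ i ∈ Finset.range N, coeffV P B X φ β i * φ i t)
      (fun t => β t + (-1) * ∑ i ∈ Finset.range N, coeffV P B X φ β i * φ i t) = wForm P B X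
        (curve β - ∑ i ∈ Finset.range N, coeffV P B X φ β i • curve (φ i))
        (curve β - ∑ i ∈ Finset.range N, coeffV P B X φ β i • curve (φ i)) := by
    intro N
    have hmem := (hE.memSobolev_sub_sum hm hβ (coeffV P B X φ β) N).memLp hm
    rw [h.formV_curve hmem hmem, curve_add_mul (hβ.memLp hm)
      ((MemSobolev.sum hm hE.mem _ N).memLp hm), curve_sum hm hE.mem]
    simp only [neg_smul, one_smul, sub_eq_add_neg]
  simp only [hr, hV] at ht
  exact ⟨squeeze_zero (fun N => h.wForm_self_nonneg _)
      (fun N => le_add_of_nonneg_right (roughness_self_nonneg _ _)) ht,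
    squeeze_zero (fun N => roughness_self_nonneg _ _)
      (fun N => le_add_of_nonneg_left (h.wForm_self_nonneg _)) ht⟩

lemma IsEigenSystem.hasSum_coeffV_sq (hE : IsEigenSystem m (covFun P B x) a k φ ρ) (hm : 1 ≤ m)
    (h : IsWeightedProcess P B X x C) (hβ : MemSobolev m β) :
    HasSum (fun i => coeffV P B X φ β i ^ 2) (wForm P B X (curve β) (curve β)) := by
  rw [hasSum_iff_tendsto_nat_of_nonneg fun i => sq_nonneg _]
  have h1 := (hE.tendsto_remainder hm h hβ).1.const_sub (wForm P B X (curve β) (curve β))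
  rw [sub_zero] at h1
  refine h1.congr fun N => ?_
  rw [h.wForm_sub_self, hE.wForm_sum_self hm h, wForm_comm (curve β)
    (∑ i ∈ Finset.range N, coeffV P B X φ β i • curve (φ i)), h.wForm_sum_left]
  have : ∑ i ∈ Finset.range N, coeffV P B X φ β i * wForm P B X (curve (φ i)) (curve β) =
      ∑ i ∈ Finset.range N, coeffV P B X φ β i ^ 2 :=
    Finset.sum_congr rfl fun i _ => by rw [wForm_comm, sq]; rfl
  rw [this]; ring

lemma IsEigenSystem.roughness_eq_mul_coeffV (hE : IsEigenSystem m (covFun P B x) a k φ ρ)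
    (hm : 1 ≤ m) (h : IsWeightedProcess P B X x C) (hβ : MemSobolev m β) (j : ℕ) :
    roughness m β (φ j) = ρ j * coeffV P B X φ β j := by
  have h2 := (hE.tendsto_remainder hm h hβ).2
  have h3 : Tendsto (fun N =>
      roughness m (fun t => β t + (-1) * ∑ i ∈ Finset.range N, coeffV P B X φ β i * φ i t)
        (φ j) ^ 2) atTop (𝓝 0) := by
    refine squeeze_zero (fun _ => sq_nonneg _) (fun N => roughness_sq_le
      (hE.memSobolev_sub_sum hm hβ _ N) (hE.mem j)) ?_
    simpa using h2.mul_const (roughness m (φ j) (φ j))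
  have h4 : ∀ᶠ N in atTop,
      roughness m (fun t => β t + (-1) * ∑ i ∈ Finset.range N, coeffV P B X φ β i * φ i t)
        (φ j) ^ 2 = (roughness m β (φ j) - ρ j * coeffV P B X φ β j) ^ 2 := by
    filter_upwards [eventually_gt_atTop j] with N hN
    rw [roughness_add_mul_left hm hβ (MemSobolev.sum hm hE.mem _ N) (hE.mem j),
      roughness_sum_left hm hE.mem _ (hE.mem j)]
    simp_rw [hE.roughness_eq]
    simp only [mul_ite, mul_zero, Finset.sum_ite_eq', Finset.mem_range, hN, if_true]
    ring
  have h5 := tendsto_nhds_unique (h3.congr' h4) tendsto_const_nhds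
  have := pow_eq_zero_iff (two_ne_zero) |>.1 h5.symm
  linarith

/-- Bessel's inequality for the roughness form. -/
lemma IsEigenSystem.sum_mul_coeffV_sq_le (hE : IsEigenSystem m (covFun P B x) a k φ ρ)
    (hm : 1 ≤ m) (h : IsWeightedProcess P B X x C) (hβ : MemSobolev m β) (N : ℕ) :
    ∑ i ∈ Finset.range N, ρ i * coeffV P B X φ β i ^ 2 ≤ roughness m β β := by
  have hS := MemSobolev.sum hm hE.mem (coeffV P B X φ β) N
  have h1 := roughness_self_nonneg m
    (fun t => β t + (-1) * ∑ i ∈ Finset.range N, coeffV P B X φ β i * φ i t)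
  rw [roughness_add_mul_self hm hβ hS] at h1
  have h2 : roughness m β (fun t => ∑ i ∈ Finset.range N, coeffV P B X φ β i * φ i t) =
      ∑ i ∈ Finset.range N, ρ i * coeffV P B X φ β i ^ 2 := by
    rw [roughness_comm, roughness_sum_left hm hE.mem _ hβ]
    refine Finset.sum_congr rfl fun i _ => ?_
    rw [roughness_comm, hE.roughness_eq_mul_coeffV hm h hβ]; ring
  have h3 : roughness m (fun t => ∑ i ∈ Finset.range N, coeffV P B X φ β i * φ i t)
      (fun t => ∑ i ∈ Finset.range N, coeffV P B X φ β i * φ i t) =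
      ∑ i ∈ Finset.range N, ρ i * coeffV P B X φ β i ^ 2 := by
    rw [roughness_sum_left hm hE.mem _ hS]
    refine Finset.sum_congr rfl fun i hi => ?_
    rw [roughness_comm, roughness_sum_left hm hE.mem _ (hE.mem i)]
    simp_rw [hE.roughness_eq]
    simp only [mul_ite, mul_zero, Finset.sum_ite_eq', hi, if_true]
    ring
  rw [h2, h3] at h1
  linarith

/-- The expansion of a Sobolev function converges in `L²([0,1])`: it is absolutely summable, and
its sum is the function because the covariance operator is injective. -/
lemma IsEigenSystem.hasSum_coeffV_smul (hE : IsEigenSystem m (covFun P B x) a k φ ρ)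
    (hk : a + 1 / 2 < k) (hm : 1 ≤ m) (h : IsWeightedProcess P B X x C)
    (hinj : ∀ u : L2I, (∀ᵐ t ∂unitVolume, ∫ s in (0 : ℝ)..1, covFun P B x s t * u s = 0) → u = 0)
    (hβ : MemSobolev m β) :
    HasSum (fun i => coeffV P B X φ β i • curve (φ i)) (curve β) := by
  set c := coeffV P B X φ β with hc
  have hsum : Summable fun i => c i • curve (φ i) := by
    obtain ⟨Cφ, hCφ, hn⟩ := hE.norm_le
    obtain ⟨c₁, hc₁, hg⟩ := hE.growth
    have s1 : Summable fun i => ρ i * c i ^ 2 :=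
      summable_of_sum_range_le (fun i => mul_nonneg (hE.nonneg i) (sq_nonneg _))
        (hE.sum_mul_coeffV_sq_le hm h hβ)
    have s2 : Summable fun i : ℕ => ((i : ℝ) + 1) ^ (2 * a - 2 * k) := by
      have := (summable_nat_add_iff 1).2
        (Real.summable_nat_rpow.2 (by linarith : 2 * a - 2 * k < -1))
      simpa using this
    refine Summable.of_norm_bounded_eventually_nat
      ((s1.mul_left (Cφ / c₁)).add (s2.mul_left Cφ)) ?_
    filter_upwards [hg] with i hi
    have hi0 : (0 : ℝ) < (i : ℝ) + 1 := by positivity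
    rw [norm_smul, norm_curve ((hE.mem i).memLp hm), Real.norm_eq_abs]
    have e1 : ((i : ℝ) + 1) ^ a * ((i : ℝ) + 1) ^ a =
        ((i : ℝ) + 1) ^ (2 * a - 2 * k) * ((i : ℝ) + 1) ^ (2 * k) := by
      rw [← Real.rpow_add hi0, ← Real.rpow_add hi0]; ring_nf
    set y := ((i : ℝ) + 1) ^ a
    set p := ((i : ℝ) + 1) ^ (2 * a - 2 * k)
    set q := ((i : ℝ) + 1) ^ (2 * k)
    have hp : 0 < p := Real.rpow_pos_of_pos hi0 _
    have hq : 0 < q := Real.rpow_pos_of_pos hi0 _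
    have h1 : |c i| * y ≤ c i ^ 2 * q + p := by
      refine (abs_le_of_sq_le_sq' ?_ (by positivity)).2
      rw [mul_pow, sq_abs, sq y, e1]
      nlinarith [mul_nonneg (sq_nonneg (c i)) (mul_pos hp hq).le, sq_nonneg (c i ^ 2 * q),
        sq_nonneg p]
    have h2 : c i ^ 2 * q ≤ c₁⁻¹ * (ρ i * c i ^ 2) := by
      rw [inv_mul_eq_div, le_div_iff₀ hc₁]
      nlinarith [sq_nonneg (c i)]
    calc |c i| * Real.sqrt (∫ t in (0 : ℝ)..1, φ i t ^ 2) ≤ |c i| * (Cφ * y) := by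
          gcongr; exact hn i
      _ = Cφ * (|c i| * y) := by ring
      _ ≤ Cφ * (c₁⁻¹ * (ρ i * c i ^ 2) + p) := by gcongr; linarith
      _ = _ := by ring
  obtain ⟨v, hv⟩ := hsum
  suffices hd : curve β - v = 0 by rwa [sub_eq_zero.1 hd]
  -- the covariance form vanishes on the difference
  have hB0 : ∀ u : L2I, 0 ≤ ∫ ω, inner ℝ (X ω) u ^ 2 ∂P ∧
      C⁻¹ * ∫ ω, inner ℝ (X ω) u ^ 2 ∂P ≤ wForm P B X u u := by
    intro u
    refine ⟨integral_nonneg fun _ => sq_nonneg _, ?_⟩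
    rw [← integral_const_mul]
    refine integral_mono_ae ((h.memLp_inner u).integrable_sq.const_mul _)
      (h.integrable_mul (h.memLp_inner u) (h.memLp_inner u)) (h.bounds.mono fun ω hω => ?_)
    simp only []
    rw [mul_assoc, ← sq]
    exact mul_le_mul_of_nonneg_right hω.1 (sq_nonneg _)
  have hlim : Tendsto (fun N => ∫ ω, inner ℝ (X ω)
      (curve β - ∑ i ∈ Finset.range N, c i • curve (φ i)) ^ 2 ∂P) atTop (𝓝 0) := by
    refine squeeze_zero (fun N => (hB0 _).1) (fun N => ?_)
      (by simpa using (hE.tendsto_remainder hm h hβ).1.const_mul C)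
    have := (hB0 (curve β - ∑ i ∈ Finset.range N, c i • curve (φ i))).2
    rwa [inv_mul_le_iff₀ h.pos] at this
  have hlim2 : Tendsto (fun N => ∫ ω, inner ℝ (X ω)
      (curve β - ∑ i ∈ Finset.range N, c i • curve (φ i)) ^ 2 ∂P) atTop
      (𝓝 (∫ ω, inner ℝ (X ω) (curve β - v) ^ 2 ∂P)) := by
    have hu : Tendsto (fun N => curve β - ∑ i ∈ Finset.range N, c i • curve (φ i)) atTop
        (𝓝 (curve β - v)) := hv.tendsto_sum_nat.const_sub _
    obtain ⟨M, hM⟩ := (Metric.isBounded_range_of_tendsto _ hu).exists_norm_le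
    refine tendsto_integral_of_dominated_convergence (fun ω => (‖X ω‖ * M) ^ 2)
      (fun N => ((h.memLp_inner _).1.pow 2)) ?_ (fun N => Eventually.of_forall fun ω => ?_)
      (Eventually.of_forall fun ω => ((tendsto_const_nhds.inner hu).pow 2))
    · exact (h.memLp.norm.mul_const M).integrable_sq
    · rw [Real.norm_of_nonneg (sq_nonneg _), sq_le_sq, abs_of_nonneg
        (mul_nonneg (norm_nonneg _) ((norm_nonneg _).trans (hM _ (mem_range_self 0))))]
      exact (abs_real_inner_le_norm _ _).trans (by gcongr; exact hM _ (mem_range_self N))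
  have hz : ∫ ω, inner ℝ (X ω) (curve β - v) ^ 2 ∂P = 0 := tendsto_nhds_unique hlim2 hlim
  have hae : ∀ᵐ ω ∂P, inner ℝ (X ω) (curve β - v) = 0 := by
    have := (integral_eq_zero_iff_of_nonneg (fun _ => sq_nonneg _)
      (h.memLp_inner _).integrable_sq).1 hz
    filter_upwards [this] with ω hω
    simpa using hω
  refine hinj _ ?_
  filter_upwards [ae_restrict_mem measurableSet_Icc] with t ht
  rw [intervalIntegral_eq_integral_unitVolume, h.integral_covFun_mul _ ht]
  refine integral_eq_zero_of_ae ?_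
  filter_upwards [hae] with ω hω
  rw [hω]; simp

end

/-! ### The parameter space as a family of ellipsoids -/

/-- The constant feature, followed by the scores `⟨x, φ i⟩` of the predictor. -/
def feature (φ : ℕ → ℝ → ℝ) : ℕ → L2I × ℝ → ℝ
  | 0, _ => 1
  | i + 1, z => inner ℝ z.1 (curve (φ i))

/-- The weights of the penalized norm: `1` for the constant and `1 + l ρ i` for `φ i`. -/
def penWeight (ρ : ℕ → ℝ) (l : ℝ) : ℕ → ℝ
  | 0 => 1
  | i + 1 => 1 + l * ρ i

/-- The coefficients of `α + ⟨x, β⟩` in the features. -/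
def coeffs {Ω : Type*} [MeasurableSpace Ω] (P : Measure Ω) (B : Ω → ℝ) (X : Ω → L2I)
    (φ : ℕ → ℝ → ℝ) (θ : ℝ × (ℝ → ℝ)) : ℕ → ℝ
  | 0 => θ.1
  | i + 1 => coeffV P B X φ θ.2 i

lemma sum_mul_feature (φ : ℕ → ℝ → ℝ) (c : ℕ → ℝ) (N : ℕ) (z : L2I × ℝ) :
    ∑ i ∈ Finset.range (N + 1), c i * feature φ i z =
      c 0 + inner ℝ z.1 (∑ i ∈ Finset.range N, c (i + 1) • curve (φ i)) := by
  rw [Finset.sum_range_succ', inner_sum, add_comm]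
  simp [feature, real_inner_smul_right]

lemma measurable_feature (φ : ℕ → ℝ → ℝ) (i : ℕ) : Measurable (feature φ i) := by
  cases i with
  | zero => exact measurable_const
  | succ i => exact measurable_fst.inner measurable_const

/-- Polynomial moments from exponential ones. -/
lemma integrable_norm_pow_of_exp {Ω : Type*} [MeasurableSpace Ω] {P : Measure Ω} {X : Ω → L2I}
    (hX : Measurable X) {s : ℝ} (hs : 0 < s)
    (h : Integrable (fun ω => Real.exp (s * ‖X ω‖)) P) (j : ℕ) :
    Integrable (fun ω => ‖X ω‖ ^ j) P := by
  refine (h.const_mul (j.factorial / s ^ j)).mono' (hX.norm.pow_const j).aestronglyMeasurable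
    (Eventually.of_forall fun ω => ?_)
  have h1 := Real.pow_div_factorial_le_exp (s * ‖X ω‖) (by positivity) j
  rw [Real.norm_of_nonneg (by positivity), div_mul_eq_mul_div, le_div_iff₀ (by positivity)]
  rw [div_le_iff₀ (by positivity), mul_pow] at h1
  linarith

section

variable {Ω : Type*} [MeasurableSpace Ω] {P : Measure Ω}
  {X : ℕ → Ω → L2I} {Y : ℕ → Ω → ℝ} {x : Ω → ℝ → ℝ} {B : Ω → ℝ} {C a k : ℝ} {m : ℕ}
  {φ : ℕ → ℝ → ℝ} {ρ : ℕ → ℝ}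

/-- The features have comparable second moments, and fourth moments bounded by the squares of the
second ones. -/
theorem IsEigenSystem.isFeatureSystem [IsProbabilityMeasure P]
    (hE : IsEigenSystem m (covFun P B x) a k φ ρ) (hm : 1 ≤ m)
    (h : IsWeightedProcess P B (X 0) x C) (h4 : Integrable (fun ω => ‖X 0 ω‖ ^ 4) P) {M₀ : ℝ}
    (hM₀ : 0 < M₀) (hfourth : ∀ β, MemSobolev m β →
      ∫ ω, (∫ t in (0 : ℝ)..1, X 0 ω t * β t) ^ 4 ∂P ≤
        M₀ * (∫ ω, (∫ t in (0 : ℝ)..1, X 0 ω t * β t) ^ 2 ∂P) ^ 2) :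
    IsFeatureSystem P (fun i ω => (X i ω, Y i ω)) (feature φ)
      (8 + (C + C ^ 2) + 8 * M₀ * (C + C ^ 2) ^ 2) := by
  have hC := h.pos
  have hX4 : ∀ u : L2I, Integrable (fun ω => inner ℝ (X 0 ω) u ^ 4) P := by
    intro u
    refine (h4.mul_const (‖u‖ ^ 4)).mono' ((h.memLp_inner u).1.pow 4)
      (Eventually.of_forall fun ω => ?_)
    rw [norm_pow, ← mul_pow]
    exact pow_le_pow_left₀ (norm_nonneg _) (norm_inner_le_norm _ _) 4
  have hquad : ∀ (c : ℕ → ℝ) (N : ℕ), ∑ i ∈ Finset.range (N + 1), c i ^ 2 = c 0 ^ 2 +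
      wForm P B (X 0) (∑ i ∈ Finset.range N, c (i + 1) • curve (φ i))
        (∑ i ∈ Finset.range N, c (i + 1) • curve (φ i)) := by
    intro c N
    rw [hE.wForm_sum_self hm h (fun i => c (i + 1)), Finset.sum_range_succ', add_comm]
  refine ⟨measurable_feature φ, ?_, ?_, ?_, ?_, ?_⟩
  · rintro (_ | i)
    · simp [feature]
    · exact hX4 _
  · have : 0 ≤ (C + C ^ 2) + 8 * M₀ * (C + C ^ 2) ^ 2 := by positivity
    linarith
  · rintro c (_ | N)
    · simp
    · simp_rw [sum_mul_feature]
      rw [hquad]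
      refine (h.integral_sq_bounds _ _).1.trans (mul_le_mul_of_nonneg_right ?_
        (add_nonneg (sq_nonneg _) (h.wForm_self_nonneg _)))
      have : 0 ≤ 8 + 8 * M₀ * (C + C ^ 2) ^ 2 := by positivity
      linarith
  · rintro c (_ | N)
    · simp
    · simp_rw [sum_mul_feature]
      rw [hquad]
      refine (h.integral_sq_bounds _ _).2.trans (mul_le_mul_of_nonneg_right ?_
        (integral_nonneg fun _ => sq_nonneg _))
      have : 0 ≤ 8 + 8 * M₀ * (C + C ^ 2) ^ 2 := by positivity
      linarith
  · rintro c (_ | N)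
    · simp
    · simp_rw [sum_mul_feature]
      rw [hquad]
      set u := ∑ i ∈ Finset.range N, c (i + 1) • curve (φ i) with hu
      have hβ := (MemSobolev.sum hm hE.mem (fun i => c (i + 1)) N)
      have hf := hfourth _ hβ
      have he : ∀ ω, ∫ t in (0 : ℝ)..1, X 0 ω t * ∑ i ∈ Finset.range N, c (i + 1) * φ i t =
          inner ℝ (X 0 ω) u := by
        intro ω
        rw [hu, ← curve_sum hm hE.mem (fun i => c (i + 1)), curve_eq (hβ.memLp hm), inner_toLp_eq]
      simp_rw [he] at hf
      have hV := h.wForm_self_nonneg u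
      have h2 : ∫ ω, inner ℝ (X 0 ω) u ^ 2 ∂P ≤ (C + C ^ 2) * wForm P B (X 0) u u := by
        have := (h.integral_sq_bounds 0 u).1
        simpa using this
      have h3 : ∫ ω, inner ℝ (X 0 ω) u ^ 4 ∂P ≤
          M₀ * ((C + C ^ 2) * wForm P B (X 0) u u) ^ 2 :=
        hf.trans (by gcongr)
      have h5 : ∫ ω, (c 0 + inner ℝ (X 0 ω) u) ^ 4 ∂P ≤
          8 * c 0 ^ 4 + 8 * ∫ ω, inner ℝ (X 0 ω) u ^ 4 ∂P := by
        have i1 : Integrable (fun _ : Ω => 8 * c 0 ^ 4) P := integrable_const _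
        have e1 : 8 * c 0 ^ 4 + 8 * ∫ ω, inner ℝ (X 0 ω) u ^ 4 ∂P =
            ∫ ω, 8 * c 0 ^ 4 + 8 * inner ℝ (X 0 ω) u ^ 4 ∂P := by
          rw [integral_add i1 ((hX4 u).const_mul 8), integral_const, integral_const_mul]; simp
        rw [e1]
        refine integral_mono_of_nonneg (Eventually.of_forall fun _ => by positivity)
          (i1.add ((hX4 u).const_mul 8)) (Eventually.of_forall fun ω => ?_)
        simp only []
        nlinarith [sq_nonneg (c 0 - inner ℝ (X 0 ω) u), sq_nonneg (c 0 + inner ℝ (X 0 ω) u),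
          sq_nonneg (c 0 ^ 2 - inner ℝ (X 0 ω) u ^ 2),
          sq_nonneg ((c 0 - inner ℝ (X 0 ω) u) ^ 2), mul_nonneg
              (sq_nonneg (c 0 - inner ℝ (X 0 ω) u)) (sq_nonneg (c 0 + inner ℝ (X 0 ω) u))]
      set V := wForm P B (X 0) u u
      have hK1 : 8 ≤ 8 + (C + C ^ 2) + 8 * M₀ * (C + C ^ 2) ^ 2 := by
        have : 0 ≤ (C + C ^ 2) + 8 * M₀ * (C + C ^ 2) ^ 2 := by positivity
        linarith
      have hK2 : 8 * M₀ * (C + C ^ 2) ^ 2 ≤ 8 + (C + C ^ 2) + 8 * M₀ * (C + C ^ 2) ^ 2 := by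
        have : 0 ≤ 8 + (C + C ^ 2) := by positivity
        linarith
      set K := 8 + (C + C ^ 2) + 8 * M₀ * (C + C ^ 2) ^ 2
      calc _ ≤ 8 * c 0 ^ 4 + 8 * (M₀ * ((C + C ^ 2) * V) ^ 2) := by linarith
        _ = 8 * (c 0 ^ 2) ^ 2 + 8 * M₀ * (C + C ^ 2) ^ 2 * V ^ 2 := by ring
        _ ≤ K * (c 0 ^ 2) ^ 2 + K * V ^ 2 := by gcongr
        _ ≤ K * (c 0 ^ 2 + V) ^ 2 := by
            nlinarith [mul_nonneg (sq_nonneg (c 0)) hV,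
              mul_nonneg (by linarith : 0 ≤ K) (mul_nonneg (sq_nonneg (c 0)) hV)]

variable [IsProbabilityMeasure P]

lemma IsEigenSystem.expands_linPred (hE : IsEigenSystem m (covFun P B x) a k φ ρ)
    (hk : a + 1 / 2 < k) (hm : 1 ≤ m) (h : IsWeightedProcess P B (X 0) x C)
    (hinj : ∀ u : L2I, (∀ᵐ t ∂unitVolume, ∫ s in (0 : ℝ)..1, covFun P B x s t * u s = 0) → u = 0)
    {θ : ℝ × (ℝ → ℝ)} (hθ : MemSobolev m θ.2) :
    Expands (feature φ) (coeffs P B (X 0) φ θ) (fun z => linPred z.1 θ) := by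
  intro z
  rw [← hasSum_nat_add_iff' 1]
  have h1 := (hE.hasSum_coeffV_smul hk hm h hinj hθ).mapL (innerSL ℝ z.1)
  have e : linPred z.1 θ = θ.1 + inner ℝ z.1 (curve θ.2) := linPred_curve (hθ.memLp hm) z.1 θ.1
  simpa [e, coeffs, feature, real_inner_smul_right] using h1

lemma IsEigenSystem.inEllipsoid_coeffs (hE : IsEigenSystem m (covFun P B x) a k φ ρ)
    (hm : 1 ≤ m) (h : IsWeightedProcess P B (X 0) x C) {θ : ℝ × (ℝ → ℝ)}
    (hθ : MemSobolev m θ.2) {l : ℝ} (hl : 0 ≤ l) :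
    InEllipsoid (penWeight ρ l) (coeffs P B (X 0) φ θ)
      (θ.1 ^ 2 + wForm P B (X 0) (curve θ.2) (curve θ.2) + l * roughness m θ.2 θ.2) := by
  rintro (_ | N)
  · simp only [Finset.range_zero, Finset.sum_empty]
    exact add_nonneg (add_nonneg (sq_nonneg _) (h.wForm_self_nonneg _))
      (mul_nonneg hl (roughness_self_nonneg _ _))
  · rw [Finset.sum_range_succ']
    simp only [penWeight, coeffs, one_mul, add_mul, Finset.sum_add_distrib]
    have h1 := (hE.hasSum_coeffV_sq hm h hθ).summable.sum_le_tsum (Finset.range N)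
      fun i _ => sq_nonneg _
    rw [(hE.hasSum_coeffV_sq hm h hθ).tsum_eq] at h1
    have h2 := mul_le_mul_of_nonneg_left (hE.sum_mul_coeffV_sq_le hm h hθ N) hl
    rw [Finset.mul_sum] at h2
    simp_rw [← mul_assoc] at h2
    linarith

/-- Partial sums of the squared coefficients exceed every number below their total. -/
lemma IsEigenSystem.exists_le_sum_coeffs_sq (hE : IsEigenSystem m (covFun P B x) a k φ ρ)
    (hm : 1 ≤ m) (h : IsWeightedProcess P B (X 0) x C) {θ : ℝ × (ℝ → ℝ)}
    (hθ : MemSobolev m θ.2) {r : ℝ}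
    (hr : r < θ.1 ^ 2 + wForm P B (X 0) (curve θ.2) (curve θ.2)) :
    ∃ N, r ≤ ∑ i ∈ Finset.range N, coeffs P B (X 0) φ θ i ^ 2 := by
  have h1 := ((hE.hasSum_coeffV_sq hm h hθ).tendsto_sum_nat.const_add (θ.1 ^ 2)).eventually_const_lt
      hr
  obtain ⟨N, hN⟩ := h1.exists
  refine ⟨N + 1, ?_⟩
  rw [Finset.sum_range_succ']
  simp only [coeffs]
  linarith

end

/-! ### The effective dimension -/

lemma bandwidth_rpow {k l : ℝ} (hk : k ≠ 0) (hl : 0 < l) : bandwidth k l ^ (2 * k) = l := by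
  rw [bandwidth, ← Real.rpow_mul hl.le, one_div, inv_mul_cancel₀ (by simpa using hk),
    Real.rpow_one]

/-- A rational weight is dominated by a power of the rescaled index. -/
lemma inv_one_add_mul_rpow_le {p r c y : ℝ} (hp : 0 ≤ p) (hpr : p ≤ r) (hc : 0 < c)
    (hy : 0 < y) : (1 + c * y ^ r)⁻¹ ≤ (min 1 c)⁻¹ * y ^ (-p) := by
  have hm : 0 < min 1 c := lt_min one_pos hc
  have hyp : 0 < y ^ p := Real.rpow_pos_of_pos hy p
  have hyr : 0 < y ^ r := Real.rpow_pos_of_pos hy r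
  rw [Real.rpow_neg hy.le, ← mul_inv]
  refine inv_anti₀ (mul_pos hm hyp) ?_
  have h1 : y ^ p ≤ 1 + y ^ r := by
    rcases le_total y 1 with h | h
    · exact (Real.rpow_le_one hy.le h hp).trans (by linarith)
    · exact (Real.rpow_le_rpow_of_exponent_le h hpr).trans (by linarith)
  calc min 1 c * y ^ p ≤ min 1 c * (1 + y ^ r) := by gcongr
    _ = min 1 c + min 1 c * y ^ r := by ring
    _ ≤ 1 + c * y ^ r := by
        gcongr
        · exact min_le_left _ _
        · exact min_le_right _ _

lemma penWeight_one_le {ρ : ℕ → ℝ} (hρ : ∀ i, 0 ≤ ρ i) {l : ℝ} (hl : 0 ≤ l) (i : ℕ) :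
    1 ≤ penWeight ρ l i := by
  cases i with
  | zero => exact le_rfl
  | succ i => exact le_add_of_nonneg_right (mul_nonneg hl (hρ i))

lemma monotone_penWeight {ρ : ℕ → ℝ} (hρ : ∀ i, 0 ≤ ρ i) (hmono : Monotone ρ) {l : ℝ}
    (hl : 0 ≤ l) : Monotone (penWeight ρ l) := by
  refine monotone_nat_of_le_succ fun i => ?_
  cases i with
  | zero => exact penWeight_one_le hρ hl 1
  | succ i =>
    have := mul_le_mul_of_nonneg_left (hmono i.le_succ) hl
    simp only [penWeight]
    linarith

/-- The sum of the inverse weights is `O(h ^ (-p))` for each `p > 1` up to the order of the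
weights. -/
lemma exists_tsum_inv_penWeight_le {ρ : ℕ → ℝ} (hρ : ∀ i, 0 ≤ ρ i) {c k p : ℝ} (hc : 0 < c)
    (hg : ∀ᶠ i : ℕ in atTop, c * ((i : ℝ) + 1) ^ (2 * k) ≤ ρ i) (hp : 1 < p) (hpk : p ≤ 2 * k) :
    ∃ D > 0, ∀ l > 0, Summable (fun i => (penWeight ρ l i)⁻¹) ∧
      ∑' i, (penWeight ρ l i)⁻¹ ≤ D * (1 + bandwidth k l ^ (-p)) := by
  obtain ⟨i₀, hi₀⟩ := eventually_atTop.1 hg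
  have hs : Summable fun i : ℕ => ((i : ℝ) + 1) ^ (-p) := by
    have := (summable_nat_add_iff 1).2 (Real.summable_nat_rpow.2 (by linarith : -p < -1))
    simpa using this
  set S := ∑' i : ℕ, ((i : ℝ) + 1) ^ (-p) with hS
  have hS0 : 0 ≤ S := tsum_nonneg fun i => by positivity
  have hm : 0 < min 1 c := lt_min one_pos hc
  have hk0 : 0 < k := by linarith
  refine ⟨(1 + i₀) + (min 1 c)⁻¹ * S, by positivity, fun l hl => ?_⟩
  have hh : 0 < bandwidth k l := Real.rpow_pos_of_pos hl _
  have hterm : ∀ i : ℕ, (penWeight ρ l (i + 1))⁻¹ ≤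
      (if i < i₀ then 1 else 0) +
        (min 1 c)⁻¹ * bandwidth k l ^ (-p) * ((i : ℝ) + 1) ^ (-p) := by
    intro i
    have hi1 : (0 : ℝ) < (i : ℝ) + 1 := by positivity
    have hnn : 0 ≤ (min 1 c)⁻¹ * bandwidth k l ^ (-p) * ((i : ℝ) + 1) ^ (-p) := by positivity
    split_ifs with hi
    · have := inv_le_one_of_one_le₀ (penWeight_one_le hρ hl.le (i + 1))
      linarith
    · rw [zero_add, mul_assoc, ← Real.mul_rpow hh.le hi1.le]
      refine le_trans ?_ (inv_one_add_mul_rpow_le (by linarith) hpk hc (mul_pos hh hi1))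
      have h1 : 0 < (bandwidth k l * ((i : ℝ) + 1)) ^ (2 * k) :=
        Real.rpow_pos_of_pos (mul_pos hh hi1) _
      refine inv_anti₀ (by positivity) ?_
      rw [Real.mul_rpow hh.le hi1.le, bandwidth_rpow hk0.ne' hl]
      simp only [penWeight]
      have := mul_le_mul_of_nonneg_left (hi₀ i (not_lt.1 hi)) hl.le
      linarith
  have hfin : HasSum (fun i => if i < i₀ then (1 : ℝ) else 0) i₀ := by
    have := hasSum_sum_of_ne_finset_zero (f := fun i => if i < i₀ then (1 : ℝ) else 0)
      (L := .unconditional ℕ) (s := Finset.range i₀) fun i hi => by simpa using hi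
    convert this using 1
    rw [Finset.sum_congr rfl fun i hi => if_pos (Finset.mem_range.1 hi)]
    simp
  have hub := hfin.add (hs.hasSum.mul_left ((min 1 c)⁻¹ * bandwidth k l ^ (-p)))
  have hw0 : ∀ i, 0 ≤ (penWeight ρ l i)⁻¹ := fun i =>
    inv_nonneg.2 (zero_le_one.trans (penWeight_one_le hρ hl.le i))
  have hsum1 : Summable fun i => (penWeight ρ l (i + 1))⁻¹ :=
    Summable.of_nonneg_of_le (fun i => hw0 _) hterm hub.summable
  have hsum : Summable fun i => (penWeight ρ l i)⁻¹ := (summable_nat_add_iff 1).1 hsum1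
  refine ⟨hsum, ?_⟩
  rw [hsum.tsum_eq_zero_add]
  have h1 := hsum1.tsum_le_tsum hterm hub.summable
  rw [hub.tsum_eq] at h1
  have h2 : (penWeight ρ l 0)⁻¹ = 1 := by simp [penWeight]
  rw [h2]
  have h3 : 0 ≤ bandwidth k l ^ (-p) := by positivity
  have h4 : 0 ≤ (min 1 c)⁻¹ * S := by positivity
  have h5 : (0 : ℝ) ≤ i₀ := Nat.cast_nonneg _
  nlinarith [mul_nonneg h5 h3]

/-- Under the rate conditions the effective dimension is of smaller order than `n ^ (1 / 2)`. -/
theorem IsEigenSystem.isWeightSystem {C : ℝ → ℝ → ℝ} {a k : ℝ} {m : ℕ} {φ : ℕ → ℝ → ℝ}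
    {ρ : ℕ → ℝ} (hE : IsEigenSystem m C a k φ ρ) (ha : 0 ≤ a) (hk : a + 1 / 2 < k) (hm : 1 ≤ m)
    {lam : ℕ → ℝ} (hrate : RateAssumption m a k lam) :
    IsWeightSystem fun n => penWeight ρ (lam n) := by
  obtain ⟨c, hc, hg⟩ := hE.growth
  have hm0 : (0 : ℝ) < 4 * m := by have : (1 : ℝ) ≤ m := by exact_mod_cast hm
                                   linarith
  set q : ℝ := (a + 1) + (2 * k - 2 * a - 1) / (4 * m) with hq
  have hq1 : 1 < q := by
    have : 0 < (2 * k - 2 * a - 1) / (4 * m) := div_pos (by linarith) hm0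
    linarith
  set p : ℝ := min (2 * k) q with hp
  have hp1 : 1 < p := lt_min (by linarith) hq1
  obtain ⟨D, hD, hΛ⟩ := exists_tsum_inv_penWeight_le hE.nonneg hc hg hp1 (min_le_left _ _)
  refine ⟨fun n => penWeight_one_le hE.nonneg (hrate.pos n).le,
    fun n => monotone_penWeight hE.nonneg hE.mono (hrate.pos n).le,
    fun n => (hΛ _ (hrate.pos n)).1, ?_⟩
  have hh : ∀ n, 0 < bandwidth k (lam n) := fun n => Real.rpow_pos_of_pos (hrate.pos n) _
  -- the power of the bandwidth in the rate condition dominates, as do the logarithms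
  have h1 : Tendsto (fun n : ℕ => (n : ℝ) ^ (-(1 / 2) : ℝ) * bandwidth k (lam n) ^ (-p)) atTop
      (𝓝 0) := by
    refine squeeze_zero' (Eventually.of_forall fun n => by have := hh n; positivity) ?_
      hrate.remainder
    have hlog : Tendsto (fun n : ℕ => Real.log n) atTop atTop :=
      Real.tendsto_log_atTop.comp tendsto_natCast_atTop_atTop
    filter_upwards [hrate.h_small.eventually_lt_const one_pos, hlog.eventually_ge_atTop 1,
      (Real.tendsto_log_atTop.comp hlog).eventually_ge_atTop 1] with n hn1 hn2 hn3
    have e1 : bandwidth k (lam n) ^ (-p) ≤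
        bandwidth k (lam n) ^ (-(a + 1) - (2 * k - 2 * a - 1) / (4 * m)) := by
      refine Real.rpow_le_rpow_of_exponent_ge (hh n) hn1.le ?_
      have : p ≤ q := min_le_right _ _
      linarith
    have e2 : (1 : ℝ) ≤ Real.log (Real.log n) ^ (1 / 2 : ℝ) := Real.one_le_rpow hn3 (by norm_num)
    have e3 : (1 : ℝ) ≤ Real.log n ^ 2 := one_le_pow₀ hn2
    have e4 : 0 ≤ (n : ℝ) ^ (-(1 / 2) : ℝ) *
        bandwidth k (lam n) ^ (-(a + 1) - (2 * k - 2 * a - 1) / (4 * m)) := by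
      have := hh n; positivity
    calc _ ≤ (n : ℝ) ^ (-(1 / 2) : ℝ) *
          bandwidth k (lam n) ^ (-(a + 1) - (2 * k - 2 * a - 1) / (4 * m)) := by gcongr
      _ ≤ _ := by
          rw [mul_assoc _ (Real.log n ^ 2)]
          exact le_mul_of_one_le_right e4 (one_le_mul_of_one_le_of_one_le e3 e2)
  have h2 : Tendsto (fun n : ℕ => D ^ 2 * (2 * (1 / (n : ℝ)) +
      2 * ((n : ℝ) ^ (-(1 / 2) : ℝ) * bandwidth k (lam n) ^ (-p)) ^ 2)) atTop (𝓝 0) := by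
    simpa using ((tendsto_one_div_atTop_nhds_zero_nat.const_mul 2).add
      ((h1.pow 2).const_mul 2)).const_mul (D ^ 2)
  refine squeeze_zero' (Eventually.of_forall fun n => by positivity) ?_ h2
  filter_upwards [eventually_gt_atTop 0] with n hn
  have hn0 : (0 : ℝ) < n := by exact_mod_cast hn
  have e1 := (hΛ _ (hrate.pos n)).2
  have e0 : 0 ≤ ∑' i, (penWeight ρ (lam n) i)⁻¹ := tsum_nonneg fun i =>
    inv_nonneg.2 (zero_le_one.trans (penWeight_one_le hE.nonneg (hrate.pos n).le i))
  have e2 : ((n : ℝ) ^ (-(1 / 2) : ℝ)) ^ 2 = 1 / n := by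
    rw [← Real.rpow_natCast, ← Real.rpow_mul hn0.le]
    norm_num [Real.rpow_neg_one]
  rw [mul_pow, e2, div_eq_mul_one_div]
  have e3 : (∑' i, (penWeight ρ (lam n) i)⁻¹) ^ 2 ≤
      D ^ 2 * (2 + 2 * (bandwidth k (lam n) ^ (-p)) ^ 2) := by
    refine (pow_le_pow_left₀ e0 e1 2).trans ?_
    rw [mul_pow]
    gcongr
    nlinarith [sq_nonneg (bandwidth k (lam n) ^ (-p) - 1)]
  calc _ ≤ D ^ 2 * (2 + 2 * (bandwidth k (lam n) ^ (-p)) ^ 2) * (1 / n) := by gcongr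
    _ = _ := by ring

/-! ### The link function and its Bregman divergence -/

/-- The cumulant function `b` has the strictly increasing derivative `F`, which is Lipschitz. -/
structure IsLink (b F : ℝ → ℝ) (K : ℝ) : Prop where
  pos : 0 < K
  hasDerivAt : ∀ a, HasDerivAt b (F a) a
  strictMono : StrictMono F
  lipschitz : ∀ s t, |F s - F t| ≤ K * |s - t|

/-- The Bregman divergence of `b` between `η` and `η + u`. -/
def bregman (b F : ℝ → ℝ) (η u : ℝ) : ℝ := b (η + u) - b η - F η * u

section

variable {b F : ℝ → ℝ} {K : ℝ}

lemma IsLink.continuous (h : IsLink b F K) : Continuous F :=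
  (LipschitzWith.of_dist_le_mul (K := ⟨K, h.pos.le⟩) h.lipschitz).continuous

lemma IsLink.continuous_cumulant (h : IsLink b F K) : Continuous b :=
  continuous_iff_continuousAt.2 fun a => (h.hasDerivAt a).continuousAt

/-- The mean value theorem for the divergence. -/
lemma IsLink.exists_bregman_eq (h : IsLink b F K) (η u : ℝ) :
    ∃ v, |v| ≤ |u| ∧ 0 ≤ v * u ∧ (u ≠ 0 → 0 < v * u) ∧
      bregman b F η u = (F (η + v) - F η) * u := by
  rcases lt_trichotomy u 0 with hu | rfl | hu
  · obtain ⟨ξ, hξ, he⟩ := exists_hasDerivAt_eq_slope b F (by linarith : η + u < η)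
      h.continuous_cumulant.continuousOn fun s _ => h.hasDerivAt s
    have h1 := hξ.1
    have h2 := hξ.2
    have hv : ξ - η < 0 := by linarith
    refine ⟨ξ - η, ?_, (mul_pos_of_neg_of_neg hv hu).le, fun _ => mul_pos_of_neg_of_neg hv hu, ?_⟩
    · rw [abs_of_neg hv, abs_of_neg hu]; linarith
    · rw [bregman, add_sub_cancel, he]
      have : η - (η + u) ≠ 0 := by linarith
      field_simp
      ring
  · exact ⟨0, by simp, by simp, by simp, by simp [bregman]⟩
  · obtain ⟨ξ, hξ, he⟩ := exists_hasDerivAt_eq_slope b F (by linarith : η < η + u)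
      h.continuous_cumulant.continuousOn fun s _ => h.hasDerivAt s
    have h1 := hξ.1
    have h2 := hξ.2
    have hv : 0 < ξ - η := by linarith
    refine ⟨ξ - η, ?_, (mul_pos hv hu).le, fun _ => mul_pos hv hu, ?_⟩
    · rw [abs_of_pos hv, abs_of_pos hu]; linarith
    · rw [bregman, add_sub_cancel, he, add_sub_cancel_left, sub_mul, div_mul_cancel₀ _ hu.ne']

lemma IsLink.mul_nonneg (h : IsLink b F K) {η v u : ℝ} (hvu : 0 ≤ v * u) :
    0 ≤ (F (η + v) - F η) * u := by
  rcases lt_trichotomy u 0 with hu | rfl | hu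
  · have hv : v ≤ 0 := by
      by_contra! hv
      exact absurd hvu (not_le.2 (mul_neg_of_pos_of_neg hv hu))
    have := h.strictMono.monotone (by linarith : η + v ≤ η)
    exact mul_nonneg_of_nonpos_of_nonpos (by linarith) hu.le
  · simp
  · have hv : 0 ≤ v := by
      by_contra! hv
      exact absurd hvu (not_le.2 (mul_neg_of_neg_of_pos hv hu))
    have := h.strictMono.monotone (by linarith : η ≤ η + v)
    exact _root_.mul_nonneg (by linarith) hu.le

lemma IsLink.bregman_nonneg (h : IsLink b F K) (η u : ℝ) : 0 ≤ bregman b F η u := by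
  obtain ⟨v, -, hv, -, he⟩ := h.exists_bregman_eq η u
  rw [he]
  exact h.mul_nonneg hv

lemma IsLink.bregman_pos (h : IsLink b F K) (η : ℝ) {u : ℝ} (hu : u ≠ 0) :
    0 < bregman b F η u := by
  obtain ⟨v, -, hv0, hv, he⟩ := h.exists_bregman_eq η u
  refine lt_of_le_of_ne (h.bregman_nonneg η u) fun h0 => ?_
  rw [he] at h0
  rcases mul_eq_zero.1 h0.symm with h1 | h1
  · have h2 := h.strictMono.injective (sub_eq_zero.1 h1)
    have h3 : v = 0 := by linarith
    have := hv hu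
    simp [h3] at this
  · exact hu h1

lemma IsLink.bregman_le (h : IsLink b F K) (η u : ℝ) : bregman b F η u ≤ K * u ^ 2 := by
  obtain ⟨v, hv, -, -, he⟩ := h.exists_bregman_eq η u
  rw [he]
  refine (le_abs_self _).trans ?_
  rw [abs_mul, ← sq_abs u]
  have h1 := h.lipschitz (η + v) η
  rw [add_sub_cancel_left] at h1
  have hK := h.pos
  calc |F (η + v) - F η| * |u| ≤ (K * |u|) * |u| := by
        gcongr; exact h1.trans (by gcongr)
    _ = _ := by ring

/-- Co-coercivity: the divergence dominates the squared difference of the means. -/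
lemma IsLink.sq_sub_le_bregman (h : IsLink b F K) (η u : ℝ) :
    (F (η + u) - F η) ^ 2 ≤ 4 * K * bregman b F η u := by
  have hK := h.pos
  set Δ := F (η + u) - F η with hΔ
  set s := Δ / (2 * K) with hs
  have h1 := h.bregman_le (η + u) (-s)
  have h2 := h.bregman_nonneg η (u - s)
  simp only [bregman] at h1 h2 ⊢
  have e : η + (u - s) = η + u + -s := by ring
  rw [e] at h2
  have h3 : Δ * s - K * s ^ 2 ≤ b (η + u) - b η - F η * u := by
    rw [hΔ]; nlinarith
  have h4 : Δ * s - K * s ^ 2 = Δ ^ 2 / (4 * K) := by rw [hs]; field_simp; ring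
  rw [h4, div_le_iff₀ (by positivity)] at h3
  linarith

lemma IsLink.bregman_mul_le (h : IsLink b F K) (η u : ℝ) {s : ℝ} (hs0 : 0 ≤ s) (hs1 : s ≤ 1) :
    bregman b F η (s * u) ≤ s * bregman b F η u := by
  -- convexity of `b`, from the tangent at the intermediate point
  have h1 := h.bregman_nonneg (η + s * u) ((1 - s) * u)
  have h2 := h.bregman_nonneg (η + s * u) (-(s * u))
  simp only [bregman] at *
  have e1 : η + s * u + (1 - s) * u = η + u := by ring
  have e2 : η + s * u + -(s * u) = η := by ring
  rw [e1] at h1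
  rw [e2] at h2
  nlinarith [_root_.mul_nonneg hs0 h1, _root_.mul_nonneg (sub_nonneg.2 hs1) h2]

/-- Uniform strict convexity on a bounded set of centres. -/
lemma IsLink.exists_mul_le_bregman (h : IsLink b F K) (M : ℝ) {τ : ℝ} (hτ : 0 < τ) :
    ∃ c > 0, ∀ η u, |η| ≤ M → c * (min |u| 1 - τ) ≤ bregman b F η u := by
  have hcont : ∀ t, Continuous fun η => bregman b F η t := fun t =>
    ((h.continuous_cumulant.comp (continuous_id.add continuous_const)).sub
      h.continuous_cumulant).sub (h.continuous.mul continuous_const)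
  have hpos : ∀ t, t ≠ 0 → ∃ c > 0, ∀ η, |η| ≤ M → c ≤ bregman b F η t := by
    intro t ht
    rcases lt_or_ge M 0 with hM | hM
    · exact ⟨1, one_pos, fun η hη => absurd ((abs_nonneg η).trans hη) (not_le.2 hM)⟩
    · obtain ⟨η₀, -, hmin⟩ := (isCompact_Icc (a := -M) (b := M)).exists_isMinOn
        ⟨0, by constructor <;> linarith⟩ (hcont t).continuousOn
      exact ⟨_, h.bregman_pos η₀ ht, fun η hη => hmin (abs_le.1 hη)⟩
  obtain ⟨c₁, hc₁, h₁⟩ := hpos τ hτ.ne'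
  obtain ⟨c₂, hc₂, h₂⟩ := hpos (-τ) (neg_ne_zero.2 hτ.ne')
  refine ⟨min c₁ c₂, lt_min hc₁ hc₂, fun η u hη => ?_⟩
  have hc : 0 < min c₁ c₂ := lt_min hc₁ hc₂
  rcases le_or_gt (min |u| 1) τ with hu | hu
  · exact (mul_nonpos_of_nonneg_of_nonpos hc.le (by linarith)).trans (h.bregman_nonneg η u)
  · have h3 : min c₁ c₂ * (min |u| 1 - τ) ≤ min c₁ c₂ :=
      mul_le_of_le_one_right hc.le (by linarith [min_le_right |u| 1])
    refine h3.trans ?_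
    have hu' : τ < |u| := hu.trans_le (min_le_left _ _)
    -- the divergence increases along rays
    rcases le_total 0 u with h0 | h0
    · rw [abs_of_nonneg h0] at hu'
      refine (min_le_left _ _).trans ((h₁ η hη).trans ?_)
      have h4 := h.bregman_nonneg (η + τ) (u - τ)
      have h5 := h.strictMono.monotone (by linarith : η ≤ η + τ)
      simp only [bregman] at *
      have e : η + τ + (u - τ) = η + u := by ring
      rw [e] at h4
      nlinarith [_root_.mul_nonneg (sub_nonneg.2 h5) (sub_nonneg.2 hu'.le)]
    · rw [abs_of_nonpos h0] at hu'
      refine (min_le_right _ _).trans ((h₂ η hη).trans ?_)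
      have h4 := h.bregman_nonneg (η + -τ) (u + τ)
      have h5 := h.strictMono.monotone (by linarith : η + -τ ≤ η)
      simp only [bregman] at *
      have e : η + -τ + (u + τ) = η + u := by ring
      rw [e] at h4
      nlinarith [_root_.mul_nonneg (sub_nonneg.2 h5) (by linarith : 0 ≤ -u - τ)]

end

/-- The cumulant function of the model: smoothness and concavity of the log-likelihood make `F`
strictly increasing, and the bound on the second derivative makes it Lipschitz. -/
theorem IsExpFamilyLogLik.exists_isLink {𝒴 : Set ℝ} {ℓ : ℝ → ℝ → ℝ} {F : ℝ → ℝ} {d : ℝ}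
    (h : IsExpFamilyLogLik 𝒴 ℓ F d) {y : ℝ} (hy : y ∈ 𝒴) (hs : ContDiff ℝ 3 (ℓ y))
    (hc : StrictConcaveOn ℝ univ (ℓ y))
    (hb : BddAbove (range fun a => |iteratedDeriv 2 (ℓ y) a|)) :
    ∃ (b c : ℝ → ℝ) (K : ℝ), IsLink b F K ∧
      ∀ y ∈ 𝒴, ∀ a, ℓ y a = (y * a - b a) / d + c y := by
  obtain ⟨b, c, hbF, hform⟩ := h.form
  have hd := h.dispersion_pos
  have hder : ∀ a, HasDerivAt (ℓ y) ((y - F a) / d) a := by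
    intro a
    have h1 : HasDerivAt (fun a => (y * a - b a) / d + c y) ((y * 1 - F a) / d) a :=
      ((((hasDerivAt_id a).const_mul y).sub (hbF a)).div_const d).add_const _
    rw [mul_one] at h1
    exact h1.congr_of_eventuallyEq (Eventually.of_forall fun a => hform y hy a)
  have hderiv : deriv (ℓ y) = fun a => (y - F a) / d := funext fun a => (hder a).deriv
  have hF : F = fun a => y - d * deriv (ℓ y) a := by
    funext a; rw [hderiv]; field_simp; ring
  have hdiff : Differentiable ℝ (deriv (ℓ y)) := by
    have : ContDiff ℝ 2 (deriv (ℓ y)) := (contDiff_succ_iff_deriv.1 hs).2.2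
    exact this.differentiable (by norm_num)
  obtain ⟨M, hM⟩ := hb
  have hM' : ∀ a, |deriv (deriv (ℓ y)) a| ≤ M := by
    intro a
    have := hM (mem_range_self a)
    simpa [iteratedDeriv_succ, iteratedDeriv_zero] using this
  have hM0 : 0 ≤ M := (abs_nonneg _).trans (hM' 0)
  refine ⟨b, c, d * M + 1, ⟨by positivity, hbF, ?_, ?_⟩, hform⟩
  · have hanti : StrictAnti (deriv (ℓ y)) := by
      have := hc.strictAntiOn_deriv fun a _ => (hder a).differentiableAt
      exact strictAntiOn_univ.1 this
    intro s t hst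
    rw [hF]
    have := mul_lt_mul_of_pos_left (hanti hst) hd
    simp only []
    linarith
  · intro s t
    have h1 := Convex.norm_image_sub_le_of_norm_deriv_le (f := deriv (ℓ y)) (s := univ)
      (fun a _ => hdiff a) (fun a _ => hM' a) convex_univ (mem_univ t) (mem_univ s)
    rw [Real.norm_eq_abs, Real.norm_eq_abs] at h1
    have e : F s - F t = -(d * (deriv (ℓ y) s - deriv (ℓ y) t)) := by rw [hF]; ring
    rw [e, abs_neg, abs_mul, abs_of_pos hd]
    nlinarith [mul_le_mul_of_nonneg_left h1 hd.le, abs_nonneg (s - t)]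

/-! ### Consistency of the penalized estimator -/

/-- The difference of two parameters. -/
def paramSub (θ θ' : ℝ × (ℝ → ℝ)) : ℝ × (ℝ → ℝ) := (θ.1 - θ'.1, fun t => θ.2 t + (-1) * θ'.2 t)

lemma memSobolev_paramSub {m : ℕ} (hm : 1 ≤ m) {θ θ' : ℝ × (ℝ → ℝ)} (h : MemSobolev m θ.2)
    (h' : MemSobolev m θ'.2) : MemSobolev m (paramSub θ θ').2 := h.add_mul hm h' (-1)

lemma linPred_paramSub {m : ℕ} (hm : 1 ≤ m) {θ θ' : ℝ × (ℝ → ℝ)} (h : MemSobolev m θ.2)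
    (h' : MemSobolev m θ'.2) (x : L2I) :
    linPred x (paramSub θ θ') = linPred x θ - linPred x θ' := by
  have e : ∀ θ : ℝ × (ℝ → ℝ), MemSobolev m θ.2 → linPred x θ = θ.1 + inner ℝ x (curve θ.2) :=
    fun θ hθ => linPred_curve (hθ.memLp hm) x θ.1
  rw [e _ (memSobolev_paramSub hm h h'), e _ h, e _ h']
  simp only [paramSub]
  rw [curve_add_mul (h.memLp hm) (h'.memLp hm), inner_add_right, real_inner_smul_right]
  ring

lemma roughness_eq_paramSub {m : ℕ} (hm : 1 ≤ m) {θ θ' : ℝ × (ℝ → ℝ)} (h : MemSobolev m θ.2)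
    (h' : MemSobolev m θ'.2) :
    roughness m θ.2 θ.2 = roughness m θ'.2 θ'.2 + 2 * roughness m θ'.2 (paramSub θ θ').2 +
      roughness m (paramSub θ θ').2 (paramSub θ θ').2 := by
  have h1 := roughness_add_mul_self hm h' (memSobolev_paramSub hm h h') 1
  have e : (fun t => θ'.2 t + 1 * (paramSub θ θ').2 t) = θ.2 := by
    funext t; simp [paramSub]
  rw [e] at h1
  linarith

/-- The normalized residual `(y - F(α + ∫ x β)) / d`. -/
def stdResidual (F : ℝ → ℝ) (d : ℝ) (θ : ℝ × (ℝ → ℝ)) (z : L2I × ℝ) : ℝ :=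
  residual F θ z.1 z.2 / d

lemma loglik_sub_eq {b c F : ℝ → ℝ} {d y : ℝ} {ℓ : ℝ → ℝ → ℝ}
    (hform : ∀ a, ℓ y a = (y * a - b a) / d + c y) (η u : ℝ) :
    ℓ y (η + u) - ℓ y η = (y - F η) / d * u - bregman b F η u / d := by
  rw [hform, hform, bregman]; ring

/-- The basic inequality of penalized maximum likelihood, also for the directions shrunk by a factor
`s ≤ 1`: by convexity of the divergence and of the penalty. -/
lemma IsEstimate.basic_inequality {𝒴 : Set ℝ} {ℓ : ℝ → ℝ → ℝ} {b c F : ℝ → ℝ} {K d l : ℝ} {m n : ℕ}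
    (hL : IsLink b F K) (hform : ∀ y ∈ 𝒴, ∀ a, ℓ y a = (y * a - b a) / d + c y) (hd : 0 < d)
    (hm : 1 ≤ m) (hl : 0 ≤ l) {X : ℕ → L2I} {Y : ℕ → ℝ} (hY : ∀ i < n, Y i ∈ 𝒴)
    {θ θ' : ℝ × (ℝ → ℝ)} (hθ : IsEstimate ℓ m l n X Y θ) (hθ' : MemSobolev m θ'.2) {s : ℝ}
    (hs0 : 0 ≤ s) (hs1 : s ≤ 1) :
    avg n (fun i => bregman b F (linPred (X i) θ') (s * linPred (X i) (paramSub θ θ'))) / d +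
      s ^ 2 * (l * roughness m (paramSub θ θ').2 (paramSub θ θ').2) / 2 ≤
    |avg n (fun i => stdResidual F d θ' (X i, Y i) * (s * linPred (X i) (paramSub θ θ')))| +
      Real.sqrt (l * roughness m θ'.2 θ'.2) *
        Real.sqrt (s ^ 2 * (l * roughness m (paramSub θ θ').2 (paramSub θ θ').2)) := by
  have hθm : MemSobolev m θ.2 := hθ.1
  have hδ := memSobolev_paramSub hm hθm hθ'
  set δ := paramSub θ θ' with hδdef
  set Jδ := roughness m δ.2 δ.2 with hJδ
  have hJ0 : 0 ≤ Jδ := roughness_self_nonneg _ _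
  have hmax : penLogLik ℓ m l n X Y θ' ≤ penLogLik ℓ m l n X Y θ := hθ.2 hθ'
  have hdiff : avg n (fun i => ℓ (Y i) (linPred (X i) θ)) -
      avg n (fun i => ℓ (Y i) (linPred (X i) θ')) =
      avg n (fun i => stdResidual F d θ' (X i, Y i) * linPred (X i) δ) -
      avg n (fun i => bregman b F (linPred (X i) θ') (linPred (X i) δ)) / d := by
    rw [← avg_sub, div_eq_inv_mul, ← avg_mul_left, ← avg_sub]
    refine avg_congr fun i hi => ?_
    have h1 := loglik_sub_eq (F := F) (hform (Y i) (hY i hi)) (linPred (X i) θ')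
      (linPred (X i) δ)
    have h2 : linPred (X i) θ' + linPred (X i) δ = linPred (X i) θ := by
      rw [hδdef, linPred_paramSub hm hθm hθ']; ring
    rw [h2] at h1
    rw [h1, stdResidual, residual]
    ring
  have hbasic : avg n (fun i => bregman b F (linPred (X i) θ') (linPred (X i) δ)) / d +
      l * Jδ / 2 ≤ avg n (fun i => stdResidual F d θ' (X i, Y i) * linPred (X i) δ) -
        l * roughness m θ'.2 δ.2 := by
    have e : ∀ θ, penLogLik ℓ m l n X Y θ =
        avg n (fun i => ℓ (Y i) (linPred (X i) θ)) - l / 2 * roughness m θ.2 θ.2 := by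
      intro θ; simp only [penLogLik, avg, one_div]
    rw [e, e, roughness_eq_paramSub hm hθm hθ'] at hmax
    nlinarith
  have hD : avg n (fun i => bregman b F (linPred (X i) θ') (s * linPred (X i) δ)) / d ≤
      s * (avg n (fun i => bregman b F (linPred (X i) θ') (linPred (X i) δ)) / d) := by
    rw [← mul_div_assoc, ← avg_mul_left]
    exact div_le_div_of_nonneg_right (avg_mono fun i _ => hL.bregman_mul_le _ _ hs0 hs1) hd.le
  have hlin : avg n (fun i => stdResidual F d θ' (X i, Y i) * (s * linPred (X i) δ)) =
      s * avg n (fun i => stdResidual F d θ' (X i, Y i) * linPred (X i) δ) := by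
    rw [← avg_mul_left]; exact avg_congr fun i _ => by ring
  have hcross : -(s * (l * roughness m θ'.2 δ.2)) ≤
      Real.sqrt (l * roughness m θ'.2 θ'.2) * Real.sqrt (s ^ 2 * (l * Jδ)) := by
    have hJt : 0 ≤ roughness m θ'.2 θ'.2 := roughness_self_nonneg _ _
    rw [← Real.sqrt_mul (mul_nonneg hl hJt)]
    refine Real.le_sqrt_of_sq_le ?_
    have := roughness_sq_le hθ' hδ
    calc _ = s ^ 2 * l ^ 2 * roughness m θ'.2 δ.2 ^ 2 := by ring
      _ ≤ s ^ 2 * l ^ 2 * (roughness m θ'.2 θ'.2 * Jδ) := by gcongr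
      _ = _ := by ring
  have hs2 : s ^ 2 * (l * Jδ) / 2 ≤ s * (l * Jδ / 2) := by
    have : 0 ≤ l * Jδ := mul_nonneg hl hJ0
    nlinarith [mul_nonneg (mul_nonneg hs0 (sub_nonneg.2 hs1)) this]
  have := mul_le_mul_of_nonneg_left hbasic hs0
  have h3 := le_abs_self
    (avg n (fun i => stdResidual F d θ' (X i, Y i) * (s * linPred (X i) δ)))
  rw [hlin] at h3 ⊢
  linarith

lemma Expands.const_mul {𝒵 : Type*} {g : ℕ → 𝒵 → ℝ} {c : ℕ → ℝ} {u : 𝒵 → ℝ} (h : Expands g c u)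
    (s : ℝ) : Expands g (fun i => s * c i) (fun z => s * u z) := fun z => by
  simpa [mul_assoc] using (h z).mul_left s

lemma InEllipsoid.const_mul {w c : ℕ → ℝ} {R R' : ℝ} (h : InEllipsoid w c R) (s : ℝ)
    (hR : s ^ 2 * R ≤ R') : InEllipsoid w (fun i => s * c i) R' := fun N => by
  refine le_trans ?_ ((mul_le_mul_of_nonneg_left (h N) (sq_nonneg s)).trans hR)
  rw [Finset.mul_sum]
  exact Finset.sum_le_sum fun i _ => le_of_eq (by ring)

section

variable {Ω : Type*} [MeasurableSpace Ω] {P : Measure Ω} [IsProbabilityMeasure P]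
  {X : ℕ → Ω → L2I} {Y : ℕ → Ω → ℝ}

/-- Consistency in the divergence of the model. A localization to the unit ball of the penalized
norm reduces it to a uniform law of large numbers for the linear term, and the small ball estimate
excludes the boundary of the ball. -/
theorem eventually_avg_bregman_le {𝒴 : Set ℝ} {ℓ : ℝ → ℝ → ℝ} {b c₀ F : ℝ → ℝ} {K K' d : ℝ} {m : ℕ}
    (hL : IsLink b F K) (hform : ∀ y ∈ 𝒴, ∀ a, ℓ y a = (y * a - b a) / d + c₀ y) (hd : 0 < d)
    (hm : 1 ≤ m) (hZ : IsIID P fun i ω => (X i ω, Y i ω)) (hY : ∀ i, ∀ᵐ ω ∂P, Y i ω ∈ 𝒴)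
    {g : ℕ → L2I × ℝ → ℝ} (hg : IsFeatureSystem P (fun i ω => (X i ω, Y i ω)) g K')
    {w : ℕ → ℕ → ℝ} (hw : IsWeightSystem w) {lam : ℕ → ℝ} (hlam : ∀ n, 0 < lam n)
    (hlam0 : Tendsto lam atTop (𝓝 0))
    {c : ℝ × (ℝ → ℝ) → ℕ → ℝ} {Q : ℝ × (ℝ → ℝ) → ℝ} (hQ : ∀ θ, 0 ≤ Q θ)
    (hexp : ∀ θ, MemSobolev m θ.2 → Expands g (c θ) fun z => linPred z.1 θ)
    (hell : ∀ n θ, MemSobolev m θ.2 → InEllipsoid (w n) (c θ) (Q θ + lam n * roughness m θ.2 θ.2))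
    (hlow : ∀ θ, MemSobolev m θ.2 → ∀ r < Q θ, ∃ N, r ≤ ∑ i ∈ Finset.range N, c θ i ^ 2)
    {θt : ℝ × (ℝ → ℝ)} (hθt : MemSobolev m θt.2)
    (he : Measurable (stdResidual F d θt))
    (he2 : MemLp (fun ω => stdResidual F d θt (X 0 ω, Y 0 ω)) 2 P)
    (hfoc : ∀ i, ∫ ω, stdResidual F d θt (X 0 ω, Y 0 ω) * g i (X 0 ω, Y 0 ω) ∂P = 0)
    (hη : Measurable fun z : L2I × ℝ => linPred z.1 θt)
    {θhat : ℕ → Ω → ℝ × (ℝ → ℝ)}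
    (hest : ∀ᶠ q : ℕ × Ω in probFilter P, IsEstimate ℓ m (lam q.1) q.1 (fun i => X i q.2)
      (fun i => Y i q.2) (θhat q.1 q.2)) {ε : ℝ} (hε : 0 < ε) :
    ∀ᶠ q : ℕ × Ω in probFilter P, avg q.1 (fun i => bregman b F (linPred (X i q.2) θt)
      (linPred (X i q.2) (θhat q.1 q.2) - linPred (X i q.2) θt)) ≤ ε := by
  obtain ⟨M, hM, κ, hκ, hball⟩ := hg.eventually_le_avg_min hZ hw hη
  obtain ⟨c₁, hc₁, hD⟩ := hL.exists_mul_le_bregman M (half_pos hκ)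
  set τ : ℝ := min (1 / 16) (min (c₁ * κ / (8 * d)) (ε / (2 * d))) with hτdef
  have hτ : 0 < τ := by
    refine lt_min (by norm_num) (lt_min ?_ ?_) <;> positivity
  have hτ1 : τ ≤ 1 / 16 := min_le_left _ _
  have hτ2 : τ * (8 * d) ≤ c₁ * κ := by
    rw [← le_div_iff₀ (by positivity)]; exact (min_le_right _ _).trans (min_le_left _ _)
  have hτ3 : τ * (2 * d) ≤ ε := by
    rw [← le_div_iff₀ (by positivity)]; exact (min_le_right _ _).trans (min_le_right _ _)
  have hpen : ∀ᶠ q : ℕ × Ω in probFilter P, Real.sqrt (lam q.1 * roughness m θt.2 θt.2) < τ := by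
    have h1 : Tendsto (fun n => Real.sqrt (lam n * roughness m θt.2 θt.2)) atTop (𝓝 0) := by
      simpa using (hlam0.mul_const (roughness m θt.2 θt.2)).sqrt
    exact tendsto_fst_probFilter.eventually (h1.eventually_lt_const hτ)
  have hYall : ∀ᶠ q : ℕ × Ω in probFilter P, ∀ i, Y i q.2 ∈ 𝒴 :=
    eventually_probFilter_of_ae fun _ => ae_all_iff.2 hY
  have hpos : ∀ᶠ q : ℕ × Ω in probFilter P, q.1 ≠ 0 :=
    tendsto_fst_probFilter.eventually (eventually_ne_atTop 0)
  filter_upwards [hball, hg.eventually_abs_avg_mul_le hZ hw he he2 hfoc hτ, hpen, hYall, hest, hpos]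
    with q hq1 hq2 hq3 hq4 hq5 hn
  obtain ⟨n, ω⟩ := q
  simp only at hq1 hq2 hq3 hq4 hq5 hn ⊢
  set θ := θhat n ω with hθ
  have hθm : MemSobolev m θ.2 := hq5.1
  have hδ := memSobolev_paramSub hm hθm hθt
  set δ := paramSub θ θt with hδdef
  set J := roughness m δ.2 δ.2 with hJ
  have hJ0 : 0 ≤ J := roughness_self_nonneg _ _
  have hlJ : 0 ≤ lam n * J := mul_nonneg (hlam n).le hJ0
  -- the consequence of the basic inequality for a direction in the unit ball
  have key : ∀ s, 0 ≤ s → s ≤ 1 → s ^ 2 * (Q δ + lam n * J) ≤ 1 →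
      avg n (fun i => bregman b F (linPred (X i ω) θt) (s * linPred (X i ω) δ)) / d +
        s ^ 2 * (lam n * J) / 2 ≤ 2 * τ := by
    intro s hs0 hs1 hs2
    have h1 := hq5.basic_inequality hL hform hd hm (hlam n).le (fun i _ => hq4 i) hθt hs0 hs1
    have h2 := hq2 _ _ ((hexp δ hδ).const_mul s) ((hell n δ hδ).const_mul s hs2)
    have h3 : Real.sqrt (s ^ 2 * (lam n * J)) ≤ 1 := by
      have := mul_nonneg (sq_nonneg s) (hQ δ)
      exact Real.sqrt_le_iff.2 ⟨zero_le_one, by linarith⟩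
    have h4 : Real.sqrt (lam n * roughness m θt.2 θt.2) * Real.sqrt (s ^ 2 * (lam n * J)) ≤
        τ * 1 := by gcongr
    linarith
  have hbnn : ∀ s, 0 ≤ avg n (fun i => bregman b F (linPred (X i ω) θt)
      (s * linPred (X i ω) δ)) / d := fun s =>
    div_nonneg (avg_nonneg fun i _ => hL.bregman_nonneg _ _) hd.le
  have hinside : Q δ + lam n * J ≤ 1 := by
    by_contra! hN
    set N := Q δ + lam n * J with hNdef
    have hN0 : 0 < N := one_pos.trans hN
    have hs2 : (Real.sqrt N)⁻¹ ^ 2 * N = 1 := by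
      rw [inv_pow, Real.sq_sqrt hN0.le, inv_mul_cancel₀ hN0.ne']
    have hs1 : (Real.sqrt N)⁻¹ ≤ 1 := inv_le_one_of_one_le₀ (Real.one_le_sqrt.2 hN.le)
    have hs0 : 0 ≤ (Real.sqrt N)⁻¹ := by positivity
    set s := (Real.sqrt N)⁻¹
    have h1 := key s hs0 hs1 hs2.le
    rcases le_or_gt (1 / 2) (s ^ 2 * (lam n * J)) with h2 | h2
    · have := hbnn s
      linarith
    · have h3 : 1 / 4 < s ^ 2 * Q δ := by rw [hNdef] at hs2; linarith
      have hs : 0 < s ^ 2 := by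
        have : 0 < s := inv_pos.2 (Real.sqrt_pos.2 hN0)
        positivity
      obtain ⟨L, hLq⟩ := hlow δ hδ (1 / 4 / s ^ 2) (by rw [div_lt_iff₀ hs]; linarith)
      have h4 := hq1 _ _ ((hexp δ hδ).const_mul s) ((hell n δ hδ).const_mul s hs2.le)
        ⟨L, by
          rw [div_le_iff₀ hs] at hLq
          refine hLq.trans_eq ?_
          rw [Finset.sum_mul]
          exact Finset.sum_congr rfl fun i _ => by ring⟩
      have h5 : c₁ * (κ - κ / 2) ≤ avg n (fun i => bregman b F (linPred (X i ω) θt)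
          (s * linPred (X i ω) δ)) := by
        refine (mul_le_mul_of_nonneg_left (sub_le_sub_right h4 (κ / 2)) hc₁.le).trans ?_
        rw [← avg_const hn (κ / 2), ← avg_sub, ← avg_mul_left]
        refine avg_mono fun i _ => ?_
        by_cases h6 : |linPred (X i ω) θt| ≤ M
        · simpa [indicator, h6] using hD (linPred (X i ω) θt) (s * linPred (X i ω) δ) h6
        · have : 0 ≤ bregman b F (linPred (X i ω) θt) (s * linPred (X i ω) δ) :=
            hL.bregman_nonneg _ _
          have h7 : c₁ * (0 - κ / 2) ≤ 0 := mul_nonpos_of_nonneg_of_nonpos hc₁.le (by linarith)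
          simpa [indicator, h6] using h7.trans this
      have h8 : avg n (fun i => bregman b F (linPred (X i ω) θt)
          (s * linPred (X i ω) δ)) / d ≤ 2 * τ := by
        have := mul_nonneg hs.le hlJ
        linarith
      rw [div_le_iff₀ hd] at h8
      nlinarith [mul_pos hc₁ hκ]
  have h1 := key 1 zero_le_one le_rfl (by simpa using hinside)
  simp only [one_mul] at h1
  have h2 : avg n (fun i => bregman b F (linPred (X i ω) θt) (linPred (X i ω) δ)) / d ≤ 2 * τ := by
    linarith
  rw [div_le_iff₀ hd] at h2
  simp_rw [hδdef, linPred_paramSub hm hθm hθt] at h2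
  linarith

end

/-! ### The first-order condition at the pseudo-true parameter -/

lemma linPred_add_mul {m : ℕ} (hm : 1 ≤ m) {θ δ : ℝ × (ℝ → ℝ)} (h : MemSobolev m θ.2)
    (hδ : MemSobolev m δ.2) (s : ℝ) (x : L2I) :
    linPred x (θ.1 + s * δ.1, fun t => θ.2 t + s * δ.2 t) = linPred x θ + s * linPred x δ := by
  have e : ∀ θ : ℝ × (ℝ → ℝ), MemSobolev m θ.2 → linPred x θ = θ.1 + inner ℝ x (curve θ.2) :=
    fun θ hθ => linPred_curve (hθ.memLp hm) x θ.1
  rw [e (_, _) (h.add_mul hm hδ s), e _ h, e _ hδ]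
  simp only []
  rw [curve_add_mul (h.memLp hm) (hδ.memLp hm), inner_add_right, real_inner_smul_right]
  ring

lemma measurable_linPred {m : ℕ} (hm : 1 ≤ m) {θ : ℝ × (ℝ → ℝ)} (h : MemSobolev m θ.2) :
    Measurable fun x : L2I => linPred x θ := by
  have e : (fun x : L2I => linPred x θ) = fun x => θ.1 + inner ℝ x (curve θ.2) :=
    funext fun x => linPred_curve (h.memLp hm) x θ.1
  rw [e]
  exact (measurable_id.inner measurable_const).const_add _

lemma memLp_linPred {Ω : Type*} [MeasurableSpace Ω] {P : Measure Ω} [IsProbabilityMeasure P]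
    {X : Ω → L2I} (hX : MemLp X 2 P) {m : ℕ} (hm : 1 ≤ m) {θ : ℝ × (ℝ → ℝ)}
    (h : MemSobolev m θ.2) : MemLp (fun ω => linPred (X ω) θ) 2 P := by
  have e : (fun ω => linPred (X ω) θ) = fun ω => θ.1 + inner ℝ (X ω) (curve θ.2) :=
    funext fun ω => linPred_curve (h.memLp hm) (X ω) θ.1
  rw [e]
  have h1 : MemLp (fun ω => inner ℝ (X ω) (curve θ.2)) 2 P := hX.inner_const _
  exact MemLp.add (memLp_const θ.1) h1

lemma measurable_stdResidual {b F : ℝ → ℝ} {K : ℝ} (hL : IsLink b F K) (d : ℝ) {m : ℕ}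
    (hm : 1 ≤ m) {θ : ℝ × (ℝ → ℝ)} (h : MemSobolev m θ.2) : Measurable (stdResidual F d θ) :=
  (measurable_snd.sub (hL.continuous.measurable.comp
    ((measurable_linPred hm h).comp measurable_fst))).div_const d

/-- A linear function dominated by a quadratic one vanishes. -/
lemma eq_zero_of_forall_mul_le_sq_mul {A B : ℝ} (hB : 0 ≤ B) (h : ∀ s : ℝ, s * A ≤ s ^ 2 * B) :
    A = 0 := by
  have h1 := h (A / (2 * (B + 1)))
  have h2 : A / (2 * (B + 1)) * A = A ^ 2 / (2 * (B + 1)) := by ring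
  have h3 : (A / (2 * (B + 1))) ^ 2 * B = A ^ 2 / (2 * (B + 1)) * (B / (2 * (B + 1))) := by
    field_simp
  rw [h2, h3] at h1
  have h4 : B / (2 * (B + 1)) ≤ 1 / 2 := by
    rw [div_le_div_iff₀ (by positivity) (by norm_num)]; linarith
  have h5 : 0 ≤ A ^ 2 / (2 * (B + 1)) := by positivity
  have h6 : A ^ 2 / (2 * (B + 1)) = 0 := by nlinarith
  have h7 : (2 * (B + 1)) ≠ 0 := by positivity
  rw [div_eq_zero_iff] at h6
  simpa [h7] using h6

section

variable {Ω : Type*} [MeasurableSpace Ω] {P : Measure Ω} [IsProbabilityMeasure P]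

/-- The residual at the pseudo-true parameter is orthogonal to all linear predictors. -/
lemma IsPseudoTrue.integral_stdResidual_mul {𝒴 : Set ℝ} {ℓ : ℝ → ℝ → ℝ} {b c F : ℝ → ℝ} {K d : ℝ}
    {m : ℕ} {X : Ω → L2I} {Y : Ω → ℝ} (hL : IsLink b F K)
    (hform : ∀ y ∈ 𝒴, ∀ a, ℓ y a = (y * a - b a) / d + c y) (hd : 0 < d) (hm : 1 ≤ m)
    (hX : MemLp X 2 P) (hY : ∀ᵐ ω ∂P, Y ω ∈ 𝒴) {θ : ℝ × (ℝ → ℝ)}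
    (hθ : IsPseudoTrue P m ℓ X Y θ)
    (he2 : MemLp (fun ω => stdResidual F d θ (X ω, Y ω)) 2 P) {δ : ℝ × (ℝ → ℝ)}
    (hδ : MemSobolev m δ.2) :
    ∫ ω, stdResidual F d θ (X ω, Y ω) * linPred (X ω) δ ∂P = 0 := by
  have hθm : MemSobolev m θ.2 := hθ.1
  have hv := memLp_linPred hX hm hδ
  have hK := hL.pos
  have hev : Integrable (fun ω => stdResidual F d θ (X ω, Y ω) * linPred (X ω) δ) P :=
    he2.integrable_mul hv
  -- compare the expected log-likelihood at `θ` with its value at `θ + s δ`, for small `s`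
  refine eq_zero_of_forall_mul_le_sq_mul
    (B := K / d * ∫ ω, linPred (X ω) δ ^ 2 ∂P)
    (mul_nonneg (by positivity) (integral_nonneg fun _ => sq_nonneg _)) fun s => ?_
  have hmem : (θ.1 + s * δ.1, fun t => θ.2 t + s * δ.2 t) ∈ paramSpace m :=
    hθm.add_mul hm hδ s
  have hmax : ∫ ω, ℓ (Y ω) (linPred (X ω) (θ.1 + s * δ.1, fun t => θ.2 t + s * δ.2 t)) ∂P ≤
      ∫ ω, ℓ (Y ω) (linPred (X ω) θ) ∂P := hθ.2.2 hmem
  rw [← sub_nonpos, ← integral_sub (hθ.2.1 _ hmem) (hθ.2.1 _ hθ.1)] at hmax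
  have hlow : ∫ ω, (s * (stdResidual F d θ (X ω, Y ω) * linPred (X ω) δ) -
      s ^ 2 * (K / d * linPred (X ω) δ ^ 2)) ∂P ≤ 0 := by
    refine le_trans (integral_mono_ae ((hev.const_mul s).sub
      ((hv.integrable_sq.const_mul _).const_mul _))
      ((hθ.2.1 _ hmem).sub (hθ.2.1 _ hθ.1)) ?_) hmax
    filter_upwards [hY] with ω hω
    rw [Pi.sub_apply, linPred_add_mul hm hθm hδ, loglik_sub_eq (F := F) (hform _ hω)]
    have h1 := hL.bregman_le (linPred (X ω) θ) (s * linPred (X ω) δ)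
    have h2 : bregman b F (linPred (X ω) θ) (s * linPred (X ω) δ) / d ≤
        s ^ 2 * (K / d * linPred (X ω) δ ^ 2) := by
      rw [div_le_iff₀ hd]
      refine h1.trans_eq ?_
      field_simp
    have h3 : stdResidual F d θ (X ω, Y ω) = (Y ω - F (linPred (X ω) θ)) / d := rfl
    rw [h3]
    nlinarith
  rw [integral_sub (hev.const_mul s) ((hv.integrable_sq.const_mul _).const_mul _),
    integral_const_mul, integral_const_mul, integral_const_mul] at hlow
  linarith

/-- The residuals at any two parameters differ by a square integrable function. -/
lemma memLp_stdResidual_of_memLp {b F : ℝ → ℝ} {K d : ℝ} {m : ℕ} {X : Ω → L2I} {Y : Ω → ℝ}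
    (hL : IsLink b F K) (hd : 0 < d) (hm : 1 ≤ m) (hX : MemLp X 2 P) (hXm : Measurable X)
    (hYm : Measurable Y) {θ θ' : ℝ × (ℝ → ℝ)} (hθ : MemSobolev m θ.2) (hθ' : MemSobolev m θ'.2)
    (h : MemLp (fun ω => stdResidual F d θ (X ω, Y ω)) 2 P) :
    MemLp (fun ω => stdResidual F d θ' (X ω, Y ω)) 2 P := by
  have hK := hL.pos
  have hdiff : MemLp (fun ω =>
      stdResidual F d θ' (X ω, Y ω) - stdResidual F d θ (X ω, Y ω)) 2 P := by
    refine (((memLp_linPred hX hm hθ).sub (memLp_linPred hX hm hθ')).const_mul (K / d)).mono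
      (((measurable_stdResidual hL d hm hθ').comp (hXm.prodMk hYm)).sub
      ((measurable_stdResidual hL d hm hθ).comp (hXm.prodMk hYm))).aestronglyMeasurable
      (Eventually.of_forall fun ω => ?_)
    have e : stdResidual F d θ' (X ω, Y ω) - stdResidual F d θ (X ω, Y ω) =
        (F (linPred (X ω) θ) - F (linPred (X ω) θ')) / d := by
      simp only [stdResidual, residual]; ring
    simp only [Pi.sub_apply]
    rw [e, norm_div, norm_mul, norm_div, Real.norm_of_nonneg hd.le, Real.norm_of_nonneg hK.le,
      div_mul_eq_mul_div]
    exact div_le_div_of_nonneg_right (hL.lipschitz _ _) hd.le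
  have e : (fun ω => stdResidual F d θ' (X ω, Y ω)) = fun ω =>
      (stdResidual F d θ' (X ω, Y ω) - stdResidual F d θ (X ω, Y ω)) +
        stdResidual F d θ (X ω, Y ω) := by
    funext ω
    ring
  rw [e]
  exact hdiff.add h

end

/-! ### Replacing the residuals and the angles in the statistic -/

/-- The change of the statistic caused by new factors `f'` and new angles `A'`. The angles change in
the mean, hence in mean square as they are bounded. -/
lemma abs_tripleAvg_sub_le {n : ℕ} (hn : 3 ≤ n) (f f' : ℕ → ℝ) {A A' : ℕ → ℕ → ℕ → ℝ}
    (hA : ∀ i j k, 0 ≤ A i j k ∧ A i j k ≤ Real.pi)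
    (hA' : ∀ i j k, 0 ≤ A' i j k ∧ A' i j k ≤ Real.pi) :
    |tripleAvg n (fun i j k => f' i * f' j * A' i j k) -
      tripleAvg n (fun i j k => f i * f j * A i j k)| ≤
    5 * Real.pi * (2 * avg n (fun i => |f' i - f i|) * avg n (fun i => |f i|) +
      avg n (fun i => |f' i - f i|) ^ 2) +
    Real.sqrt (5 * avg n (fun i => f i ^ 2) ^ 2 *
      (Real.pi * tripleAvg n (fun i j k => |A' i j k - A i j k|))) := by
  have hn0 : n ≠ 0 := by omega
  have hπ := Real.pi_pos
  have hsplit : tripleAvg n (fun i j k => f' i * f' j * A' i j k) -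
      tripleAvg n (fun i j k => f i * f j * A i j k) =
      tripleAvg n (fun i j k => (f' i * f' j - f i * f j) * A' i j k) +
      tripleAvg n (fun i j k => f i * f j * (A' i j k - A i j k)) := by
    rw [← tripleAvg_sub, ← tripleAvg_add]
    congr 1
    funext i j k
    ring
  -- averages of products that do not depend on the third index
  have havg : ∀ u v : ℕ → ℝ, (avg n fun i => avg n fun j => avg n fun _ => u i * v j) =
      avg n u * avg n v := by
    intro u v
    simp only [avg_const hn0, avg_mul_left]
    rw [mul_comm, ← avg_mul_left]
    exact avg_congr fun i _ => mul_comm _ _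
  have h1 : |tripleAvg n (fun i j k => (f' i * f' j - f i * f j) * A' i j k)| ≤
      5 * Real.pi * (2 * avg n (fun i => |f' i - f i|) * avg n (fun i => |f i|) +
        avg n (fun i => |f' i - f i|) ^ 2) := by
    calc _ ≤ tripleAvg n (fun i j k => |(f' i * f' j - f i * f j) * A' i j k|) :=
          abs_tripleAvg_le hn _
      _ ≤ tripleAvg n (fun i j _ => Real.pi * (|f' i - f i| * |f j|) +
            (Real.pi * (|f i| * |f' j - f j|) + Real.pi * (|f' i - f i| * |f' j - f j|))) := by
          refine tripleAvg_mono hn fun i _ j _ k _ => ?_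
          have e : f' i * f' j - f i * f j = (f' i - f i) * f j +
              (f i * (f' j - f j) + (f' i - f i) * (f' j - f j)) := by ring
          have e2 : |f' i * f' j - f i * f j| ≤ |f' i - f i| * |f j| +
              (|f i| * |f' j - f j| + |f' i - f i| * |f' j - f j|) := by
            rw [e, ← abs_mul, ← abs_mul, ← abs_mul]
            exact (abs_add_le _ _).trans (add_le_add_right (abs_add_le _ _) _)
          rw [abs_mul, abs_of_nonneg (hA' i j k).1, ← mul_add, ← mul_add, mul_comm]
          exact mul_le_mul (hA' i j k).2 e2 (abs_nonneg _) hπ.le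
      _ ≤ 5 * (Real.pi * (avg n (fun i => |f' i - f i|) * avg n (fun i => |f i|))) +
          (5 * (Real.pi * (avg n (fun i => |f i|) * avg n (fun i => |f' i - f i|))) +
          5 * (Real.pi * (avg n (fun i => |f' i - f i|) * avg n (fun i => |f' i - f i|)))) := by
          have hb : ∀ u v : ℕ → ℝ, (∀ i, 0 ≤ u i) → (∀ i, 0 ≤ v i) →
              tripleAvg n (fun i j _ => Real.pi * (u i * v j)) ≤
              5 * (Real.pi * (avg n u * avg n v)) := by
            intro u v hu hv
            rw [tripleAvg_mul_left, mul_left_comm]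
            refine mul_le_mul_of_nonneg_left ((tripleAvg_le hn fun i j k =>
              mul_nonneg (hu i) (hv j)).trans_eq ?_) hπ.le
            rw [havg]
          rw [tripleAvg_add, tripleAvg_add]
          exact add_le_add (hb _ _ (fun _ => abs_nonneg _) fun _ => abs_nonneg _)
            (add_le_add (hb _ _ (fun _ => abs_nonneg _) fun _ => abs_nonneg _)
              (hb _ _ (fun _ => abs_nonneg _) fun _ => abs_nonneg _))
      _ = _ := by ring
  have h2 : |tripleAvg n (fun i j k => f i * f j * (A' i j k - A i j k))| ≤
      Real.sqrt (5 * avg n (fun i => f i ^ 2) ^ 2 *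
        (Real.pi * tripleAvg n (fun i j k => |A' i j k - A i j k|))) := by
    refine Real.abs_le_sqrt ((tripleAvg_mul_sq_le hn (fun i j _ => f i * f j) _).trans ?_)
    have h3 : tripleAvg n (fun i j _ => (f i * f j) ^ 2) ≤ 5 * avg n (fun i => f i ^ 2) ^ 2 := by
      refine (tripleAvg_le hn fun _ _ _ => sq_nonneg _).trans_eq ?_
      simp_rw [mul_pow]
      rw [havg, sq]
    have h4 : tripleAvg n (fun i j k => (A' i j k - A i j k) ^ 2) ≤
        Real.pi * tripleAvg n (fun i j k => |A' i j k - A i j k|) := by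
      rw [← tripleAvg_mul_left]
      refine tripleAvg_mono hn fun i _ j _ k _ => ?_
      rw [← sq_abs, sq]
      refine mul_le_mul_of_nonneg_right ?_ (abs_nonneg _)
      rw [abs_le]
      constructor <;> linarith [(hA i j k).1, (hA i j k).2, (hA' i j k).1, (hA' i j k).2]
    exact mul_le_mul h3 h4 (tripleAvg_nonneg hn fun _ _ _ => sq_nonneg _) (by positivity)
  rw [hsplit]
  exact (abs_add_le _ _).trans (add_le_add h1 h2)

/-- Mean square convergence of the factors and convergence of the angles in mean suffice to replace
them in the statistic. -/
lemma tendsto_tripleAvg_sub {ι : Type*} {l : Filter ι} {n : ι → ℕ} (hn : Tendsto n l atTop)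
    {f f' : ι → ℕ → ℝ} {A A' : ι → ℕ → ℕ → ℕ → ℝ}
    (hA : ∀ q i j k, 0 ≤ A q i j k ∧ A q i j k ≤ Real.pi)
    (hA' : ∀ q i j k, 0 ≤ A' q i j k ∧ A' q i j k ≤ Real.pi) {v : ℝ}
    (hf : Tendsto (fun q => avg (n q) (fun i => f q i ^ 2)) l (𝓝 v))
    (hff : Tendsto (fun q => avg (n q) (fun i => (f' q i - f q i) ^ 2)) l (𝓝 0))
    (hAA : Tendsto (fun q => tripleAvg (n q) (fun i j k => |A' q i j k - A q i j k|)) l (𝓝 0)) :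
    Tendsto (fun q => tripleAvg (n q) (fun i j k => f' q i * f' q j * A' q i j k) -
      tripleAvg (n q) (fun i j k => f q i * f q j * A q i j k)) l (𝓝 0) := by
  have habs : ∀ q (u : ℕ → ℝ), avg (n q) (fun i => |u i|) ≤
      Real.sqrt (avg (n q) (fun i => u i ^ 2)) := by
    intro q u
    refine Real.le_sqrt_of_sq_le ((avg_sq_le _ _).trans_eq ?_)
    simp only [sq_abs]
  have hbound : Tendsto (fun q => 5 * Real.pi * (2 *
      Real.sqrt (avg (n q) (fun i => (f' q i - f q i) ^ 2)) *
      Real.sqrt (avg (n q) (fun i => f q i ^ 2)) +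
      Real.sqrt (avg (n q) (fun i => (f' q i - f q i) ^ 2)) ^ 2) +
      Real.sqrt (5 * avg (n q) (fun i => f q i ^ 2) ^ 2 *
        (Real.pi * tripleAvg (n q) (fun i j k => |A' q i j k - A q i j k|)))) l (𝓝 0) := by
    have := ((((hff.sqrt.const_mul 2).mul hf.sqrt).add (hff.sqrt.pow 2)).const_mul
      (5 * Real.pi)).add (((hf.pow 2).const_mul 5).mul (hAA.const_mul Real.pi)).sqrt
    simpa using this
  refine squeeze_zero_norm' ?_ hbound
  filter_upwards [hn.eventually_ge_atTop 3] with q hq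
  refine (abs_tripleAvg_sub_le hq (f q) (f' q) (hA q) (hA' q)).trans ?_
  have := habs q (fun i => f' q i - f q i)
  have := habs q (f q)
  have : 0 ≤ avg (n q) (fun i => |f' q i - f q i|) := avg_nonneg fun _ _ => abs_nonneg _
  have : 0 ≤ avg (n q) (fun i => |f q i|) := avg_nonneg fun _ _ => abs_nonneg _
  have := Real.pi_pos
  gcongr

/-! ### The limit of the statistic -/

lemma testStat_eq_tripleAvg (F : ℝ → ℝ) (n : ℕ) {p : ℕ} (X : ℕ → L2I) (Y : ℕ → ℝ)
    (θ : ℝ × (ℝ → ℝ)) (ψ : Fin p → L2I) :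
    testStat F n X Y θ ψ = tripleAvg n (fun i j k =>
      residual F θ (X i) (Y i) * residual F θ (X j) (Y j) * InnerProductGeometry.angle
        (fpcScores ψ (X i) - fpcScores ψ (X k)) (fpcScores ψ (X k) - fpcScores ψ (X j))) := by
  rw [tripleAvg, testStat, sum_distinctTriples n (fun i j k =>
      residual F θ (X i) (Y i) * residual F θ (X j) (Y j) * InnerProductGeometry.angle
        (fpcScores ψ (X i) - fpcScores ψ (X k)) (fpcScores ψ (X k) - fpcScores ψ (X j)))]

/-- Products of two independent factors with a bounded third one are square integrable. -/
lemma memLp_mul_mul_of_bounded {Ω : Type*} [MeasurableSpace Ω] {P : Measure Ω} {f g A : Ω → ℝ}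
    (hf : MemLp f 2 P) (hg : MemLp g 2 P)
    (hfg : IndepFun f g P) (hA : Measurable A) {c : ℝ} (hc : ∀ ω, |A ω| ≤ c) :
    MemLp (fun ω => f ω * g ω * A ω) 2 P := by
  have h1 : MemLp (fun ω => f ω * g ω) 2 P := by
    refine (memLp_two_iff_integrable_sq (hf.1.mul hg.1)).2 ?_
    have h2 : IndepFun (fun ω => f ω ^ 2) (fun ω => g ω ^ 2) P :=
      hfg.comp (measurable_id.pow_const 2) (measurable_id.pow_const 2)
    have h3 := h2.integrable_mul hf.integrable_sq hg.integrable_sq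
    refine h3.congr (Eventually.of_forall fun ω => ?_)
    simp only [Pi.mul_apply, mul_pow]
  refine (h1.const_mul c).mono (h1.1.mul hA.aestronglyMeasurable)
    (Eventually.of_forall fun ω => ?_)
  rw [norm_mul, norm_mul c, mul_comm]
  exact mul_le_mul_of_nonneg_right ((hc ω).trans (le_abs_self c)) (norm_nonneg _)

lemma abs_angle_le_pi {H : Type*} [NormedAddCommGroup H] [InnerProductSpace ℝ H] (u v : H) :
    |InnerProductGeometry.angle u v| ≤ Real.pi := by
  rw [abs_of_nonneg (InnerProductGeometry.angle_nonneg _ _)]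
  exact InnerProductGeometry.angle_le_pi _ _

section

variable {Ω : Type*} [MeasurableSpace Ω] {P : Measure Ω} [IsProbabilityMeasure P]

/-- Consistency of the fitted means yields the limit of the statistic. -/
lemma tendsto_testStat {b F : ℝ → ℝ} {K d : ℝ} {m : ℕ} {X : ℕ → Ω → L2I} {Y : ℕ → Ω → ℝ}
    (hL : IsLink b F K) (hd : 0 < d) (hm : 1 ≤ m) (hZ : IsIID P fun i ω => (X i ω, Y i ω))
    (hX2 : MemLp (X 0) 2 P) {θ : ℝ × (ℝ → ℝ)} (hθ : MemSobolev m θ.2)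
    (he2 : MemLp (fun ω => stdResidual F d θ (X 0 ω, Y 0 ω)) 2 P)
    {p : ℕ → ℕ} (hp : Tendsto p atTop atTop) {ψ : (n : ℕ) → Ω → Fin (p n) → L2I}
    (hψ : ∀ n, ∀ᵐ ω ∂P, IsEstimatedFPC n (p n) (fun i => X i ω) (ψ n ω))
    {θhat : ℕ → Ω → ℝ × (ℝ → ℝ)}
    (hbreg : ∀ ε > 0, ∀ᶠ q : ℕ × Ω in probFilter P, avg q.1 (fun i =>
      bregman b F (linPred (X i q.2) θ)
        (linPred (X i q.2) (θhat q.1 q.2) - linPred (X i q.2) θ)) ≤ ε) :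
    Tendsto (fun q : ℕ × Ω => testStat F q.1 (fun i => X i q.2) (fun i => Y i q.2)
      (θhat q.1 q.2) (ψ q.1 q.2)) (probFilter P)
      (𝓝 (d ^ 2 * ∫ ω, stdResidual F d θ (X 0 ω, Y 0 ω) * stdResidual F d θ (X 1 ω, Y 1 ω) *
        InnerProductGeometry.angle (X 0 ω - X 2 ω) (X 2 ω - X 1 ω) ∂P)) := by
  have hK := hL.pos
  have hXi : IsIID P X := hZ.comp measurable_fst
  set e : L2I × ℝ → ℝ := stdResidual F d θ with he
  have hem : Measurable e := measurable_stdResidual hL d hm hθ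
  have hres : ∀ x y, residual F θ x y = d * e (x, y) := fun x y => by
    rw [he, stdResidual, mul_div_cancel₀ _ hd.ne']
  -- the mean squared change of the residuals
  have hΔ : Tendsto (fun q : ℕ × Ω => avg q.1 (fun i =>
      (residual F (θhat q.1 q.2) (X i q.2) (Y i q.2) - d * e (X i q.2, Y i q.2)) ^ 2))
      (probFilter P) (𝓝 0) := by
    rw [Metric.tendsto_nhds]
    intro ε hε
    filter_upwards [hbreg (ε / (8 * K)) (by positivity)] with q hq
    have h0 : 0 ≤ avg q.1 (fun i =>
        (residual F (θhat q.1 q.2) (X i q.2) (Y i q.2) - d * e (X i q.2, Y i q.2)) ^ 2) :=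
      avg_nonneg fun _ _ => sq_nonneg _
    rw [Real.dist_eq, sub_zero, abs_of_nonneg h0]
    have h1 : avg q.1 (fun i =>
        (residual F (θhat q.1 q.2) (X i q.2) (Y i q.2) - d * e (X i q.2, Y i q.2)) ^ 2) ≤
        4 * K * avg q.1 (fun i => bregman b F (linPred (X i q.2) θ)
          (linPred (X i q.2) (θhat q.1 q.2) - linPred (X i q.2) θ)) := by
      rw [← avg_mul_left]
      refine avg_mono fun i _ => ?_
      have h2 := hL.sq_sub_le_bregman (linPred (X i q.2) θ)
        (linPred (X i q.2) (θhat q.1 q.2) - linPred (X i q.2) θ)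
      rw [add_sub_cancel] at h2
      refine le_trans (le_of_eq ?_) h2
      rw [← hres]
      simp only [residual]
      ring
    have h3 : 4 * K * (ε / (8 * K)) = ε / 2 := by field_simp; norm_num
    have h4 := mul_le_mul_of_nonneg_left hq (by positivity : 0 ≤ 4 * K)
    linarith
  have hsq : Tendsto (fun q : ℕ × Ω => avg q.1 (fun i => (d * e (X i q.2, Y i q.2)) ^ 2))
      (probFilter P) (𝓝 (∫ ω, (d * e (X 0 ω, Y 0 ω)) ^ 2 ∂P)) :=
    hZ.tendsto_avg (f := fun z => (d * e z) ^ 2) ((hem.const_mul d).pow_const 2)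
      (he2.const_mul d).integrable_sq
  have hang := tendsto_tripleAvg_angle hXi hX2 hp hψ
  have hsub := tendsto_tripleAvg_sub (n := Prod.fst) tendsto_fst_probFilter
    (fun (q : ℕ × Ω) i j k => ⟨InnerProductGeometry.angle_nonneg (X i q.2 - X k q.2)
      (X k q.2 - X j q.2), InnerProductGeometry.angle_le_pi _ _⟩)
    (fun (q : ℕ × Ω) i j k => ⟨InnerProductGeometry.angle_nonneg
      (fpcScores (ψ q.1 q.2) (X i q.2) - fpcScores (ψ q.1 q.2) (X k q.2))
      (fpcScores (ψ q.1 q.2) (X k q.2) - fpcScores (ψ q.1 q.2) (X j q.2)),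
      InnerProductGeometry.angle_le_pi _ _⟩) hsq hΔ hang
  have hGm : Measurable fun z : (L2I × ℝ) × (L2I × ℝ) × (L2I × ℝ) =>
      InnerProductGeometry.angle (z.1.1 - z.2.2.1) (z.2.2.1 - z.2.1.1) :=
    measurable_angle (measurable_fst.fst.sub measurable_snd.snd.fst)
      (measurable_snd.snd.fst.sub measurable_snd.fst.fst)
  have hlim := hZ.tendsto_tripleAvg
    (G := fun z => (d * e z.1) * (d * e z.2.1) *
      InnerProductGeometry.angle (z.1.1 - z.2.2.1) (z.2.2.1 - z.2.1.1))
    ((((hem.comp measurable_fst).const_mul d).mul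
      ((hem.comp measurable_snd.fst).const_mul d)).mul hGm)
    (memLp_mul_mul_of_bounded (he2.const_mul d) ((hZ.memLp hem he2 1).const_mul d)
      (hZ.indepFun_comp (hem.const_mul d) zero_ne_one)
      (hGm.comp ((hZ.meas 0).prodMk ((hZ.meas 1).prodMk (hZ.meas 2))))
      fun _ => abs_angle_le_pi _ _)
  have hsum := hsub.add hlim
  rw [zero_add] at hsum
  have hval : ∫ ω, (d * e (X 0 ω, Y 0 ω)) * (d * e (X 1 ω, Y 1 ω)) *
      InnerProductGeometry.angle (X 0 ω - X 2 ω) (X 2 ω - X 1 ω) ∂P =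
      d ^ 2 * ∫ ω, e (X 0 ω, Y 0 ω) * e (X 1 ω, Y 1 ω) *
        InnerProductGeometry.angle (X 0 ω - X 2 ω) (X 2 ω - X 1 ω) ∂P := by
    rw [← integral_const_mul]
    congr 1
    funext ω
    ring
  rw [hval] at hsum
  refine hsum.congr fun q => ?_
  rw [sub_add_cancel, testStat_eq_tripleAvg]

/-- Under the alternative the residual at any parameter has nonzero mean on some event that is
determined by the predictor. -/
lemma Alternative.exists_setIntegral_ne_zero {b F : ℝ → ℝ} {K d : ℝ} {m : ℕ} {X : Ω → L2I}
    {Y : Ω → ℝ} (h : Alternative P m F X Y) (hL : IsLink b F K) (hd : 0 < d) (hm : 1 ≤ m)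
    (hX : Measurable X) (hX2 : MemLp X 2 P) {θ : ℝ × (ℝ → ℝ)} (hθ : MemSobolev m θ.2)
    (he2 : MemLp (fun ω => stdResidual F d θ (X ω, Y ω)) 2 P) :
    ∃ A, MeasurableSet A ∧ ∫ ω in X ⁻¹' A, stdResidual F d θ (X ω, Y ω) ∂P ≠ 0 := by
  by_contra! hA
  have hFm : Measurable fun x : L2I => F (linPred x θ) :=
    hL.continuous.measurable.comp (measurable_linPred hm hθ)
  have hF : Integrable (fun ω => F (linPred (X ω) θ)) P := by
    have h1 : Integrable (fun ω => |F 0| + K * |linPred (X ω) θ|) P :=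
      (integrable_const _).add
        (((memLp_linPred hX2 hm hθ).integrable one_le_two).abs.const_mul K)
    refine h1.mono' (hFm.comp hX).aestronglyMeasurable (Eventually.of_forall fun ω => ?_)
    have h2 := hL.lipschitz (linPred (X ω) θ) 0
    rw [sub_zero] at h2
    have h3 := abs_add_le (F 0) (F (linPred (X ω) θ) - F 0)
    rw [add_sub_cancel] at h3
    exact h3.trans (add_le_add_right h2 _)
  have he := he2.integrable one_le_two
  have hYeq : Y = fun ω => d * stdResidual F d θ (X ω, Y ω) + F (linPred (X ω) θ) := by
    funext ω
    rw [stdResidual, mul_div_cancel₀ _ hd.ne', residual, sub_add_cancel]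
  have hY : Integrable Y P := by
    rw [hYeq]
    exact (he.const_mul d).add hF
  have hle : sigmaX X ≤ (inferInstance : MeasurableSpace Ω) := hX.comap_le
  have hcond : (fun ω => F (linPred (X ω) θ)) =ᵐ[P] P[Y | sigmaX X] := by
    refine ae_eq_condExp_of_forall_setIntegral_eq hle hY (fun s _ _ => hF.integrableOn) ?_
      (hFm.comp (comap_measurable X)).stronglyMeasurable.aestronglyMeasurable
    rintro s ⟨A, hAm, rfl⟩ -
    have h1 : ∫ ω in X ⁻¹' A, Y ω ∂P = d * ∫ ω in X ⁻¹' A, stdResidual F d θ (X ω, Y ω) ∂P +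
        ∫ ω in X ⁻¹' A, F (linPred (X ω) θ) ∂P := by
      rw [← integral_const_mul, ← integral_add (he.const_mul d).integrableOn hF.integrableOn]
      exact congrArg (fun g : Ω → ℝ => ∫ ω in X ⁻¹' A, g ω ∂P) hYeq
    rw [h1, hA A hAm, mul_zero, zero_add]
  refine (h θ hθ).ne' ?_
  have := hcond.symm
  exact this

/-- The limit of the statistic is positive under the alternative. -/
lemma integral_stdResidual_mul_angle_pos {b F : ℝ → ℝ} {K d : ℝ} {m : ℕ} {X : ℕ → Ω → L2I}
    {Y : ℕ → Ω → ℝ} (hL : IsLink b F K) (hd : 0 < d) (hm : 1 ≤ m)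
    (hZ : IsIID P fun i ω => (X i ω, Y i ω)) (hX2 : MemLp (X 0) 2 P) {θ : ℝ × (ℝ → ℝ)}
    (hθ : MemSobolev m θ.2) (he2 : MemLp (fun ω => stdResidual F d θ (X 0 ω, Y 0 ω)) 2 P)
    (hmean : ∫ ω, stdResidual F d θ (X 0 ω, Y 0 ω) ∂P = 0)
    (halt : Alternative P m F (X 0) (Y 0)) :
    0 < ∫ ω, stdResidual F d θ (X 0 ω, Y 0 ω) * stdResidual F d θ (X 1 ω, Y 1 ω) *
      InnerProductGeometry.angle (X 0 ω - X 2 ω) (X 2 ω - X 1 ω) ∂P := by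
  set e : L2I × ℝ → ℝ := stdResidual F d θ with he
  have hem : Measurable e := measurable_stdResidual hL d hm hθ
  have hZ0 := hZ.meas 0
  have hX0 : Measurable (X 0) := measurable_fst.comp hZ0
  obtain ⟨A, hAm, hA⟩ := halt.exists_setIntegral_ne_zero hL hd hm hX0 hX2 hθ he2
  have hprob : IsProbabilityMeasure (P.map fun ω => (X 0 ω, Y 0 ω)) :=
    Measure.isProbabilityMeasure_map hZ0.aemeasurable
  have hpos := integral_mul_angle_pos (μ := P.map fun ω => (X 0 ω, Y 0 ω)) (f := e)
    (X := (Prod.fst : L2I × ℝ → L2I))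
    ((integrable_map_measure hem.aestronglyMeasurable hZ0.aemeasurable).2
      (he2.integrable one_le_two)) measurable_fst
    (by rw [integral_map hZ0.aemeasurable hem.aestronglyMeasurable]; exact hmean)
    ⟨A, hAm, by
      rw [setIntegral_map (measurable_fst hAm) hem.aestronglyMeasurable hZ0.aemeasurable]
      exact hA⟩
  rw [← hZ.map_triple (i := 2) (j := 0) (k := 1) (by norm_num) (by norm_num) (by norm_num),
    integral_map ((hZ.meas 2).prodMk ((hZ.meas 0).prodMk (hZ.meas 1))).aemeasurable] at hpos
  · exact hpos
  · refine Measurable.aestronglyMeasurable ?_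
    exact ((hem.comp measurable_snd.fst).mul (hem.comp measurable_snd.snd)).mul
      (measurable_angle (measurable_snd.fst.fst.sub measurable_fst.fst)
        (measurable_fst.fst.sub measurable_snd.snd.fst))

end

/-- A statistic with a positive limit in probability, multiplied by a sequence that tends to
infinity. -/
lemma tendsto_measure_mul_le {Ω : Type*} [MeasurableSpace Ω] {P : Measure Ω}
    {T : ℕ → Ω → ℝ} {c : ℝ} (hc : 0 < c)
    (hT : Tendsto (fun q : ℕ × Ω => T q.1 q.2) (probFilter P) (𝓝 c)) {r : ℕ → ℝ}
    (hr : Tendsto r atTop atTop) (M : ℝ) :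
    Tendsto (fun n => P {ω | r n * T n ω ≤ M}) atTop (𝓝 0) := by
  have h1 := (hr.comp tendsto_fst_probFilter).atTop_mul_pos hc hT
  have h2 := eventually_probFilter.1 (h1.eventually_gt_atTop M)
  simpa only [not_lt, Function.comp_apply] using h2

/-! ### The assumptions of the theorem -/

/-- As `n ≥ n ^ (1 / 2)`, already the first rate condition makes `n h` diverge. -/
lemma RateAssumption.tendsto_mul_bandwidth {m : ℕ} {a k : ℝ} {lam : ℕ → ℝ}
    (h : RateAssumption m a k lam) :
    Tendsto (fun n : ℕ => (n : ℝ) * bandwidth k (lam n)) atTop atTop := by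
  have hb : ∀ n, 0 < bandwidth k (lam n) := fun n => Real.rpow_pos_of_pos (h.pos n) _
  have h1 : Tendsto (fun n : ℕ => (n : ℝ) ^ (-(1 / 2) : ℝ) * (bandwidth k (lam n))⁻¹) atTop
      (𝓝[>] 0) := by
    refine tendsto_nhdsWithin_iff.2 ⟨h.nh_large, ?_⟩
    filter_upwards [eventually_gt_atTop 0] with n hn
    have : (0 : ℝ) < n := by exact_mod_cast hn
    exact mul_pos (Real.rpow_pos_of_pos this _) (inv_pos.2 (hb n))
  refine tendsto_atTop_mono' _ ?_ h1.inv_tendsto_nhdsGT_zero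
  filter_upwards [eventually_gt_atTop 0] with n hn
  have hn1 : (1 : ℝ) ≤ n := by exact_mod_cast hn
  rw [Pi.inv_apply, mul_inv, inv_inv, Real.rpow_neg (by positivity), inv_inv]
  refine mul_le_mul_of_nonneg_right ?_ (hb n).le
  calc (n : ℝ) ^ (1 / 2 : ℝ) ≤ (n : ℝ) ^ (1 : ℝ) :=
        Real.rpow_le_rpow_of_exponent_le hn1 (by norm_num)
    _ = n := Real.rpow_one _

lemma RateAssumption.tendsto_lam {m : ℕ} {a k : ℝ} {lam : ℕ → ℝ} (h : RateAssumption m a k lam)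
    (hk : 0 < k) : Tendsto lam atTop (𝓝 0) := by
  have h1 := h.h_small.rpow_const (p := 2 * k) (Or.inr (by positivity))
  rw [Real.zero_rpow (by positivity)] at h1
  exact h1.congr fun n => bandwidth_rpow hk.ne' (h.pos n)

lemma EigenAssumption.exists_isEigenSystem {m : ℕ} {C : ℝ → ℝ → ℝ} {a k : ℝ}
    (h : EigenAssumption m C a k) : ∃ φ ρ, IsEigenSystem m C a k φ ρ := by
  obtain ⟨-, -, φ, ρ, h1, h2, h3, h4, h5, h6, ⟨c, hc, _, _, h7⟩, h8⟩ := h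
  exact ⟨φ, ρ, h1, h2, h3, h4, h5, h6, ⟨c, hc, h7.mono fun _ h => h.1⟩, h8⟩

lemma score_eq_stdResidual {𝒴 : Set ℝ} {ℓ : ℝ → ℝ → ℝ} {b c F : ℝ → ℝ} {K d : ℝ}
    (hL : IsLink b F K) (hform : ∀ y ∈ 𝒴, ∀ a, ℓ y a = (y * a - b a) / d + c y) {y : ℝ}
    (hy : y ∈ 𝒴) (θ : ℝ × (ℝ → ℝ)) (x : L2I) : score ℓ θ x y = stdResidual F d θ (x, y) := by
  set η := linPred x θ with hη
  have h1 : HasDerivAt (fun a => (y * a - b a) / d + c y) ((y * 1 - F η) / d) η :=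
    ((((hasDerivAt_id η).const_mul y).sub (hL.hasDerivAt η)).div_const d).add_const _
  rw [mul_one] at h1
  exact (h1.congr_of_eventuallyEq (Eventually.of_forall fun a => hform y hy a)).deriv

lemma ModelAssumption.exists_isWeightedProcess {Ω : Type*} [MeasurableSpace Ω] {P : Measure Ω}
    {𝒴 : Set ℝ} {ℓ : ℝ → ℝ → ℝ} {X : Ω → L2I} {x : Ω → ℝ → ℝ} {Y : Ω → ℝ} {θ₀ : ℝ × (ℝ → ℝ)}
    (h : ModelAssumption P 𝒴 ℓ X x Y θ₀) (hX : Measurable X) (hX2 : MemLp X 2 P)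
    (hx : IsProcessOf P X x) (hcov : CovarianceAssumption P (weightB P ℓ X Y θ₀) x) :
    ∃ C, IsWeightedProcess P (weightB P ℓ X Y θ₀) X x C := by
  obtain ⟨C, hC, hb⟩ := h.weight_bounds
  exact ⟨C, hX2, (stronglyMeasurable_condExp.mono hX.comap_le).neg.aestronglyMeasurable, hC,
    hb, hx, h.centred, hcov.sq_integrable⟩

end GFLM

end

open GFLM

theorem theorem2 {Ω : Type*} [MeasurableSpace Ω] (P : Measure Ω) [IsProbabilityMeasure P]
    -- the model
    (𝒴 : Set ℝ) (ℓ : ℝ → ℝ → ℝ) (F : ℝ → ℝ) (d : ℝ) (hℓ : GFLM.IsExpFamilyLogLik 𝒴 ℓ F d)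
    (m : ℕ) (hm : 1 ≤ m)
    -- the i.i.d. data; `(X 0, Y 0)` plays the role of the generic pair `(X, Y)`
    (X : ℕ → Ω → GFLM.L2I) (Y : ℕ → Ω → ℝ)
    (hX : ∀ i, Measurable (X i)) (hY : ∀ i, Measurable (Y i))
    (hind : iIndepFun (fun i ω => (X i ω, Y i ω)) P)
    (hident : ∀ i, IdentDistrib (fun ω => (X i ω, Y i ω)) (fun ω => (X 0 ω, Y 0 ω)) P P)
    (h𝒴 : ∀ i, ∀ᵐ ω ∂P, Y i ω ∈ 𝒴)
    -- pointwise values of the predictor process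
    (x : Ω → ℝ → ℝ) (hx : GFLM.IsProcessOf P (X 0) x)
    -- standing assumptions
    (θ₀ : ℝ × (ℝ → ℝ)) (hθ₀ : θ₀ ∈ GFLM.paramSpace m)
    (hmodel : GFLM.ModelAssumption P 𝒴 ℓ (X 0) x (Y 0) θ₀)
    (hcov : GFLM.CovarianceAssumption P (GFLM.weightB P ℓ (X 0) (Y 0) θ₀) x)
    (a k : ℝ)
    (heigen : GFLM.EigenAssumption m
      (GFLM.covFun P (GFLM.weightB P ℓ (X 0) (Y 0) θ₀) x) a k)
    (hmoment : GFLM.MomentAssumption P m (X 0))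
    (lam : ℕ → ℝ) (hrate : GFLM.RateAssumption m a k lam)
    -- the pseudo-true parameter and the alternative
    (θt : ℝ × (ℝ → ℝ)) (hθt : GFLM.IsPseudoTrue P m ℓ (X 0) (Y 0) θt)
    (hH₁ : GFLM.Alternative P m F (X 0) (Y 0))
    -- the penalized estimators, which exist with probability tending to one
    (θhat : ℕ → Ω → ℝ × (ℝ → ℝ))
    (hθhat : Tendsto (fun n => P {ω | ¬ GFLM.IsEstimate ℓ m (lam n) n
      (fun i => X i ω) (fun i => Y i ω) (θhat n ω)}) atTop (𝓝 0))
    -- the truncation dimension and the estimated eigenfunctions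
    (p : ℕ → ℕ) (hp_top : Tendsto p atTop atTop)
    (hp : (fun n => (p n : ℝ)) =o[atTop] fun n : ℕ => (n : ℝ) ^ (1 / 4 : ℝ))
    (ψ : (n : ℕ) → Ω → Fin (p n) → GFLM.L2I)
    (hψ : ∀ n, ∀ᵐ ω ∂P, GFLM.IsEstimatedFPC n (p n) (fun i => X i ω) (ψ n ω))
    -- the test statistic
    (T : ℕ → Ω → ℝ)
    (hT : ∀ n ω, T n ω = GFLM.testStat F n (fun i => X i ω) (fun i => Y i ω) (θhat n ω) (ψ n ω)) :
    TendstoInMeasure P T atTop (fun _ => d ^ 2 * GFLM.scoreAngleMean P ℓ θt X Y) ∧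
    0 < GFLM.scoreAngleMean P ℓ θt X Y ∧
    ∀ M : ℝ, Tendsto (fun n : ℕ => P {ω | (n : ℝ) * GFLM.bandwidth k (lam n) * T n ω ≤ M})
      atTop (𝓝 0) := by
  have hZ : IsIID P fun i ω => (X i ω, Y i ω) :=
    ⟨fun i => (hX i).prodMk (hY i), hind, hident⟩
  have hd := hℓ.dispersion_pos
  obtain ⟨C₀, -, C₁, -, htails, -⟩ := hmodel.tails
  obtain ⟨ω₀, hω₀, hbdd⟩ := ((h𝒴 0).and htails.1).exists
  obtain ⟨b, c, K, hL, hform⟩ := hℓ.exists_isLink hω₀ (hmodel.smooth _ hω₀)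
    (hmodel.concave _ hω₀) hbdd
  -- moments of the predictor
  obtain ⟨s, ⟨hs, -⟩, hexp⟩ := hmoment.exp_moment
  have h4 := integrable_norm_pow_of_exp (hX 0) hs hexp 4
  have hX2 : MemLp (X 0) 2 P :=
    (memLp_two_iff_integrable_sq_norm (hX 0).aestronglyMeasurable).2
      (integrable_norm_pow_of_exp (hX 0) hs hexp 2)
  -- the features and their weights
  obtain ⟨ha, hak, -⟩ := id heigen
  obtain ⟨φ, ρ, hE⟩ := heigen.exists_isEigenSystem
  obtain ⟨C, hW⟩ := hmodel.exists_isWeightedProcess (hX 0) hX2 hx hcov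
  obtain ⟨M₀, hM₀, hfourth⟩ := hmoment.fourth
  -- residuals at the pseudo-true parameter
  have hθm : MemSobolev m θt.2 := hθt.1
  have hscore : ∀ i θ, ∀ᵐ ω ∂P, score ℓ θ (X i ω) (Y i ω) = stdResidual F d θ (X i ω, Y i ω) :=
    fun i θ => (h𝒴 i).mono fun ω hω => score_eq_stdResidual hL hform hω θ _
  have he2 : MemLp (fun ω => stdResidual F d θt (X 0 ω, Y 0 ω)) 2 P :=
    memLp_stdResidual_of_memLp hL hd hm hX2 (hX 0) (hY 0) hθ₀ hθm
      ((memLp_congr_ae (hscore 0 θ₀)).1 hmodel.score_sq)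
  have hfoc : ∀ δ : ℝ × (ℝ → ℝ), MemSobolev m δ.2 →
      ∫ ω, stdResidual F d θt (X 0 ω, Y 0 ω) * linPred (X 0 ω) δ ∂P = 0 := fun δ hδ =>
    hθt.integral_stdResidual_mul hL hform hd hm hX2 (h𝒴 0) he2 hδ
  have hone : ∀ x : L2I, linPred x (1, fun _ => 0) = 1 := fun x => by simp [linPred]
  have hmean : ∫ ω, stdResidual F d θt (X 0 ω, Y 0 ω) ∂P = 0 := by
    simpa [hone] using hfoc (1, fun _ => 0) (MemSobolev.zero m)
  have hfeature : ∀ i, ∫ ω, stdResidual F d θt (X 0 ω, Y 0 ω) *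
      feature φ i (X 0 ω, Y 0 ω) ∂P = 0
    | 0 => by simpa [feature] using hmean
    | i + 1 => by
      refine Eq.trans ?_ (hfoc (0, φ i) (hE.mem i))
      congr 1
      funext ω
      rw [linPred_curve ((hE.mem i).memLp hm), zero_add]
      rfl
  have hT' : Tendsto (fun q : ℕ × Ω => T q.1 q.2) (probFilter P)
      (𝓝 (d ^ 2 * scoreAngleMean P ℓ θt X Y)) ∧ 0 < scoreAngleMean P ℓ θt X Y := by
    have hmean_eq : scoreAngleMean P ℓ θt X Y = ∫ ω, stdResidual F d θt (X 0 ω, Y 0 ω) *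
        stdResidual F d θt (X 1 ω, Y 1 ω) *
        InnerProductGeometry.angle (X 0 ω - X 2 ω) (X 2 ω - X 1 ω) ∂P := by
      refine integral_congr_ae ?_
      filter_upwards [hscore 0 θt, hscore 1 θt] with ω h0 h1
      rw [h0, h1]
    rw [hmean_eq]
    refine ⟨?_, integral_stdResidual_mul_angle_pos hL hd hm hZ hX2 hθm he2 hmean hH₁⟩
    simp only [hT]
    refine tendsto_testStat hL hd hm hZ hX2 hθm he2 hp_top hψ fun ε hε => ?_
    exact eventually_avg_bregman_le hL hform hd hm hZ h𝒴
      (hE.isFeatureSystem hm hW h4 hM₀ hfourth) (hE.isWeightSystem ha hak hm hrate) hrate.pos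
      (hrate.tendsto_lam (by linarith))
      (Q := fun θ => θ.1 ^ 2 + wForm P (weightB P ℓ (X 0) (Y 0) θ₀) (X 0) (curve θ.2) (curve θ.2))
      (fun θ => add_nonneg (sq_nonneg _) (hW.wForm_self_nonneg _))
      (fun θ hθ => hE.expands_linPred hak hm hW hcov.injective hθ)
      (fun n θ hθ => hE.inEllipsoid_coeffs hm hW hθ (hrate.pos n).le)
      (fun θ hθ r hr => hE.exists_le_sum_coeffs_sq hm hW hθ hr) hθm
      (measurable_stdResidual hL d hm hθm) he2 hfeature
      ((measurable_linPred hm hθm).comp measurable_fst) (eventually_probFilter.2 hθhat) hε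
  exact ⟨tendstoInMeasure_iff_probFilter.2 hT'.1, hT'.2,
    tendsto_measure_mul_le (mul_pos (by positivity) hT'.2) hT'.1 hrate.tendsto_mul_bandwidth⟩
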